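/- Let $n\ge 1$, $\Omega\subset\mathbb R^n$ open, $s\in(0,1)$, $p\in(1,\infty)$, $m\in[p,\infty)$, and let $W:[-1,1]\to[0,\infty)$ be lower semicontinuous and such that, for some $\lambda\in(0,1]$, $\Lambda\in[1,\infty)$, $\theta\in(-1,1)$, $q\in(0,1)$, $c_1\in(0,\infty)$, $$\lambda\,\chi_{(-\infty,\theta]}(x)\,|1+x|^m\le W(x)\le\Lambda|1+x|^m\quad\text{for all }x\in[-1,1],$$ $$W(t)-W(r)\ge c_1(t-r)|1+r|^{m-1}+c_1(t-r)^{k}\quad\text{whenever }-1\le r\le t\le-1+q,$$ where $k=\lceil m\rceil$ is the smallest integer $\geq m$. For measurable $u:\mathbb R^n\to\mathbb R$ set $$\mathcal K_s^p(u,\Omega)=\frac12\int_\Omega\int_\Omega\frac{|u(x)-u(y)|^p}{|x-y|^{n+sp}}\,dx\,dy+\int_\Omega\int_{\mathbb R^n\setminus\Omega}\frac{|u(x)-u(y)|^p}{|x-y|^{n+sp}}\,dx\,dy,$$ $$\mathcal E_s^p(u,\Omega)=(1-s)\mathcal K_s^p(u,\Omega)+\int_\Omega W(u)\,dx .$$ Let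 $X^{s,p}(\Omega)$ be the set of measurable $u:\mathbb R^n\to\mathbb R$ with $\mathcal K_s^p(u,\Omega)<\infty$ and $\|u\|_{L^\infty(\mathbb R^n)}\le1$. For $\epsilon\ge0$ and $\Omega$ bounded, $u\in X^{s,p}(\Omega)$ is called an $\epsilon$-minimizer for $\mathcal E_s^p$ in $\Omega$ if $\mathcal E_s^p(u,\Omega)\le\epsilon+\mathcal E_s^p(v,\Omega)$ for every $v\in X^{s,p}(\Omega)$ with $v=u$ a.e. in $\mathbb R^n\setminus\Omega$; for $\Omega$ unbounded, $u\in X^{s,p}(\Omega)$ is called an $\epsilon$-minimizer in $\Omega$ if it is an $\epsilon$-minimizer in every open $\Omega'\subset\subset\Omega$. Write $B_r$ for the open ball of radius $r$ centred at $0$ and $\mathcal L^n$ for the Lebesgue measure. **Theorem (density estimates for $\epsilon$-minimizers).** Let $\theta_1,\theta_2\in(-1,\theta]$, $\theta_*=\min\{\theta_1,\theta_2,-1+q\}$ and $\theta^*=\max\{\theta_1,\theta_2,-1+q\}$. Let $u\in X^{s,p}(\Omega)$ and $c_0,r_0\in(0,\infty)$ be such that $B_{r_0}\subset\Omega$ and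 $$\mathcal L^n(B_{r_0}\cap\{u>\theta_1\})>c_0.$$ Then there exists $\delta\in(0,\infty)$, depending only on $s,n,p,m,c_1,\theta_*,c_0$, such that, if $\epsilon\in[0,\delta)$ and $u$ is an $\epsilon$-minimizer for $\mathcal E_s^p$ in $\Omega$, the following holds: there exist $R^*\in[r_0,\infty)$, depending only on $s,n,p,m,c_1,\theta_*,r_0$; $\tilde c\in(0,1)$, depending only on $s,n,p,m,\Lambda,c_1,\theta_*,r_0,c_0$; and $c\in(0,\infty)$, depending only on $m,\theta_*$, such that, for every $r\in[R^*,\infty)$ with $B_{3r}\subset\Omega$, $$c\int_{B_r\cap\{\theta_*<u\le\theta^*\}}|1+u(x)|^m\,dx+\mathcal L^n(B_r\cap\{u>\theta_2\})>\tilde c\,r^n.$$ -/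

import Mathlib

open MeasureTheory Set
open scoped ENNReal

noncomputable section

namespace NonlocalPhase

/-- The structural assumptions on the potential. `W` is a function on `[-1,1]`: only its values on
`Icc (-1) 1` are constrained (and only these matter below). Nonnegativity of `W` on `[-1,1]`
is part of `bounds`. The exponent `⌈m⌉₊` is `m` if `m` is an integer, and `[m] + 1` otherwise. -/
structure IsDegeneratePotential (W : ℝ → ℝ) (m lam Lam θ q c₁ : ℝ) : Prop where
  lam_mem : lam ∈ Ioc (0 : ℝ) 1
  Lam_mem : Lam ∈ Ici (1 : ℝ)
  theta_mem : θ ∈ Ioo (-1 : ℝ) 1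
  q_mem : q ∈ Ioo (0 : ℝ) 1
  c₁_pos : 0 < c₁
  lsc : LowerSemicontinuousOn W (Icc (-1) 1)
  bounds : ∀ x ∈ Icc (-1 : ℝ) 1,
    lam * (Iic θ).indicator (fun _ => (1 : ℝ)) x * |1 + x| ^ m ≤ W x ∧ W x ≤ Lam * |1 + x| ^ m
  growth : ∀ r t : ℝ, -1 ≤ r → r ≤ t → t ≤ -1 + q →
    c₁ * (t - r) * |1 + r| ^ (m - 1) + c₁ * (t - r) ^ ⌈m⌉₊ ≤ W t - W r

variable {n : ℕ}

/-- The integrand `|u(x) - u(y)|^p / |x - y|^(n + s p)`. -/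
def gagliardo (s p : ℝ) (u : EuclideanSpace ℝ (Fin n) → ℝ) (x y : EuclideanSpace ℝ (Fin n)) :
    ℝ≥0∞ :=
  ENNReal.ofReal (|u x - u y| ^ p / ‖x - y‖ ^ ((n : ℝ) + s * p))

/-- The kinetic energy `K_s^p(u, Ω)`. -/
def kinetic (s p : ℝ) (u : EuclideanSpace ℝ (Fin n) → ℝ) (Ω : Set (EuclideanSpace ℝ (Fin n))) :
    ℝ≥0∞ :=
  (1 / 2) * (∫⁻ x in Ω, ∫⁻ y in Ω, gagliardo s p u x y)
    + ∫⁻ x in Ω, ∫⁻ y in Ωᶜ, gagliardo s p u x y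

/-- The renormalized energy `E_s^p(u, Ω) = (1 - s) K_s^p(u, Ω) + ∫_Ω W(u)`. -/
def energy (W : ℝ → ℝ) (s p : ℝ) (u : EuclideanSpace ℝ (Fin n) → ℝ)
    (Ω : Set (EuclideanSpace ℝ (Fin n))) : ℝ≥0∞ :=
  ENNReal.ofReal (1 - s) * kinetic s p u Ω + ∫⁻ x in Ω, ENNReal.ofReal (W (u x))

/-- The space `X^{s,p}(Ω)`: (Lebesgue) measurable `u : ℝⁿ → ℝ` with finite kinetic energy in `Ω`
and `‖u‖_{L^∞(ℝⁿ)} ≤ 1`. -/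
def X (s p : ℝ) (Ω : Set (EuclideanSpace ℝ (Fin n))) : Set (EuclideanSpace ℝ (Fin n) → ℝ) :=
  {u | AEMeasurable u volume ∧ kinetic s p u Ω < ∞ ∧ ∀ᵐ x, |u x| ≤ 1}

/-- The space `X_f^{s,p}(Ω)` of functions of `X^{s,p}(Ω)` which equal `f` a.e. outside `Ω`. -/
def XTrace (s p : ℝ) (f : EuclideanSpace ℝ (Fin n) → ℝ) (Ω : Set (EuclideanSpace ℝ (Fin n))) :
    Set (EuclideanSpace ℝ (Fin n) → ℝ) :=
  {u | u ∈ X s p Ω ∧ ∀ᵐ x, x ∉ Ω → u x = f x}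

/-- The `ε`-minimality inequality in `Ω`, among all competitors with the same exterior values. -/
def EpsMinimizes (W : ℝ → ℝ) (s p ε : ℝ) (u : EuclideanSpace ℝ (Fin n) → ℝ)
    (Ω : Set (EuclideanSpace ℝ (Fin n))) : Prop :=
  u ∈ X s p Ω ∧ ∀ v ∈ XTrace s p u Ω, energy W s p u Ω ≤ ENNReal.ofReal ε + energy W s p v Ω

/-- `u ∈ X^{s,p}(Ω)` is an `ε`-minimizer: if `Ω` is bounded, the inequality holds in `Ω`; if `Ω` is
unbounded, it holds in every open `Ω'` compactly contained in `Ω`. -/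
def IsEpsMinimizer (W : ℝ → ℝ) (s p ε : ℝ) (u : EuclideanSpace ℝ (Fin n) → ℝ)
    (Ω : Set (EuclideanSpace ℝ (Fin n))) : Prop :=
  u ∈ X s p Ω ∧
    (Bornology.IsBounded Ω → EpsMinimizes W s p ε u Ω) ∧
    (¬ Bornology.IsBounded Ω → ∀ Ω' : Set (EuclideanSpace ℝ (Fin n)), IsOpen Ω' →
      IsCompact (closure Ω') → closure Ω' ⊆ Ω → EpsMinimizes W s p ε u Ω')

end NonlocalPhase

end

/-!
Compare `u` with `min u w`, where the barrier `w` equals `1` outside `B_R`, is close to `-1` well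
inside `B_R`, approaches `-1` like a power of the distance to the sphere, and is almost a
supersolution of the fractional `p`-Laplacian. Since `W` grows at least like `|1 + u|^(m-1)` near
`-1`, `ε`-minimality then bounds the nonlocal perimeter of a set containing
`B_{R-K} ∩ {u > θ_*}` by `ε` plus the integral of `(1 + R - |x|)^(-sp)` over `B_R ∩ {u > θ_*}`.

The nonlocal isoperimetric inequality bounds this perimeter from below. At a single radius this says
little, because the measure of `{u > θ_*}` could concentrate near the sphere, where the weight is
large. Averaging over `2^(N + i₀)` consecutive radii replaces the weight by its mean, which is small
compared with the isoperimetric constant at scale `2^N` once `i₀` is large, uniformly in `N`. The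
measure of `B_R ∩ {u > θ_*}` therefore grows by a factor `2^n` each time the radius doubles, while
`ε` is absorbed into the perimeter, which is bounded below already by the initial measure.
-/

noncomputable section

namespace NonlocalPhase

open Filter Metric Module
open scoped NNReal Pointwise Topology

/-! ### Signed powers -/

/-- The odd extension `t ↦ |t| ^ (r - 1) * t` of `t ↦ t ^ r` from `[0, ∞)` to the real line. For
`r = p - 1` it is the nonlinearity of the fractional `p`-Laplacian. The encoding as a difference of
powers of the positive and negative parts avoids the junk value of `|0| ^ (r - 1)` for `r < 1`. -/
def spow (r t : ℝ) : ℝ := (max t 0) ^ r - (max (-t) 0) ^ r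

section SignedPower

variable {p r : ℝ}

lemma spow_of_nonneg (hr : 0 < r) {t : ℝ} (ht : 0 ≤ t) : spow r t = t ^ r := by
  simp [spow, ht, Real.zero_rpow hr.ne']

lemma spow_neg (r t : ℝ) : spow r (-t) = -spow r t := by
  simp [spow]

lemma spow_of_nonpos (hr : 0 < r) {t : ℝ} (ht : t ≤ 0) : spow r t = -(-t) ^ r := by
  rw [← spow_of_nonneg hr (neg_nonneg.2 ht), spow_neg, neg_neg]

lemma continuous_spow (hr : 0 < r) : Continuous (spow r) :=
  ((continuous_id.max continuous_const).rpow_const fun _ => Or.inr hr.le).sub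
    ((continuous_neg.max continuous_const).rpow_const fun _ => Or.inr hr.le)

lemma spow_eq_sign_mul (hr : 0 < r) (t : ℝ) : spow r t = SignType.sign t * |t| ^ r := by
  rcases lt_trichotomy t 0 with ht | rfl | ht
  · simp [spow_of_nonpos hr ht.le, abs_of_neg ht, sign_neg ht]
  · simp [spow]
  · simp [spow_of_nonneg hr ht.le, abs_of_pos ht, sign_pos ht]

lemma abs_spow (hr : 0 < r) (t : ℝ) : |spow r t| = |t| ^ r := by
  rcases le_total 0 t with ht | ht
  · rw [spow_of_nonneg hr ht, abs_of_nonneg ht, abs_of_nonneg (by positivity)]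
  · rw [spow_of_nonpos hr ht, abs_neg, abs_of_nonpos ht,
      abs_of_nonneg (Real.rpow_nonneg (neg_nonneg.2 ht) _)]

lemma spow_mul (hr : 0 < r) (a b : ℝ) : spow r (a * b) = spow r a * spow r b := by
  simp only [spow_eq_sign_mul hr, sign_mul, SignType.coe_mul, abs_mul,
    Real.mul_rpow (abs_nonneg a) (abs_nonneg b)]
  ring

lemma strictMono_spow (hr : 0 < r) : StrictMono (spow r) := by
  refine strictMono_of_odd_strictMonoOn_nonneg (spow_neg r) fun a ha b hb hab => ?_
  rw [spow_of_nonneg hr ha, spow_of_nonneg hr hb]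
  exact Real.rpow_lt_rpow ha hab hr

lemma hasDerivAt_abs_rpow_spow (hp : 1 < p) (x : ℝ) :
    HasDerivAt (fun t : ℝ => |t| ^ p) (p * spow (p - 1) x) x := by
  convert hasDerivAt_abs_rpow x hp using 1
  rw [spow_eq_sign_mul (by linarith), mul_assoc]
  rcases eq_or_ne x 0 with rfl | hx
  · simp
  · rw [show p - 1 = (p - 2) + 1 by ring, Real.rpow_add_one (abs_ne_zero.2 hx)]
    linear_combination (p * |x| ^ (p - 2)) * sign_mul_abs x

lemma strictConvexOn_abs_rpow (hp : 1 < p) : StrictConvexOn ℝ univ fun t : ℝ => |t| ^ p := by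
  have hderiv : deriv (fun t : ℝ => |t| ^ p) = fun x => p * spow (p - 1) x :=
    funext fun x => (hasDerivAt_abs_rpow_spow hp x).deriv
  refine StrictMono.strictConvexOn_univ_of_deriv
    (continuous_abs.rpow_const fun _ => Or.inr (by linarith)) ?_
  rw [hderiv]
  exact (strictMono_spow (by linarith)).const_mul (by linarith)

lemma abs_rpow_tangent_lt (hp : 1 < p) {a b : ℝ} (hab : a ≠ b) :
    |b| ^ p + p * spow (p - 1) b * (a - b) < |a| ^ p := by
  have hderiv := hasDerivAt_abs_rpow_spow hp b
  rcases lt_or_gt_of_ne hab with h | h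
  · have := (strictConvexOn_abs_rpow hp).slope_lt_of_hasDerivAt (mem_univ a) (mem_univ b) h hderiv
    rw [slope_def_field, div_lt_iff₀ (by linarith)] at this
    linarith
  · have := (strictConvexOn_abs_rpow hp).lt_slope_of_hasDerivAt (mem_univ b) (mem_univ a) h hderiv
    rw [slope_def_field, lt_div_iff₀ (by linarith)] at this
    linarith

lemma abs_rpow_tangent_le (hp : 1 < p) (a b : ℝ) :
    |b| ^ p + p * spow (p - 1) b * (a - b) ≤ |a| ^ p := by
  rcases eq_or_ne a b with rfl | h
  · simp
  · exact (abs_rpow_tangent_lt hp h).le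

lemma exists_abs_rpow_tangent_add_le {β : ℝ} (hp : 1 < p) (hβ : 0 < β) (M : ℝ) :
    ∃ c : ℝ, 0 < c ∧ ∀ a b : ℝ, |a| ≤ M → |b| ≤ M → β ≤ |a - b| →
      |b| ^ p + p * spow (p - 1) b * (a - b) + c ≤ |a| ^ p := by
  set gap : ℝ × ℝ → ℝ := fun z => |z.1| ^ p - (|z.2| ^ p + p * spow (p - 1) z.2 * (z.1 - z.2))
  set K : Set (ℝ × ℝ) := (Icc (-M) M ×ˢ Icc (-M) M) ∩ {z | β ≤ |z.1 - z.2|}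
  have hgap : Continuous gap := by
    have hpow : Continuous fun t : ℝ => |t| ^ p :=
      continuous_abs.rpow_const fun _ => Or.inr (by linarith)
    exact (hpow.comp continuous_fst).sub ((hpow.comp continuous_snd).add
      ((continuous_const.mul ((continuous_spow (by linarith)).comp continuous_snd)).mul
        (continuous_fst.sub continuous_snd)))
  have hK : IsCompact K :=
    (isCompact_Icc.prod isCompact_Icc).inter_right (isClosed_le (by fun_prop) (by fun_prop))
  have hgap_pos : ∀ z ∈ K, 0 < gap z := by
    rintro z ⟨-, hz⟩
    have hne : z.1 ≠ z.2 := fun h => by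
      simp only [mem_ofPred_eq, h, sub_self, abs_zero] at hz
      linarith
    exact sub_pos.2 (abs_rpow_tangent_lt hp hne)
  obtain ⟨c, hc, hcK⟩ := hK.exists_forall_le' hgap.continuousOn hgap_pos
  refine ⟨c, hc, fun a b ha hb hab => ?_⟩
  linarith [hcK (a, b) ⟨⟨abs_le.1 ha, abs_le.1 hb⟩, hab⟩]

lemma rpow_le_max_self_one {x : ℝ} (hx : 0 ≤ x) (hr : 0 ≤ r) (hr1 : r ≤ 1) : x ^ r ≤ max x 1 := by
  rcases le_total x 1 with h | h
  · exact (Real.rpow_le_one hx h hr).trans (le_max_right _ _)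
  · exact (Real.rpow_le_self_of_one_le h hr1).trans (le_max_left _ _)

lemma min_self_one_le_rpow {x : ℝ} (hx : 0 ≤ x) (hr : 0 < r) (hr1 : r ≤ 1) : min x 1 ≤ x ^ r := by
  rcases le_total x 1 with h | h
  · exact (min_le_left _ _).trans (Real.self_le_rpow_of_le_one hx h hr1)
  · exact (min_le_right _ _).trans (Real.one_le_rpow h hr.le)

lemma abs_spow_one_add_sub_one_le_of_le_one (hr : 0 < r) (hr1 : r ≤ 1) (t : ℝ) :
    |spow r (1 + t) - 1| ≤ 2 * |t| := by
  rcases le_or_gt 0 (1 + t) with h | h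
  · rw [spow_of_nonneg hr h]
    have hupper := rpow_le_max_self_one h hr.le hr1
    have hlower := min_self_one_le_rpow h hr hr1
    rw [abs_le]
    constructor <;> grind
  · rw [spow_of_nonpos hr h.le, abs_of_nonpos (by
      linarith [Real.rpow_nonneg (neg_nonneg.2 h.le) r])]
    have hupper := rpow_le_max_self_one (neg_nonneg.2 h.le) hr.le hr1
    grind

lemma one_add_rpow_sub_one_le {t : ℝ} (hr : 1 ≤ r) (ht : 0 ≤ t) :
    (1 + t) ^ r - 1 ≤ r * t * (1 + t) ^ (r - 1) := by
  have h1t : 0 < 1 + t := by linarith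
  have hbernoulli : 1 + r * -(t / (1 + t)) ≤ (1 + -(t / (1 + t))) ^ r :=
    one_add_mul_self_le_rpow_one_add (by rw [neg_le_neg_iff, div_le_one h1t]; linarith) hr
  rw [show 1 + -(t / (1 + t)) = (1 + t)⁻¹ by field_simp; ring, Real.inv_rpow h1t.le] at hbernoulli
  have hpow : (1 + t) ^ r = (1 + t) ^ (r - 1) * (1 + t) := by
    rw [← Real.rpow_add_one h1t.ne', sub_add_cancel]
  have hpos : 0 < (1 + t) ^ r := by positivity
  have hmul := mul_le_mul_of_nonneg_left hbernoulli hpos.le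
  rw [mul_inv_cancel₀ hpos.ne', hpow] at hmul
  have hexpand : (1 + t) ^ (r - 1) * (1 + t) * (1 + r * -(t / (1 + t))) =
      (1 + t) ^ (r - 1) * (1 + t) - r * t * (1 + t) ^ (r - 1) := by
    field_simp
    ring
  linarith

lemma one_sub_spow_one_sub_le {s : ℝ} (hr : 1 ≤ r) (hs : 0 ≤ s) :
    1 - spow r (1 - s) ≤ (r + 1) * s * (1 + s) ^ (r - 1) := by
  have hr0 : 0 < r := by linarith
  have hpow_one : 1 ≤ (1 + s) ^ (r - 1) := Real.one_le_rpow (by linarith) (by linarith)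
  have hs_le : s ≤ s * (1 + s) ^ (r - 1) := le_mul_of_one_le_right hs hpow_one
  rcases le_total s 1 with hs1 | hs1
  · rw [spow_of_nonneg hr0 (by linarith)]
    have hbernoulli := one_add_mul_self_le_rpow_one_add (s := -s) (by linarith) hr
    rw [← sub_eq_add_neg] at hbernoulli
    nlinarith
  · rw [spow_of_nonpos hr0 (by linarith)]
    have hpow : (-(1 - s)) ^ r ≤ s * (1 + s) ^ (r - 1) := calc
      (-(1 - s)) ^ r ≤ s ^ r := Real.rpow_le_rpow (by linarith) (by linarith) hr0.le
      _ = s * s ^ (r - 1) := by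
        rw [mul_comm, ← Real.rpow_add_one (by linarith), sub_add_cancel]
      _ ≤ s * (1 + s) ^ (r - 1) := by
        gcongr
        linarith
    nlinarith

lemma abs_spow_one_add_sub_one_le_of_one_le (hr : 1 ≤ r) (t : ℝ) :
    |spow r (1 + t) - 1| ≤ (r + 1) * |t| * (1 + |t|) ^ (r - 1) := by
  have hr0 : 0 < r := by linarith
  rcases le_total 0 t with ht | ht
  · have hone : 1 ≤ (1 + t) ^ r := Real.one_le_rpow (by linarith) hr0.le
    have hincr := one_add_rpow_sub_one_le hr ht
    have hnonneg : 0 ≤ t * (1 + t) ^ (r - 1) := by positivity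
    rw [spow_of_nonneg hr0 (by linarith), abs_of_nonneg ht, abs_of_nonneg (by linarith)]
    linarith
  · have hle : spow r (1 + t) ≤ 1 := by
      simpa [spow_of_nonneg hr0] using (strictMono_spow hr0).monotone (by linarith : 1 + t ≤ 1)
    have hincr := one_sub_spow_one_sub_le hr (neg_nonneg.2 ht)
    rw [sub_neg_eq_add] at hincr
    rwa [abs_of_nonpos ht, abs_of_nonpos (by linarith), neg_sub]

lemma abs_spow_add_sub_eq (hr : 0 < r) {x : ℝ} (hx : x ≠ 0) (e : ℝ) :
    |spow r (x + e) - spow r x| = |x| ^ (r - 1) * (|x| * |spow r (1 + e / x) - 1|) := by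
  have hfactor : x + e = x * (1 + e / x) := by field_simp
  rw [hfactor, spow_mul hr, ← mul_sub_one, abs_mul, abs_spow hr, ← mul_assoc,
    ← Real.rpow_add_one (abs_ne_zero.2 hx), sub_add_cancel]

lemma abs_spow_add_sub_le_of_le_one (hr : 0 < r) (hr1 : r ≤ 1) {x : ℝ} (hx : x ≠ 0) (e : ℝ) :
    |spow r (x + e) - spow r x| ≤ 2 * |x| ^ (r - 1) * |e| := by
  rw [abs_spow_add_sub_eq hr hx]
  calc |x| ^ (r - 1) * (|x| * |spow r (1 + e / x) - 1|)
      ≤ |x| ^ (r - 1) * (|x| * (2 * |e / x|)) := by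
        gcongr
        exact abs_spow_one_add_sub_one_le_of_le_one hr hr1 _
    _ = 2 * |x| ^ (r - 1) * |e| := by
        have : |x| ≠ 0 := abs_ne_zero.2 hx
        rw [abs_div]
        field_simp

lemma abs_spow_add_sub_le_of_one_le (hr : 1 ≤ r) {x : ℝ} (hx : x ≠ 0) (e : ℝ) :
    |spow r (x + e) - spow r x| ≤ (r + 1) * |e| * (|x| + |e|) ^ (r - 1) := by
  have hx0 : 0 < |x| := abs_pos.2 hx
  rw [abs_spow_add_sub_eq (by linarith) hx]
  calc |x| ^ (r - 1) * (|x| * |spow r (1 + e / x) - 1|)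
      ≤ |x| ^ (r - 1) * (|x| * ((r + 1) * |e / x| * (1 + |e / x|) ^ (r - 1))) := by
        gcongr
        exact abs_spow_one_add_sub_one_le_of_one_le hr _
    _ = (r + 1) * |e| * (|x| ^ (r - 1) * (1 + |e| / |x|) ^ (r - 1)) := by
        rw [abs_div]
        field_simp
    _ = (r + 1) * |e| * (|x| + |e|) ^ (r - 1) := by
        rw [← Real.mul_rpow hx0.le (by positivity), mul_add, mul_div_cancel₀ _ hx0.ne', mul_one]

lemma exists_abs_spow_add_sub_le (hr : 0 < r) {C : ℝ} (hC : 0 ≤ C) :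
    ∃ C' : ℝ, 0 ≤ C' ∧ ∀ x e t ρ : ℝ, x ≠ 0 → |x| ≤ t → t ≤ ρ → |e| ≤ C * t ^ 2 / ρ →
      |spow r (x + e) - spow r x| ≤
        C' / ρ * (t ^ (r + 1 - min (r - 1) 0) * |x| ^ min (r - 1) 0) := by
  rcases le_total r 1 with hr1 | hr1
  · refine ⟨2 * C, by positivity, fun x e t ρ hx _ _ he => ?_⟩
    rw [min_eq_left (by linarith), show r + 1 - (r - 1) = (2 : ℕ) by push_cast; ring,
      Real.rpow_natCast]
    calc |spow r (x + e) - spow r x| ≤ 2 * |x| ^ (r - 1) * |e| :=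
          abs_spow_add_sub_le_of_le_one hr hr1 hx e
      _ ≤ 2 * |x| ^ (r - 1) * (C * t ^ 2 / ρ) := by gcongr
      _ = 2 * C / ρ * (t ^ 2 * |x| ^ (r - 1)) := by ring
  · refine ⟨(r + 1) * C * (1 + C) ^ (r - 1), by positivity, fun x e t ρ hx hxt htρ he => ?_⟩
    have ht : 0 < t := (abs_pos.2 hx).trans_le hxt
    have hρ : 0 < ρ := ht.trans_le htρ
    have he_le : |e| ≤ C * t := he.trans (by
      rw [div_le_iff₀ hρ, pow_two, ← mul_assoc]
      gcongr)
    rw [min_eq_right (by linarith), sub_zero, Real.rpow_zero, mul_one]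
    calc |spow r (x + e) - spow r x| ≤ (r + 1) * |e| * (|x| + |e|) ^ (r - 1) :=
          abs_spow_add_sub_le_of_one_le hr1 hx e
      _ ≤ (r + 1) * (C * t ^ 2 / ρ) * ((1 + C) * t) ^ (r - 1) := by
          gcongr
          linarith
      _ = (r + 1) * C * (1 + C) ^ (r - 1) / ρ * t ^ (r + 1) := by
          rw [Real.mul_rpow (by linarith) ht.le, show r + 1 = (2 : ℕ) + (r - 1) by push_cast; ring,
            Real.rpow_add ht, Real.rpow_natCast]
          push_cast
          ring

end SignedPower

lemma one_sub_mul_le_rpow_neg {x γ : ℝ} (hx : 0 < x) (hγ : 0 ≤ γ) :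
    1 - γ * (x - 1) ≤ x ^ (-γ) := by
  rw [Real.rpow_def_of_pos hx]
  have hlog := Real.log_le_sub_one_of_pos hx
  have hexp := Real.add_one_le_exp (Real.log x * -γ)
  nlinarith

lemma rpow_neg_le_one_add {x γ : ℝ} (hx : 0 < x) (hγ : 0 ≤ γ) :
    x ^ (-γ) ≤ 1 + γ * x ^ (-(γ + 1)) * (1 - x) := by
  have hinv : x⁻¹ ^ (-γ) * x ^ (-γ) = 1 := by
    rw [← Real.mul_rpow (inv_pos.2 hx).le hx.le, inv_mul_cancel₀ hx.ne', Real.one_rpow]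
  have hpow : x ^ (-(γ + 1)) = x ^ (-γ) * x⁻¹ := by
    rw [neg_add, Real.rpow_add hx, Real.rpow_neg_one]
  have htangent : (1 - γ * (x⁻¹ - 1)) * x ^ (-γ) ≤ 1 :=
    (mul_le_mul_of_nonneg_right (one_sub_mul_le_rpow_neg (inv_pos.2 hx) hγ) (by positivity)).trans
      hinv.le
  have hexpand : (1 - γ * (x⁻¹ - 1)) * x ^ (-γ) = x ^ (-γ) - γ * x ^ (-(γ + 1)) * (1 - x) := by
    rw [hpow]
    field_simp
  linarith

lemma mul_one_sub_rpow_neg_sub_one_le {γ q : ℝ} (hγ : 0 ≤ γ) (hq : q ≤ 1 / 2) :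
    q * ((1 - q) ^ (-γ) - 1) ≤ γ * 2 ^ (γ + 1) * q ^ 2 := by
  have hx : 0 < 1 - q := by linarith
  rcases le_total 0 q with h | h
  · have hpow : (1 - q) ^ (-(γ + 1)) ≤ 2 ^ (γ + 1) := calc
      (1 - q) ^ (-(γ + 1)) ≤ 2⁻¹ ^ (-(γ + 1)) :=
        Real.rpow_le_rpow_of_nonpos (by norm_num) (by linarith) (by linarith)
      _ = 2 ^ (γ + 1) := by rw [Real.inv_rpow zero_le_two, Real.rpow_neg zero_le_two, inv_inv]
    calc q * ((1 - q) ^ (-γ) - 1) ≤ q * (γ * (1 - q) ^ (-(γ + 1)) * (1 - (1 - q))) := by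
          gcongr
          linarith [rpow_neg_le_one_add hx hγ]
      _ ≤ q * (γ * 2 ^ (γ + 1) * (1 - (1 - q))) := by
          gcongr
          linarith
      _ = γ * 2 ^ (γ + 1) * q ^ 2 := by ring
  · calc q * ((1 - q) ^ (-γ) - 1) ≤ q * (1 - γ * (1 - q - 1) - 1) :=
          mul_le_mul_of_nonpos_left (sub_le_sub_right (one_sub_mul_le_rpow_neg hx hγ) _) h
      _ = γ * 1 * q ^ 2 := by ring
      _ ≤ γ * 2 ^ (γ + 1) * q ^ 2 := by
          gcongr
          exact Real.one_le_rpow one_le_two (by linarith)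

lemma one_sub_rpow_neg_le {β q : ℝ} (hβ : 0 ≤ β) (hq : q ≤ 1 / 2) :
    (1 - q) ^ (-β) ≤ 1 + β * q + β * (β + 1) * 2 ^ (β + 2) * q ^ 2 := by
  have htangent := rpow_neg_le_one_add (by linarith : 0 < 1 - q) hβ
  have hquad := mul_le_mul_of_nonneg_left
    (mul_one_sub_rpow_neg_sub_one_le (by linarith : 0 ≤ β + 1) hq) hβ
  rw [add_assoc β 1 1, one_add_one_eq_two] at hquad
  linarith

/-! ### Homogeneous functions and the fractional kernel -/

section Annuli

variable {E : Type*} [NormedAddCommGroup E] [NormedSpace ℝ E]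

lemma ball_subset_iUnion_smul_annulus :
    ball (0 : E) 1 ⊆
      {0} ∪ ⋃ j : ℕ, (2⁻¹ : ℝ) ^ j • (closedBall (0 : E) 1 \ closedBall 0 (1 / 2)) := by
  intro k hk
  rcases eq_or_ne k 0 with rfl | hk0
  · exact Or.inl rfl
  obtain ⟨j, hlt, hle⟩ := exists_nat_pow_near_of_lt_one (norm_pos_iff.2 hk0)
    (mem_ball_zero_iff.1 hk).le (by norm_num : (0 : ℝ) < 2⁻¹) (by norm_num)
  refine Or.inr (mem_iUnion.2 ⟨j, ?_⟩)
  have hpos : (0 : ℝ) < 2⁻¹ ^ j := by positivity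
  rw [mem_smul_set_iff_inv_smul_mem₀ hpos.ne', Set.mem_sdiff, mem_closedBall_zero_iff,
    mem_closedBall_zero_iff, not_le, norm_smul, norm_inv, Real.norm_of_nonneg hpos.le,
    inv_mul_le_iff₀ hpos, lt_inv_mul_iff₀ hpos]
  exact ⟨by linarith, by rwa [one_div, ← pow_succ]⟩

/-- The kernel `|h| ^ (-(n + σ))` of the fractional Laplacian of order `σ`, where `n` is the
dimension of the ambient space. -/
def kernel (σ : ℝ) (h : E) : ℝ := ‖h‖ ^ (-(finrank ℝ E + σ))

lemma kernel_nonneg (σ : ℝ) (h : E) : 0 ≤ kernel σ h := by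
  unfold kernel; positivity

lemma kernel_neg (σ : ℝ) (h : E) : kernel σ (-h) = kernel σ h := by
  rw [kernel, norm_neg, kernel]

lemma kernel_smul (σ : ℝ) {r : ℝ} (hr : 0 < r) (h : E) :
    kernel σ (r • h) = r ^ (-(finrank ℝ E + σ)) * kernel σ h := by
  rw [kernel, kernel, norm_smul, Real.norm_of_nonneg hr.le, Real.mul_rpow hr.le (norm_nonneg h)]

lemma measurable_kernel [MeasurableSpace E] [OpensMeasurableSpace E] (σ : ℝ) :
    Measurable (kernel σ : E → ℝ) :=
  measurable_norm.pow_const _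

lemma kernel_le {σ ε : ℝ} (hσ : 0 < σ) (hε : 0 < ε) {h : E} (hh : ε ≤ ‖h‖) :
    kernel σ h ≤ ε ^ (-(finrank ℝ E + σ)) :=
  Real.rpow_le_rpow_of_nonpos hε hh (by linarith [(finrank ℝ E).cast_nonneg (α := ℝ)])

end Annuli

section Homogeneous

variable {E : Type*} [NormedAddCommGroup E] [NormedSpace ℝ E] [FiniteDimensional ℝ E]
  [MeasurableSpace E] [BorelSpace E] {μ : Measure E} [μ.IsAddHaarMeasure]

lemma setLIntegral_smul_set (f : E → ℝ≥0∞) {r : ℝ} (hr : 0 < r) (S : Set E) :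
    ∫⁻ k in r • S, f k ∂μ = ENNReal.ofReal (r ^ finrank ℝ E) * ∫⁻ k in S, f (r • k) ∂μ := by
  have hemb : MeasurableEmbedding fun k : E => r • k := measurableEmbedding_const_smul₀ hr.ne'
  have hmap : ∫⁻ k in S, f (r • k) ∂μ = ∫⁻ k in r • S, f k ∂μ.map (r • ·) := by
    rw [hemb.restrict_map, hemb.lintegral_map, preimage_smul₀ hr.ne', inv_smul_smul₀ hr.ne']
  rw [hmap, Measure.map_addHaar_smul μ hr.ne', Measure.restrict_smul, lintegral_smul_measure,
    smul_eq_mul, ← mul_assoc, ← ENNReal.ofReal_mul (by positivity), abs_of_pos (by positivity),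
    mul_inv_cancel₀ (by positivity), ENNReal.ofReal_one, one_mul]

lemma setLIntegral_smul_set_of_homogeneous {f : E → ℝ≥0∞} {d : ℝ}
    (hf : ∀ r : ℝ, 0 < r → ∀ k, f (r • k) = ENNReal.ofReal (r ^ d) * f k) {r : ℝ} (hr : 0 < r)
    (S : Set E) :
    ∫⁻ k in r • S, f k ∂μ = ENNReal.ofReal (r ^ (finrank ℝ E + d)) * ∫⁻ k in S, f k ∂μ := by
  simp only [setLIntegral_smul_set f hr, hf r hr, lintegral_const_mul' _ _ ENNReal.ofReal_ne_top]
  rw [← mul_assoc, ← ENNReal.ofReal_mul (by positivity), ← Real.rpow_natCast, ← Real.rpow_add hr]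

lemma exists_lintegral_ball_le_annulus [Nontrivial E] {d : ℝ} (hd : -(finrank ℝ E : ℝ) < d) :
    ∃ C : ℝ≥0, ∀ f : E → ℝ≥0∞,
      (∀ r : ℝ, 0 < r → ∀ k, f (r • k) = ENNReal.ofReal (r ^ d) * f k) →
      ∫⁻ k in ball 0 1, f k ∂μ ≤ C * ∫⁻ k in closedBall 0 1 \ closedBall 0 (1 / 2), f k ∂μ := by
  set q : ℝ := 2⁻¹ ^ (finrank ℝ E + d)
  have hq0 : 0 ≤ q := by positivity
  have hsum : Summable fun j : ℕ => q ^ j := summable_geometric_of_lt_one hq0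
    (Real.rpow_lt_one (by norm_num) (by norm_num) (by linarith))
  refine ⟨(∑' j : ℕ, q ^ j).toNNReal, fun f hf => ?_⟩
  set A := closedBall (0 : E) 1 \ closedBall 0 (1 / 2)
  have hannulus (j : ℕ) : ∫⁻ k in (2⁻¹ : ℝ) ^ j • A, f k ∂μ =
      ENNReal.ofReal (q ^ j) * ∫⁻ k in A, f k ∂μ := by
    rw [setLIntegral_smul_set_of_homogeneous hf (pow_pos (by norm_num) j),
      Real.rpow_pow_comm (by norm_num)]
  calc ∫⁻ k in ball 0 1, f k ∂μ
      ≤ ∫⁻ k in {0} ∪ ⋃ j : ℕ, (2⁻¹ : ℝ) ^ j • A, f k ∂μ :=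
        lintegral_mono_set ball_subset_iUnion_smul_annulus
    _ ≤ (∫⁻ k in {0}, f k ∂μ) + ∑' j : ℕ, ∫⁻ k in (2⁻¹ : ℝ) ^ j • A, f k ∂μ :=
        (lintegral_union_le _ _ _).trans (add_le_add_right (lintegral_iUnion_le _ _) _)
    _ = ENNReal.ofReal (∑' j : ℕ, q ^ j) * ∫⁻ k in A, f k ∂μ := by
        simp only [hannulus, ENNReal.tsum_mul_right, Measure.restrict_singleton, measure_singleton,
          zero_smul, lintegral_zero_measure, zero_add,
          ENNReal.ofReal_tsum_of_nonneg (fun j => pow_nonneg hq0 j) hsum]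

lemma lintegral_compl_ball_kernel_lt_top {σ : ℝ} (hσ : 0 < σ) :
    ∫⁻ h in (ball (0 : E) 1)ᶜ, ENNReal.ofReal (kernel σ h) ∂μ < ∞ := by
  have hintegrable : Integrable (fun h : E => (2 : ℝ) ^ (finrank ℝ E + σ) *
      (1 + ‖h‖) ^ (-(finrank ℝ E + σ))) μ :=
    (integrable_one_add_norm (by linarith)).const_mul _
  refine lt_of_le_of_lt ?_ hintegrable.lintegral_lt_top
  refine (setLIntegral_mono' measurableSet_ball.compl fun h hh => ?_).trans
    (setLIntegral_le_lintegral _ _)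
  have hh1 : 1 ≤ ‖h‖ := by simpa using hh
  refine ENNReal.ofReal_le_ofReal ?_
  calc kernel σ h = 2 ^ (finrank ℝ E + σ) * (2 * ‖h‖) ^ (-(finrank ℝ E + σ)) := by
        rw [Real.mul_rpow zero_le_two (norm_nonneg h), ← mul_assoc, ← Real.rpow_add two_pos,
          add_neg_cancel, Real.rpow_zero, one_mul, kernel]
    _ ≤ 2 ^ (finrank ℝ E + σ) * (1 + ‖h‖) ^ (-(finrank ℝ E + σ)) := by
        gcongr ?_ * ?_
        exact Real.rpow_le_rpow_of_nonpos (by positivity) (by linarith) (by linarith)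

lemma exists_lintegral_compl_ball_kernel_eq (μ : Measure E) [μ.IsAddHaarMeasure] {σ : ℝ}
    (hσ : 0 < σ) :
    ∃ C : ℝ, 0 ≤ C ∧ ∀ r : ℝ, 0 < r →
      ∫⁻ h in (ball 0 r)ᶜ, ENNReal.ofReal (kernel σ h) ∂μ = ENNReal.ofReal (C * r ^ (-σ)) := by
  refine ⟨(∫⁻ h in (ball 0 1)ᶜ, ENNReal.ofReal (kernel σ h) ∂μ).toReal, ENNReal.toReal_nonneg,
    fun r hr => ?_⟩
  have hscale : (ball (0 : E) r)ᶜ = r • (ball 0 1)ᶜ := by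
    rw [compl_eq_univ_sdiff, compl_eq_univ_sdiff, smul_set_sdiff₀ hr.ne', smul_set_univ₀ hr.ne',
      smul_unitBall_of_pos hr]
  have hhom (r : ℝ) (hr : 0 < r) (k : E) : ENNReal.ofReal (kernel σ (r • k)) =
      ENNReal.ofReal (r ^ (-(finrank ℝ E + σ))) * ENNReal.ofReal (kernel σ k) := by
    rw [kernel_smul σ hr, ENNReal.ofReal_mul (by positivity)]
  rw [hscale, setLIntegral_smul_set_of_homogeneous hhom hr, mul_comm,
    ENNReal.ofReal_mul ENNReal.toReal_nonneg,
    ENNReal.ofReal_toReal (lintegral_compl_ball_kernel_lt_top hσ).ne]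
  congr 3
  ring

lemma lintegral_ball_norm_rpow_lt_top {b : ℝ} [Nontrivial E] (hb : -(finrank ℝ E : ℝ) < b) :
    ∫⁻ k in ball (0 : E) 1, ENNReal.ofReal (‖k‖ ^ b) ∂μ < ∞ := by
  have hfin : (finrank ℝ E - 1 : ℕ) + 1 = (finrank ℝ E : ℝ) := by
    exact_mod_cast Nat.sub_add_cancel (finrank_pos (R := ℝ) (M := E))
  have hradial : IntegrableOn (fun y : ℝ => y ^ (finrank ℝ E - 1) • y ^ b) (Ioo 0 1) := by
    refine ((intervalIntegral.integrableOn_Ioo_rpow_iff one_pos).2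
      (by linarith : -1 < (finrank ℝ E - 1 : ℕ) + b)).congr_fun (fun y hy => ?_) measurableSet_Ioo
    rw [smul_eq_mul, ← Real.rpow_natCast, ← Real.rpow_add hy.1]
  exact ((integrableOn_fun_norm_addHaar μ (f := (· ^ b))).2 hradial).lintegral_lt_top

lemma lintegral_min_rpow_mul_kernel_lt_top [Nontrivial E] {σ r b C M : ℝ} (hσ : 0 < σ) (hr : 0 ≤ r)
    (hC : 0 ≤ C) (hM : 0 ≤ M) (hb : σ < b * r) :
    ∫⁻ h : E, ENNReal.ofReal (min M (C * ‖h‖ ^ b) ^ r * kernel σ h) ∂μ < ∞ := by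
  rw [← lintegral_add_compl _ (measurableSet_ball (x := (0 : E)) (ε := 1))]
  refine ENNReal.add_lt_top.2 ⟨?_, ?_⟩
  · have hnear : ∫⁻ h in ball (0 : E) 1,
        ENNReal.ofReal (‖h‖ ^ (b * r - (finrank ℝ E + σ))) ∂μ < ∞ :=
      lintegral_ball_norm_rpow_lt_top (by linarith)
    refine lt_of_le_of_lt ?_ (ENNReal.mul_lt_top (ENNReal.ofReal_lt_top (r := C ^ r)) hnear)
    rw [← lintegral_const_mul' _ _ ENNReal.ofReal_ne_top]
    refine lintegral_mono_ae (ae_restrict_of_ae ((Measure.ae_ne μ 0).mono fun h hh => ?_))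
    have hh0 : 0 < ‖h‖ := norm_pos_iff.2 hh
    rw [← ENNReal.ofReal_mul (by positivity), sub_eq_add_neg, Real.rpow_add hh0,
      Real.rpow_mul hh0.le, ← mul_assoc, ← Real.mul_rpow hC (by positivity), kernel]
    gcongr
    exact min_le_right _ _
  · refine lt_of_le_of_lt ?_ (ENNReal.mul_lt_top (ENNReal.ofReal_lt_top (r := M ^ r))
      (lintegral_compl_ball_kernel_lt_top (μ := μ) hσ))
    rw [← lintegral_const_mul' _ _ ENNReal.ofReal_ne_top]
    refine lintegral_mono fun h => ?_
    rw [← ENNReal.ofReal_mul (by positivity)]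
    gcongr
    · exact kernel_nonneg σ h
    · exact min_le_left _ _

lemma integrableOn_annulus_mul_kernel {σ ε ρ M : ℝ} (hσ : 0 < σ) (hε : 0 < ε) {f : E → ℝ}
    (hf : Measurable f) (hM : ∀ h ∈ ball 0 ρ, |f h| ≤ M) :
    IntegrableOn (fun h => f h * kernel σ h) (ball 0 ρ \ closedBall 0 ε) μ := by
  refine Measure.integrableOn_of_bounded (M := M * ε ^ (-(finrank ℝ E + σ)))
    ((measure_mono sdiff_subset).trans_lt measure_ball_lt_top).ne
    (hf.mul (measurable_kernel σ)).aestronglyMeasurable ?_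
  filter_upwards [ae_restrict_mem (measurableSet_ball.diff measurableSet_closedBall)] with h hh
  rw [norm_mul, Real.norm_eq_abs, Real.norm_of_nonneg (kernel_nonneg σ h)]
  have hεh : ε ≤ ‖h‖ := by simpa using (not_le.1 (mt mem_closedBall_zero_iff.2 hh.2)).le
  exact mul_le_mul (hM h hh.1) (kernel_le hσ hε hεh) (kernel_nonneg σ h)
    ((abs_nonneg _).trans (hM h hh.1))

lemma setIntegral_annulus_eq_zero_of_odd {ε ρ : ℝ} {f : E → ℝ} (hf : f.Odd) :
    ∫ h in ball 0 ρ \ closedBall 0 ε, f h ∂μ = 0 := by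
  rw [← integral_indicator (measurableSet_ball.diff measurableSet_closedBall)]
  set F := (ball 0 ρ \ closedBall 0 ε).indicator f
  have hodd (h : E) : F (-h) = -F h := by
    simp only [F, indicator, Set.mem_sdiff, mem_ball_zero_iff, mem_closedBall_zero_iff,
      norm_neg, hf h]
    split_ifs <;> simp
  have hself := integral_neg_eq_self F μ
  simp only [hodd, integral_neg] at hself
  linarith

end Homogeneous

section DirectionalWeight

lemma integrable_indicator_abs_rpow {α : ℝ} (hα : -1 < α) :
    Integrable ((Icc (-1) 1).indicator fun t : ℝ => |t| ^ α) := by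
  have hpos : IntervalIntegrable (fun t : ℝ => |t| ^ α) volume 0 1 :=
    (intervalIntegral.intervalIntegrable_rpow' hα).congr fun t ht => by
      rw [uIoc_of_le zero_le_one] at ht
      simp only [abs_of_pos ht.1]
  have hneg : IntervalIntegrable (fun t : ℝ => |t| ^ α) volume (-1) 0 := by
    simpa using ((IntervalIntegrable.iff_comp_neg (by simp)).1 hpos).symm
  rw [integrable_indicator_iff measurableSet_Icc]
  exact (intervalIntegrable_iff_integrableOn_Icc_of_le (by norm_num)).1 (hneg.trans hpos)

lemma lintegral_closedBall_coord_rpow_lt_top {ι : Type*} [Fintype ι] {α : ℝ} (hα : -1 < α)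
    (i₀ : ι) :
    ∫⁻ k in closedBall (0 : EuclideanSpace ℝ ι) 1, ENNReal.ofReal (|k i₀| ^ α) < ∞ := by
  classical
  set f : ι → ℝ → ℝ := fun i => (Icc (-1) 1).indicator fun t : ℝ =>
    |t| ^ (if i = i₀ then α else 0) with hf
  have hintegrable : Integrable fun x : ι → ℝ => ∏ i, f i (x i) := by
    refine Integrable.fintype_prod (f := f) fun i => integrable_indicator_abs_rpow ?_
    split_ifs <;> linarith
  have hint_euclidean : Integrable fun x : EuclideanSpace ℝ ι => ∏ i, f i (x i) :=
    (PiLp.volume_preserving_ofLp ι).integrable_comp_of_integrable hintegrable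
  refine lt_of_le_of_lt ?_ hint_euclidean.lintegral_lt_top
  rw [← lintegral_indicator measurableSet_closedBall]
  refine lintegral_mono (indicator_le fun k hk => ENNReal.ofReal_le_ofReal ?_)
  have hmem (i : ι) : k i ∈ Icc (-1 : ℝ) 1 :=
    abs_le.1 ((PiLp.norm_apply_le k i).trans (mem_closedBall_zero_iff.1 hk))
  simp only [hf, indicator_of_mem (hmem _)]
  rw [Finset.prod_eq_single i₀ (fun i _ hi => by simp [hi]) (by simp), if_pos rfl]

variable {E : Type*} [NormedAddCommGroup E] [InnerProductSpace ℝ E]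

/-- The weight `|h| ^ (p - α) |⟨e, h⟩| ^ α` against the kernel of order `σ`, where
`α = min (p - 2) 0`. It dominates the second-order error in the expansion of
`t ↦ |t| ^ (p - 2) * t` along the linear function `⟨e, ·⟩`; for `p < 2` it is singular on the whole
hyperplane orthogonal to `e`. -/
def directionalWeight (p σ : ℝ) (e h : E) : ℝ :=
  ‖h‖ ^ (p - min (p - 2) 0) * |inner ℝ e h| ^ min (p - 2) 0 * kernel σ h

lemma directionalWeight_nonneg (p σ : ℝ) (e h : E) : 0 ≤ directionalWeight p σ e h :=
  mul_nonneg (by positivity) (kernel_nonneg σ h)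

lemma measurable_directionalWeight [MeasurableSpace E] [OpensMeasurableSpace E] (p σ : ℝ) (e : E) :
    Measurable (directionalWeight p σ e) :=
  ((measurable_norm.pow_const _).mul
    ((by fun_prop : Measurable fun h : E => |inner ℝ e h|).pow_const _)).mul (measurable_kernel σ)

lemma directionalWeight_smul (p σ : ℝ) (e : E) {r : ℝ} (hr : 0 < r) (h : E) :
    directionalWeight p σ e (r • h) =
      r ^ (p - (finrank ℝ E + σ)) * directionalWeight p σ e h := by
  simp only [directionalWeight, kernel_smul σ hr, norm_smul, Real.norm_of_nonneg hr.le,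
    inner_smul_right, abs_mul, abs_of_pos hr, Real.mul_rpow hr.le (norm_nonneg _),
    Real.mul_rpow hr.le (abs_nonneg _)]
  rw [show p - (finrank ℝ E + σ) = p - min (p - 2) 0 + min (p - 2) 0 + -(finrank ℝ E + σ) by ring,
    Real.rpow_add hr, Real.rpow_add hr]
  ring

lemma exists_spow_mul_kernel_le {p C : ℝ} (σ : ℝ) (hp : 1 < p) (hC : 0 ≤ C) :
    ∃ C' : ℝ, 0 ≤ C' ∧ ∀ (e h : E) (g ρ y : ℝ), ‖e‖ = 1 → 0 ≤ g → ‖h‖ < ρ → inner ℝ e h ≠ 0 →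
      y ≤ g * (inner ℝ e h + C * ‖h‖ ^ 2 / ρ) →
      spow (p - 1) y * kernel σ h ≤
        g ^ (p - 1) * (spow (p - 1) (inner ℝ e h) * kernel σ h +
          C' / ρ * directionalWeight p σ e h) := by
  have hr : 0 < p - 1 := by linarith
  obtain ⟨C', hC', hincr⟩ := exists_abs_spow_add_sub_le hr hC
  refine ⟨C', hC', fun e h g ρ y he hg hh hinner hy => ?_⟩
  have hinner_le : |inner ℝ e h| ≤ ‖h‖ := by simpa [he] using abs_real_inner_le_norm e h
  have hρ : 0 < ρ := (norm_nonneg h).trans_lt hh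
  have herror := hincr _ (C * ‖h‖ ^ 2 / ρ) ‖h‖ ρ hinner hinner_le hh.le
    (abs_of_nonneg (by positivity)).le
  rw [sub_add_cancel, show p - 1 - 1 = p - 2 by ring] at herror
  calc spow (p - 1) y * kernel σ h
      ≤ spow (p - 1) (g * (inner ℝ e h + C * ‖h‖ ^ 2 / ρ)) * kernel σ h :=
        mul_le_mul_of_nonneg_right ((strictMono_spow hr).monotone hy) (kernel_nonneg σ h)
    _ ≤ g ^ (p - 1) * (spow (p - 1) (inner ℝ e h) + C' / ρ *
          (‖h‖ ^ (p - min (p - 2) 0) * |inner ℝ e h| ^ min (p - 2) 0)) * kernel σ h := by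
        rw [spow_mul hr, spow_of_nonneg hr hg]
        gcongr
        · exact kernel_nonneg σ h
        · linarith [(abs_le.1 herror).2]
    _ = _ := by
        rw [directionalWeight]
        ring

variable [FiniteDimensional ℝ E] [MeasurableSpace E] [BorelSpace E]

lemma lintegral_closedBall_inner_eq {ι : Type*} [Fintype ι] (hι : finrank ℝ E = Fintype.card ι)
    (f : ℝ → ℝ≥0∞) {e : E} (he : ‖e‖ = 1) (i₀ : ι) :
    ∫⁻ k in closedBall (0 : E) 1, f (inner ℝ e k) =
      ∫⁻ k in closedBall (0 : EuclideanSpace ℝ ι) 1, f (k i₀) := by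
  have horth : Orthonormal ℝ (({i₀} : Set ι).domRestrict fun _ => e) :=
    ⟨fun _ => he, fun i j hij => absurd (Subsingleton.elim i j) hij⟩
  obtain ⟨b, hb⟩ := horth.exists_orthonormalBasis_extension_of_card_eq hι
  rw [← b.measurePreserving_repr.setLIntegral_comp_preimage_emb
    b.repr.toHomeomorph.measurableEmbedding, b.repr.preimage_closedBall, map_zero]
  simp only [b.repr_apply_apply, hb i₀ rfl]

lemma rpow_le_two_rpow_abs {x : ℝ} (hx : 1 / 2 ≤ x) (hx1 : x ≤ 1) (t : ℝ) : x ^ t ≤ 2 ^ |t| := by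
  have hx0 : 0 < x := by linarith
  calc x ^ t ≤ x ^ (-|t|) := Real.rpow_le_rpow_of_exponent_ge hx0 hx1 (neg_abs_le t)
    _ ≤ (1 / 2) ^ (-|t|) := Real.rpow_le_rpow_of_nonpos (by norm_num) hx (by simp)
    _ = 2 ^ |t| := by rw [one_div, Real.inv_rpow zero_le_two, Real.rpow_neg zero_le_two, inv_inv]

lemma exists_lintegral_ball_inner_rpow_le [Nontrivial E] {α b : ℝ} (hα : -1 < α)
    (hb : -(finrank ℝ E : ℝ) < b + α) :
    ∃ C : ℝ≥0, ∀ e : E, ‖e‖ = 1 →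
      ∫⁻ k in ball 0 1, ENNReal.ofReal (‖k‖ ^ b * |inner ℝ e k| ^ α) ≤ C := by
  obtain ⟨C, hC⟩ := exists_lintegral_ball_le_annulus (μ := (volume : Measure E)) hb
  set i₀ : Fin (finrank ℝ E) := ⟨0, finrank_pos⟩
  have hcoord := (lintegral_closedBall_coord_rpow_lt_top hα i₀).ne
  refine ⟨C * (Real.toNNReal (2 ^ |b|) *
    (∫⁻ k in closedBall (0 : EuclideanSpace ℝ (Fin (finrank ℝ E))) 1,
      ENNReal.ofReal (|k i₀| ^ α)).toNNReal), fun e he => ?_⟩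
  refine (hC _ fun r hr k => ?_).trans ?_
  · rw [← ENNReal.ofReal_mul (by positivity), norm_smul, Real.norm_of_nonneg hr.le,
      inner_smul_right, abs_mul, abs_of_pos hr, Real.mul_rpow hr.le (norm_nonneg _),
      Real.mul_rpow hr.le (abs_nonneg _), Real.rpow_add hr]
    congr 1
    ring
  · rw [ENNReal.coe_mul, ENNReal.coe_mul, ENNReal.coe_toNNReal hcoord,
      ← lintegral_closedBall_inner_eq (by simp) (fun t => ENNReal.ofReal (|t| ^ α)) he i₀]
    gcongr C * ?_
    calc ∫⁻ k in closedBall 0 1 \ closedBall 0 (1 / 2), ENNReal.ofReal (‖k‖ ^ b * |inner ℝ e k| ^ α)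
        ≤ ∫⁻ k in closedBall (0 : E) 1 \ closedBall 0 (1 / 2),
            ENNReal.ofReal (2 ^ |b|) * ENNReal.ofReal (|inner ℝ e k| ^ α) := by
          refine setLIntegral_mono' (measurableSet_closedBall.diff measurableSet_closedBall)
            fun k hk => ?_
          rw [← ENNReal.ofReal_mul (by positivity)]
          gcongr
          exact rpow_le_two_rpow_abs (not_le.1 (mt mem_closedBall_zero_iff.2 hk.2)).le
            (mem_closedBall_zero_iff.1 hk.1) b
      _ ≤ ENNReal.ofReal (2 ^ |b|) *
            ∫⁻ k in closedBall (0 : E) 1, ENNReal.ofReal (|inner ℝ e k| ^ α) := by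
          rw [lintegral_const_mul' _ _ ENNReal.ofReal_ne_top]
          gcongr
          exact sdiff_subset

lemma exists_lintegral_ball_directionalWeight_le [Nontrivial E] {p σ : ℝ} (hp : 1 < p)
    (hσp : σ < p) :
    ∃ C : ℝ≥0, ∀ e : E, ‖e‖ = 1 → ∀ ρ : ℝ, 0 < ρ →
      ∫⁻ h in ball 0 ρ, ENNReal.ofReal (directionalWeight p σ e h) ≤
        ENNReal.ofReal (C * ρ ^ (p - σ)) := by
  have hα : -1 < min (p - 2) 0 := lt_min (by linarith) (by norm_num)
  obtain ⟨C, hC⟩ := exists_lintegral_ball_inner_rpow_le (E := E)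
    (b := p - min (p - 2) 0 - (finrank ℝ E + σ)) hα (by linarith)
  refine ⟨C, fun e he ρ hρ => ?_⟩
  have hhom (r : ℝ) (hr : 0 < r) (h : E) : ENNReal.ofReal (directionalWeight p σ e (r • h)) =
      ENNReal.ofReal (r ^ (p - (finrank ℝ E + σ))) *
        ENNReal.ofReal (directionalWeight p σ e h) := by
    rw [directionalWeight_smul p σ e hr, ENNReal.ofReal_mul (by positivity)]
  have hunit : ∫⁻ h in ball 0 1, ENNReal.ofReal (directionalWeight p σ e h) ≤ C := by
    refine (lintegral_congr_ae (ae_restrict_of_ae ?_)).trans_le (hC e he)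
    filter_upwards [Measure.ae_ne volume (0 : E)] with h hh
    rw [directionalWeight, kernel, mul_right_comm, ← Real.rpow_add (norm_pos_iff.2 hh),
      ← sub_eq_add_neg]
  rw [← smul_unitBall_of_pos hρ, setLIntegral_smul_set_of_homogeneous hhom hρ,
    show (finrank ℝ E : ℝ) + (p - (finrank ℝ E + σ)) = p - σ by ring, mul_comm (C : ℝ),
    ENNReal.ofReal_mul (by positivity), ENNReal.ofReal_coe_nnreal]
  gcongr

lemma ae_inner_ne_zero {e : E} (he : e ≠ 0) : ∀ᵐ h : E, inner ℝ e h ≠ 0 := by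
  have hne : (ℝ ∙ e)ᗮ ≠ ⊤ := fun htop => he <| by
    simpa [Submodule.mem_orthogonal_singleton_iff_inner_right] using
      (htop.symm ▸ Submodule.mem_top : e ∈ (ℝ ∙ e)ᗮ)
  rw [ae_iff]
  convert Measure.addHaar_submodule volume _ hne using 2
  ext h
  simp [Submodule.mem_orthogonal_singleton_iff_inner_right]

lemma exists_setIntegral_directionalWeight_le [Nontrivial E] {p σ : ℝ} (hp : 1 < p) (hσp : σ < p) :
    ∃ C : ℝ, 0 ≤ C ∧ ∀ e : E, ‖e‖ = 1 → ∀ ρ : ℝ, 0 < ρ → ∀ A ⊆ ball 0 ρ,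
      IntegrableOn (directionalWeight p σ e) A ∧
        ∫ h in A, directionalWeight p σ e h ≤ C * ρ ^ (p - σ) := by
  obtain ⟨C, hC⟩ := exists_lintegral_ball_directionalWeight_le (E := E) hp hσp
  refine ⟨C, C.2, fun e he ρ hρ A hA => ?_⟩
  have hnonneg : ∀ᵐ h ∂volume.restrict A, 0 ≤ directionalWeight p σ e h :=
    .of_forall (directionalWeight_nonneg p σ e)
  have hmeas := (measurable_directionalWeight p σ e).aestronglyMeasurable (μ := volume.restrict A)
  have hle := (lintegral_mono_set hA).trans (hC e he ρ hρ)
  refine ⟨⟨hmeas, ?_⟩, ?_⟩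
  · exact (hasFiniteIntegral_iff_ofReal hnonneg).2 (hle.trans_lt ENNReal.ofReal_lt_top)
  · rw [integral_eq_lintegral_of_nonneg_ae hnonneg hmeas]
    exact ENNReal.toReal_le_of_le_ofReal (by positivity) hle

lemma exists_setIntegral_annulus_spow_le [Nontrivial E] {p σ C : ℝ} (hp : 1 < p) (hσ : 0 < σ)
    (hσp : σ < p) (hC : 0 ≤ C) :
    ∃ C₀ : ℝ, 0 ≤ C₀ ∧ ∀ (f : E → ℝ) (e : E) (M g ρ ε : ℝ), Measurable f → (∀ h, |f h| ≤ M) →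
      ‖e‖ = 1 → 0 ≤ g → 0 < ρ → 0 < ε →
      (∀ h ∈ ball 0 ρ, f h ≤ g * (inner ℝ e h + C * ‖h‖ ^ 2 / ρ)) →
      ∫ h in ball 0 ρ \ closedBall 0 ε, spow (p - 1) (f h) * kernel σ h ≤
        C₀ * (g ^ (p - 1) * ρ ^ (p - 1 - σ)) := by
  have hr : 0 < p - 1 := by linarith
  obtain ⟨C', hC', hpointwise⟩ := exists_spow_mul_kernel_le (E := E) σ hp hC
  obtain ⟨D, hD, hweight⟩ := exists_setIntegral_directionalWeight_le (E := E) hp hσp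
  refine ⟨C' * D, by positivity, fun f e M g ρ ε hf hfM he hg hρ hε hfg => ?_⟩
  set A := ball (0 : E) ρ \ closedBall 0 ε
  obtain ⟨hweight_int, hweight_le⟩ := hweight e he ρ hρ A sdiff_subset
  have hinner (h : E) (hh : h ∈ ball 0 ρ) : |inner ℝ e h| ≤ ρ := by
    simpa [he] using (abs_real_inner_le_norm e h).trans
      (mul_le_mul_of_nonneg_left (mem_ball_zero_iff.1 hh).le (norm_nonneg e))
  have hspow_int {F : E → ℝ} {N : ℝ} (hF : Measurable F) (hFN : ∀ h ∈ ball 0 ρ, |F h| ≤ N) :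
      IntegrableOn (fun h => spow (p - 1) (F h) * kernel σ h) A :=
    integrableOn_annulus_mul_kernel (M := N ^ (p - 1)) hσ hε
      ((continuous_spow hr).measurable.comp hF) fun h hh => by
        rw [abs_spow hr]
        exact Real.rpow_le_rpow (abs_nonneg _) (hFN h hh) hr.le
  have hlinear_int := hspow_int (by fun_prop) hinner
  -- The linear part of the bound for `f` contributes an odd integrand, which cancels on annuli.
  have hlinear : ∫ h in A, spow (p - 1) (inner ℝ e h) * kernel σ h = 0 :=
    setIntegral_annulus_eq_zero_of_odd fun h => by
      rw [inner_neg_right, spow_neg, kernel_neg, neg_mul]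
  calc ∫ h in A, spow (p - 1) (f h) * kernel σ h
      ≤ ∫ h in A, g ^ (p - 1) * (spow (p - 1) (inner ℝ e h) * kernel σ h +
          C' / ρ * directionalWeight p σ e h) := by
        refine setIntegral_mono_ae_restrict (hspow_int hf fun h _ => hfM h)
          ((hlinear_int.add (hweight_int.const_mul _)).const_mul _) ?_
        have he0 : e ≠ 0 := norm_ne_zero_iff.1 (he ▸ one_ne_zero)
        filter_upwards [ae_restrict_of_ae (ae_inner_ne_zero he0),
          ae_restrict_mem (measurableSet_ball.diff measurableSet_closedBall)] with h hne hh
        exact hpointwise e h g ρ (f h) he hg (mem_ball_zero_iff.1 hh.1) hne (hfg h hh.1)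
    _ = g ^ (p - 1) * (C' / ρ * ∫ h in A, directionalWeight p σ e h) := by
        rw [integral_const_mul, integral_add hlinear_int (hweight_int.const_mul _), hlinear,
          zero_add, integral_const_mul]
    _ ≤ g ^ (p - 1) * (C' / ρ * (D * ρ ^ (p - σ))) := by gcongr
    _ = C' * D * (g ^ (p - 1) * ρ ^ (p - 1 - σ)) := by
        rw [show p - σ = p - 1 - σ + 1 by ring, Real.rpow_add_one hρ.ne']
        field_simp

end DirectionalWeight

lemma abs_one_add_pow_sub_one_le {t : ℝ} (ht : |t| ≤ 1) (N : ℕ) :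
    |(1 + t) ^ N - 1| ≤ 2 ^ N * |t| := by
  induction N with
  | zero => simp
  | succ N ih =>
    have hbase : |1 + t| ≤ 2 := (abs_add_le _ _).trans (by rw [abs_one]; linarith)
    have hpow : |1 + t| ^ N ≤ 2 ^ N := by gcongr
    calc |(1 + t) ^ (N + 1) - 1| = |((1 + t) ^ N - 1) + t * (1 + t) ^ N| := by congr 1; ring
      _ ≤ |(1 + t) ^ N - 1| + |t| * |1 + t| ^ N := by
          rw [← abs_pow, ← abs_mul]
          exact abs_add_le _ _
      _ ≤ 2 ^ N * |t| + |t| * 2 ^ N := by gcongr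
      _ = 2 ^ (N + 1) * |t| := by ring

lemma abs_one_add_pow_sub_one_sub_le {t : ℝ} (ht : |t| ≤ 1) (N : ℕ) :
    |(1 + t) ^ N - 1 - N * t| ≤ 2 ^ N * t ^ 2 := by
  induction N with
  | zero => simp [sq_nonneg]
  | succ N ih =>
    calc |(1 + t) ^ (N + 1) - 1 - (N + 1 : ℕ) * t|
        = |((1 + t) ^ N - 1 - N * t) + t * ((1 + t) ^ N - 1)| := by
          congr 1
          push_cast
          ring
      _ ≤ |(1 + t) ^ N - 1 - N * t| + |t| * |(1 + t) ^ N - 1| := by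
          rw [← abs_mul]
          exact abs_add_le _ _
      _ ≤ 2 ^ N * t ^ 2 + |t| * (2 ^ N * |t|) := by
          gcongr
          exact abs_one_add_pow_sub_one_le ht N
      _ = 2 ^ (N + 1) * t ^ 2 := by
          rw [← sq_abs t]
          ring

section Profile

variable {E : Type*} [NormedAddCommGroup E] {N : ℕ} {β κ : ℝ}

/-- A smoothed distance to the complement of the unit ball, bounded below by `κ`. The even power of
the norm makes it smooth inside the ball, with derivatives at the origin vanishing to high order. -/
def regDist (N : ℕ) (κ : ℝ) (y : E) : ℝ := κ + max 0 (1 - ‖y‖ ^ (2 * N))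

/-- The barrier at unit scale: it takes values in `(-1, 1]`, equals `1` outside the unit ball, and
`1 + profile` decays inside like the power `-β` of the distance to the boundary. -/
def profile (N : ℕ) (β κ : ℝ) (y : E) : ℝ := -1 + 2 * (κ / regDist N κ y) ^ β

lemma le_regDist (y : E) : κ ≤ regDist N κ y :=
  le_add_of_nonneg_right (le_max_left _ _)

lemma regDist_pos (hκ : 0 < κ) (y : E) : 0 < regDist N κ y :=
  hκ.trans_le (le_regDist y)

lemma regDist_le (y : E) : regDist N κ y ≤ κ + 1 := by
  unfold regDist
  gcongr
  exact max_le zero_le_one (sub_le_self _ (by positivity))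

lemma le_regDist_sub_norm_pow (y : E) : κ + (1 - ‖y‖ ^ (2 * N)) ≤ regDist N κ y := by
  unfold regDist
  gcongr
  exact le_max_right _ _

lemma regDist_of_norm_le_one {y : E} (hy : ‖y‖ ≤ 1) :
    regDist N κ y = κ + (1 - ‖y‖ ^ (2 * N)) := by
  rw [regDist, max_eq_right (sub_nonneg.2 (pow_le_one₀ (norm_nonneg _) hy))]

lemma div_regDist_pos (hκ : 0 < κ) (y : E) : 0 < κ / regDist N κ y :=
  div_pos hκ (regDist_pos hκ y)

lemma div_regDist_le_one (hκ : 0 < κ) (y : E) : κ / regDist N κ y ≤ 1 :=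
  (div_le_one (regDist_pos hκ y)).2 (le_regDist y)

lemma div_regDist_rpow_le_one (hκ : 0 < κ) (hβ : 0 ≤ β) (y : E) :
    (κ / regDist N κ y) ^ β ≤ 1 :=
  Real.rpow_le_one (div_regDist_pos hκ y).le (div_regDist_le_one hκ y) hβ

lemma profile_mem_Ioc (hκ : 0 < κ) (hβ : 0 ≤ β) (y : E) : profile N β κ y ∈ Ioc (-1 : ℝ) 1 := by
  have hpos : 0 < (κ / regDist N κ y) ^ β := Real.rpow_pos_of_pos (div_regDist_pos hκ y) _
  have hle := div_regDist_rpow_le_one (N := N) hκ hβ y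
  constructor <;> unfold profile <;> linarith

lemma continuous_profile (hκ : 0 < κ) : Continuous (profile N β κ : E → ℝ) := by
  have hdist : Continuous (regDist N κ : E → ℝ) := by
    unfold regDist
    fun_prop
  exact continuous_const.add (continuous_const.mul
    ((continuous_const.div hdist fun y => (regDist_pos hκ y).ne').rpow_const fun y =>
      .inl (div_regDist_pos hκ y).ne'))

lemma profile_of_one_le_norm (hκ : 0 < κ) {y : E} (hy : 1 ≤ ‖y‖) : profile N β κ y = 1 := by
  rw [profile, regDist, max_eq_left (sub_nonpos.2 (one_le_pow₀ hy)), add_zero, div_self hκ.ne',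
    Real.one_rpow]
  norm_num

lemma abs_profile_sub_le (hκ : 0 < κ) (hβ : 0 ≤ β) (y z : E) :
    |profile N β κ y - profile N β κ z| ≤ 2 := by
  have hy := profile_mem_Ioc (N := N) hκ hβ y
  have hz := profile_mem_Ioc (N := N) hκ hβ z
  rw [abs_le]
  constructor <;> linarith [hy.1, hy.2, hz.1, hz.2]

lemma profile_zero_le (hκ : 0 < κ) (hβ : 0 ≤ β) (y : E) :
    profile N β κ (0 : E) ≤ profile N β κ y := by
  rcases eq_or_ne N 0 with rfl | hN
  · simp [profile, regDist]
  unfold profile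
  gcongr
  · exact (div_regDist_pos hκ _).le
  · exact regDist_pos hκ y
  · rw [regDist_of_norm_le_one (y := (0 : E)) (by simp)]
    simpa [hN] using regDist_le (N := N) (κ := κ) y

lemma profile_sub_le {q : ℝ} (hκ : 0 < κ) (hβ : 0 ≤ β) {y z : E} (hy : ‖y‖ ≤ 1) (hq : q ≤ 1 / 2)
    (hz : ‖z‖ ^ (2 * N) - ‖y‖ ^ (2 * N) = q * regDist N κ y) :
    profile N β κ z - profile N β κ y ≤
      2 * (κ / regDist N κ y) ^ β * (β * q + β * (β + 1) * 2 ^ (β + 2) * q ^ 2) := by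
  set d := regDist N κ y with hd
  have hd0 : 0 < d := regDist_pos hκ y
  have hq1 : 0 < 1 - q := by linarith
  have hdist : d * (1 - q) ≤ regDist N κ z := by
    refine le_trans (le_of_eq ?_) (le_regDist_sub_norm_pow z)
    rw [mul_one_sub, mul_comm, ← hz, hd, regDist_of_norm_le_one hy]
    ring
  have hpow : (κ / regDist N κ z) ^ β ≤
      (κ / d) ^ β * (1 + β * q + β * (β + 1) * 2 ^ (β + 2) * q ^ 2) := by
    calc (κ / regDist N κ z) ^ β ≤ (κ / (d * (1 - q))) ^ β := by
          gcongr
          exact (div_regDist_pos hκ z).le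
      _ = (κ / d) ^ β * (1 - q) ^ (-β) := by
          rw [← div_div, Real.div_rpow (by positivity) hq1.le, Real.rpow_neg hq1.le, div_eq_mul_inv]
      _ ≤ _ := by
          gcongr
          exact one_sub_rpow_neg_le hβ hq
  calc profile N β κ z - profile N β κ y = 2 * ((κ / regDist N κ z) ^ β - (κ / d) ^ β) := by
        unfold profile
        ring
    _ ≤ 2 * ((κ / d) ^ β * (1 + β * q + β * (β + 1) * 2 ^ (β + 2) * q ^ 2) - (κ / d) ^ β) := by
        gcongr
    _ = _ := by ring

lemma profile_sub_profile_zero_le (hN : N ≠ 0) (hκ : 0 < κ) (hβ : 0 ≤ β) (z : E) :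
    profile N β κ z - profile N β κ (0 : E) ≤
      2 * (1 + β + β * (β + 1) * 2 ^ (β + 2)) * (2 * ‖z‖) ^ (2 * N) := by
  set t := ‖z‖ ^ (2 * N) with ht
  rcases le_or_gt ‖z‖ (1 / 2) with hsmall | hlarge
  · have ht_half : t ≤ 1 / 2 :=
      (pow_le_of_le_one (norm_nonneg _) (by linarith) (by omega)).trans hsmall
    have hdist : regDist N κ (0 : E) = κ + 1 := by simp [regDist, hN]
    have hqt : t / (κ + 1) ≤ t := div_le_self (by positivity) (by linarith)
    have hprofile := profile_sub_le (N := N) (y := (0 : E)) (z := z) (q := t / (κ + 1)) hκ hβ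
      (by simp) (by linarith) (by rw [hdist]; field_simp; simp [hN, ht])
    calc profile N β κ z - profile N β κ (0 : E)
        ≤ 2 * 1 * (β * t + β * (β + 1) * 2 ^ (β + 2) * t) := by
          refine hprofile.trans ?_
          gcongr
          · exact div_regDist_rpow_le_one hκ hβ 0
          · calc (t / (κ + 1)) ^ 2 ≤ t ^ 2 := by gcongr
              _ ≤ t := by nlinarith [(by positivity : 0 ≤ t)]
      _ ≤ 2 * (1 + β + β * (β + 1) * 2 ^ (β + 2)) * t := by
          linarith [(by positivity : 0 ≤ t)]
      _ ≤ _ := by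
          rw [ht]
          gcongr
          linarith [norm_nonneg z]
  · have hone : 1 ≤ (2 * ‖z‖) ^ (2 * N) := one_le_pow₀ (by linarith)
    have hB : 0 ≤ 2 * (β + β * (β + 1) * 2 ^ (β + 2)) := by positivity
    linarith [(abs_le.1 (abs_profile_sub_le (N := N) hκ hβ z 0)).2,
      mul_le_mul_of_nonneg_left hone hB]

-- The increment is at most the one from the minimum point `0`, where the profile is very flat.
lemma exists_profile_add_sub_le_norm_pow (hN : N ≠ 0) (hβ : 0 ≤ β) {c : ℝ} (hc : 0 < c) :
    ∃ C : ℝ, 0 ≤ C ∧ ∀ κ : ℝ, 0 < κ → ∀ y h : E, c * ‖y‖ ≤ ‖h‖ →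
      profile N β κ (y + h) - profile N β κ y ≤ C * ‖h‖ ^ (2 * N) := by
  set B := 2 * (1 + β + β * (β + 1) * 2 ^ (β + 2))
  have : 0 ≤ B := by positivity
  refine ⟨B * (2 * (1 + c⁻¹)) ^ (2 * N), by positivity, fun κ hκ y h hh => ?_⟩
  have hyh : ‖y + h‖ ≤ (1 + c⁻¹) * ‖h‖ := by
    have hy : ‖y‖ ≤ c⁻¹ * ‖h‖ := by rwa [inv_mul_eq_div, le_div_iff₀' hc]
    linarith [norm_add_le y h]
  calc profile N β κ (y + h) - profile N β κ y
      ≤ profile N β κ (y + h) - profile N β κ (0 : E) := by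
        gcongr
        exact profile_zero_le hκ hβ y
    _ ≤ B * (2 * ‖y + h‖) ^ (2 * N) := profile_sub_profile_zero_le hN hκ hβ _
    _ ≤ B * (2 * ((1 + c⁻¹) * ‖h‖)) ^ (2 * N) := by gcongr
    _ = _ := by
        simp only [mul_pow]
        ring

/-- The length of the gradient of `profile N β κ` at `y`. -/
def profileSlope (N : ℕ) (β κ : ℝ) (y : E) : ℝ :=
  4 * β * N * (κ / regDist N κ y) ^ β * ‖y‖ ^ (2 * N - 1) / regDist N κ y

/-- The radius of the ball around `y` in which `profile N β κ` stays below a paraboloid touching it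
at `y`. -/
def touchRadius (N : ℕ) (κ : ℝ) (y : E) : ℝ :=
  (6 * 2 ^ N)⁻¹ * min ‖y‖ (regDist N κ y)

lemma touchRadius_pos (hκ : 0 < κ) {y : E} (hy : y ≠ 0) : 0 < touchRadius N κ y :=
  mul_pos (by positivity) (lt_min (norm_pos_iff.2 hy) (regDist_pos hκ y))

lemma touchRadius_le_norm (hκ : 0 < κ) (y : E) : 6 * touchRadius N κ y ≤ ‖y‖ := by
  have hone : (1 : ℝ) ≤ 2 ^ N := one_le_pow₀ one_le_two
  have hd := regDist_pos (N := N) hκ y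
  rw [touchRadius, mul_inv, ← mul_assoc, mul_inv_cancel_left₀ (by norm_num)]
  exact (mul_le_of_le_one_left (by positivity) (inv_le_one_of_one_le₀ hone)).trans
    (min_le_left _ _)

lemma two_pow_mul_touchRadius_le (y : E) :
    6 * 2 ^ N * touchRadius N κ y ≤ regDist N κ y := by
  rw [touchRadius, mul_inv_cancel_left₀ (by positivity)]
  exact min_le_right _ _

lemma touchRadius_le_regDist (hκ : 0 < κ) {y : E} (hy : y ≠ 0) :
    touchRadius N κ y ≤ regDist N κ y := by
  refine le_trans ?_ (two_pow_mul_touchRadius_le y)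
  have hone : (1 : ℝ) ≤ 2 ^ N := one_le_pow₀ one_le_two
  exact le_mul_of_one_le_left (touchRadius_pos hκ hy).le (by linarith)

lemma profileSlope_nonneg (hκ : 0 < κ) (hβ : 0 ≤ β) (y : E) : 0 ≤ profileSlope N β κ y := by
  have := regDist_pos (N := N) hκ y
  unfold profileSlope
  positivity

lemma profileSlope_mul_regDist_le (hκ : 0 < κ) (hβ : 0 ≤ β) (y : E) :
    profileSlope N β κ y * regDist N κ y ≤ 4 * β * N * ‖y‖ ^ (2 * N - 1) := by
  rw [profileSlope, div_mul_cancel₀ _ (regDist_pos hκ y).ne']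
  exact mul_le_mul_of_nonneg_right
    (mul_le_of_le_one_right (by positivity) (div_regDist_rpow_le_one hκ hβ y)) (by positivity)

variable [InnerProductSpace ℝ E]

lemma norm_add_pow_two_mul {y : E} (hy : y ≠ 0) (h : E) (N : ℕ) :
    ‖y + h‖ ^ (2 * N) =
      ‖y‖ ^ (2 * N) * (1 + (2 * inner ℝ y h + ‖h‖ ^ 2) / ‖y‖ ^ 2) ^ N := by
  have : ‖y‖ ≠ 0 := norm_ne_zero_iff.2 hy
  rw [pow_mul, pow_mul, ← mul_pow, norm_add_sq_real]
  congr 1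
  field_simp
  ring

lemma abs_two_inner_add_sq_div_le {y h : E} (hh : ‖h‖ ≤ ‖y‖) :
    |(2 * inner ℝ y h + ‖h‖ ^ 2) / ‖y‖ ^ 2| ≤ 3 * (‖h‖ / ‖y‖) := by
  rcases eq_or_ne y 0 with rfl | hy
  · simp
  have : 0 < ‖y‖ := norm_pos_iff.2 hy
  rw [abs_div, abs_of_pos (by positivity : 0 < ‖y‖ ^ 2), div_le_iff₀ (by positivity)]
  calc |2 * inner ℝ y h + ‖h‖ ^ 2| ≤ 2 * (‖y‖ * ‖h‖) + ‖h‖ * ‖y‖ := by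
        refine (abs_add_le _ _).trans ?_
        rw [abs_mul, abs_two, abs_of_nonneg (sq_nonneg ‖h‖), sq]
        gcongr
        exact abs_real_inner_le_norm y h
    _ = 3 * (‖h‖ / ‖y‖) * ‖y‖ ^ 2 := by
        field_simp
        ring

lemma abs_norm_add_pow_sub_le (hN : N ≠ 0) {y h : E} (hh : 3 * ‖h‖ ≤ ‖y‖) :
    |‖y + h‖ ^ (2 * N) - ‖y‖ ^ (2 * N)| ≤ 3 * 2 ^ N * ‖y‖ ^ (2 * N - 1) * ‖h‖ := by
  rcases eq_or_ne y 0 with rfl | hy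
  · have hh0 : ‖h‖ = 0 := le_antisymm (by simp at hh; linarith [norm_nonneg h]) (norm_nonneg h)
    simp [hh0]
  have hy0 : 0 < ‖y‖ := norm_pos_iff.2 hy
  have ht := abs_two_inner_add_sq_div_le (y := y) (h := h) (by linarith [norm_nonneg h])
  have hratio : 3 * (‖h‖ / ‖y‖) ≤ 1 := by rwa [← mul_div_assoc, div_le_one hy0]
  rw [norm_add_pow_two_mul hy, ← mul_sub_one, abs_mul, abs_of_pos (by positivity)]
  calc ‖y‖ ^ (2 * N) * |(1 + (2 * inner ℝ y h + ‖h‖ ^ 2) / ‖y‖ ^ 2) ^ N - 1|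
      ≤ ‖y‖ ^ (2 * N) * (2 ^ N * (3 * (‖h‖ / ‖y‖))) := by
        gcongr
        exact (abs_one_add_pow_sub_one_le (ht.trans hratio) N).trans (by gcongr)
    _ = 3 * 2 ^ N * ‖y‖ ^ (2 * N - 1) * ‖h‖ := by
        rw [← pow_sub_one_mul (by omega : 2 * N ≠ 0)]
        field_simp

lemma norm_add_pow_sub_le (hN : N ≠ 0) {y h : E} (hy : y ≠ 0) (hh : 3 * ‖h‖ ≤ ‖y‖) :
    ‖y + h‖ ^ (2 * N) - ‖y‖ ^ (2 * N) ≤ 2 * N * ‖y‖ ^ (2 * N - 1) *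
      (inner ℝ (‖y‖⁻¹ • y) h + (N + 9 * 2 ^ N) / (2 * N) * ‖h‖ ^ 2 / ‖y‖) := by
  have hy0 : 0 < ‖y‖ := norm_pos_iff.2 hy
  set t := (2 * inner ℝ y h + ‖h‖ ^ 2) / ‖y‖ ^ 2 with ht_def
  have ht : |t| ≤ 3 * (‖h‖ / ‖y‖) := abs_two_inner_add_sq_div_le (by linarith [norm_nonneg h])
  have hratio : 3 * (‖h‖ / ‖y‖) ≤ 1 := by rwa [← mul_div_assoc, div_le_one hy0]
  have hexpand : (1 + t) ^ N - 1 ≤ N * t + 2 ^ N * (3 * (‖h‖ / ‖y‖)) ^ 2 := by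
    have hsq : 2 ^ N * t ^ 2 ≤ 2 ^ N * (3 * (‖h‖ / ‖y‖)) ^ 2 := by
      rw [← sq_abs t]
      gcongr
    linarith [(abs_le.1 (abs_one_add_pow_sub_one_sub_le (ht.trans hratio) N)).2]
  calc ‖y + h‖ ^ (2 * N) - ‖y‖ ^ (2 * N) = ‖y‖ ^ (2 * N) * ((1 + t) ^ N - 1) := by
        rw [norm_add_pow_two_mul hy, mul_sub_one]
    _ ≤ ‖y‖ ^ (2 * N) * (N * t + 2 ^ N * (3 * (‖h‖ / ‖y‖)) ^ 2) := by gcongr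
    _ = _ := by
        rw [← pow_sub_one_mul (by omega : 2 * N ≠ 0), ht_def, real_inner_smul_left]
        field_simp
        ring

lemma norm_add_pow_sub_le_half_regDist (hN : N ≠ 0) (hκ : 0 < κ) {y h : E} (hy : ‖y‖ ≤ 1)
    (hh : ‖h‖ < touchRadius N κ y) :
    ‖y + h‖ ^ (2 * N) - ‖y‖ ^ (2 * N) ≤ 1 / 2 * regDist N κ y := by
  have hy_pow : ‖y‖ ^ (2 * N - 1) ≤ 1 := pow_le_one₀ (norm_nonneg y) hy
  calc ‖y + h‖ ^ (2 * N) - ‖y‖ ^ (2 * N) ≤ 3 * 2 ^ N * ‖y‖ ^ (2 * N - 1) * ‖h‖ :=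
        (le_abs_self _).trans (abs_norm_add_pow_sub_le hN
          (by linarith [touchRadius_le_norm (N := N) hκ y, norm_nonneg h]))
    _ ≤ 3 * 2 ^ N * 1 * touchRadius N κ y := by gcongr
    _ ≤ 1 / 2 * regDist N κ y := by linarith [two_pow_mul_touchRadius_le (N := N) (κ := κ) y]

lemma sq_norm_add_pow_sub_div_le (hN : N ≠ 0) (hκ : 0 < κ) {y h : E} (hy0 : y ≠ 0) (hy : ‖y‖ ≤ 1)
    (hh : ‖h‖ < touchRadius N κ y) :
    ((‖y + h‖ ^ (2 * N) - ‖y‖ ^ (2 * N)) / regDist N κ y) ^ 2 ≤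
      (3 * 2 ^ N) ^ 2 * ‖y‖ ^ (2 * N - 1) * ‖h‖ ^ 2 / (regDist N κ y * touchRadius N κ y) := by
  have hd := regDist_pos (N := N) hκ y
  have hρ := touchRadius_pos (N := N) hκ hy0
  have hy_pow : ‖y‖ ^ (2 * N - 1) ≤ 1 := pow_le_one₀ (norm_nonneg y) hy
  rw [div_pow, ← sq_abs (_ - _)]
  calc |‖y + h‖ ^ (2 * N) - ‖y‖ ^ (2 * N)| ^ 2 / regDist N κ y ^ 2
      ≤ (3 * 2 ^ N * ‖y‖ ^ (2 * N - 1) * ‖h‖) ^ 2 / regDist N κ y ^ 2 := by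
        gcongr
        exact abs_norm_add_pow_sub_le hN
          (by linarith [touchRadius_le_norm (N := N) hκ y, norm_nonneg h])
    _ = (3 * 2 ^ N) ^ 2 * (‖y‖ ^ (2 * N - 1) * ‖y‖ ^ (2 * N - 1)) * ‖h‖ ^ 2 /
          (regDist N κ y * regDist N κ y) := by ring
    _ ≤ (3 * 2 ^ N) ^ 2 * (‖y‖ ^ (2 * N - 1) * 1) * ‖h‖ ^ 2 /
          (regDist N κ y * touchRadius N κ y) := by
        gcongr
        exact touchRadius_le_regDist hκ hy0
    _ = _ := by rw [mul_one]

lemma exists_profile_add_sub_le (hN : N ≠ 0) (hβ : 0 < β) :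
    ∃ C : ℝ, 0 ≤ C ∧ ∀ κ : ℝ, 0 < κ → ∀ y : E, y ≠ 0 → ‖y‖ < 1 →
      ∀ h ∈ ball 0 (touchRadius N κ y),
        profile N β κ (y + h) - profile N β κ y ≤
          profileSlope N β κ y *
            (inner ℝ (‖y‖⁻¹ • y) h + C * ‖h‖ ^ 2 / touchRadius N κ y) := by
  set B := β * (β + 1) * 2 ^ (β + 2)
  set C₁ : ℝ := (N + 9 * 2 ^ N) / (2 * N)
  set C₂ : ℝ := B * (3 * 2 ^ N) ^ 2 / (2 * β * N) with hC₂
  have : 0 ≤ C₁ := by positivity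
  refine ⟨C₁ + C₂, by positivity, fun κ hκ y hy0 hy1 h hh => ?_⟩
  rw [mem_ball_zero_iff] at hh
  set d := regDist N κ y with hd
  set b := ‖y‖ ^ (2 * N - 1) with hb
  set ρ := touchRadius N κ y
  have hd0 : 0 < d := regDist_pos hκ y
  have hρ0 : 0 < ρ := touchRadius_pos hκ hy0
  have hρy : 6 * ρ ≤ ‖y‖ := touchRadius_le_norm hκ y
  have hfirst := norm_add_pow_sub_le hN hy0 (h := h) (by linarith)
  have hsecond := sq_norm_add_pow_sub_div_le hN hκ hy0 hy1.le hh
  set q := (‖y + h‖ ^ (2 * N) - ‖y‖ ^ (2 * N)) / d with hq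
  have hq_half : q ≤ 1 / 2 :=
    (div_le_iff₀ hd0).2 (norm_add_pow_sub_le_half_regDist hN hκ hy1.le hh)
  have hq_le : q ≤ 2 * N * b * (inner ℝ (‖y‖⁻¹ • y) h + C₁ * ‖h‖ ^ 2 / ρ) / d := by
    rw [hq]
    gcongr
    refine hfirst.trans ?_
    gcongr
    linarith
  calc profile N β κ (y + h) - profile N β κ y
      ≤ 2 * (κ / d) ^ β * (β * q + B * q ^ 2) :=
        profile_sub_le hκ hβ.le hy1.le hq_half (div_mul_cancel₀ _ hd0.ne').symm
    _ ≤ 2 * (κ / d) ^ β * (β * (2 * N * b * (inner ℝ (‖y‖⁻¹ • y) h + C₁ * ‖h‖ ^ 2 / ρ) / d) +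
          B * ((3 * 2 ^ N) ^ 2 * b * ‖h‖ ^ 2 / (d * ρ))) := by gcongr
    _ = _ := by
        rw [hC₂, profileSlope, ← hd, ← hb]
        field_simp
        ring

end Profile

section Operator

lemma integral_le_of_lintegral_ofReal_le {α : Type*} [MeasurableSpace α] {μ : Measure α}
    {f : α → ℝ} {M : ℝ} (hM : 0 ≤ M) (h : ∫⁻ x, ENNReal.ofReal (f x) ∂μ ≤ ENNReal.ofReal M) :
    ∫ x, f x ∂μ ≤ M := by
  by_cases hf : Integrable f μ
  · rw [integral_eq_lintegral_pos_part_sub_lintegral_neg_part hf]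
    exact (sub_le_self _ ENNReal.toReal_nonneg).trans (ENNReal.toReal_le_of_le_ofReal hM h)
  · rwa [integral_undef hf]

lemma norm_mul_regDist_le_touchRadius {E : Type*} [NormedAddCommGroup E] (N : ℕ) {κ : ℝ}
    (hκ : 0 < κ) (hκ1 : κ ≤ 1) {y : E} (hy : ‖y‖ ≤ 1) :
    ‖y‖ * regDist N κ y ≤ 12 * 2 ^ N * touchRadius N κ y := by
  have hd := regDist_pos (N := N) hκ y
  have hd2 : regDist N κ y ≤ 2 := (regDist_le y).trans (by linarith)
  have hmin : ‖y‖ * regDist N κ y ≤ 2 * min ‖y‖ (regDist N κ y) := by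
    rw [mul_min_of_nonneg _ _ zero_le_two]
    exact le_min (by nlinarith [norm_nonneg y]) (by nlinarith)
  refine hmin.trans_eq ?_
  rw [touchRadius]
  field_simp
  ring

lemma norm_pow_rpow_mul_touchRadius_rpow_le {E : Type*} [NormedAddCommGroup E] {N : ℕ}
    {κ σ r : ℝ} (hκ : 0 < κ) (hκ1 : κ ≤ 1) (hσ : 0 ≤ σ) (hσr : σ ≤ (2 * N - 1 : ℕ) * r) {y : E}
    (hy0 : y ≠ 0) (hy : ‖y‖ ≤ 1) :
    (‖y‖ ^ (2 * N - 1)) ^ r * touchRadius N κ y ^ (-σ) ≤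
      (12 * 2 ^ N) ^ σ * regDist N κ y ^ (-σ) := by
  have hd := regDist_pos (N := N) hκ y
  have hy_pos : 0 < ‖y‖ := norm_pos_iff.2 hy0
  have hlow : ‖y‖ * regDist N κ y / (12 * 2 ^ N) ≤ touchRadius N κ y :=
    (div_le_iff₀' (by positivity)).2 (norm_mul_regDist_le_touchRadius N hκ hκ1 hy)
  calc (‖y‖ ^ (2 * N - 1)) ^ r * touchRadius N κ y ^ (-σ)
      ≤ ‖y‖ ^ σ * (‖y‖ * regDist N κ y / (12 * 2 ^ N)) ^ (-σ) := by
        rw [← Real.rpow_natCast, ← Real.rpow_mul hy_pos.le]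
        exact mul_le_mul (Real.rpow_le_rpow_of_exponent_ge hy_pos hy hσr)
          (Real.rpow_le_rpow_of_nonpos (by positivity) hlow (by linarith))
          (Real.rpow_nonneg (touchRadius_pos hκ hy0).le _) (by positivity)
    _ = (12 * 2 ^ N) ^ σ * regDist N κ y ^ (-σ) := by
        rw [Real.rpow_neg (by positivity), Real.div_rpow (by positivity) (by positivity),
          Real.mul_rpow hy_pos.le hd.le, Real.rpow_neg hd.le]
        field_simp

lemma setIntegral_spow_mul_kernel_le {E : Type*} [NormedAddCommGroup E] [NormedSpace ℝ E]
    [MeasurableSpace E] {μ : Measure E} {r σ M : ℝ} (hr : 0 < r) {f g : E → ℝ} {S : Set E}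
    (hS : MeasurableSet S) (hg : ∀ h ∈ S, 0 ≤ g h) (hfg : ∀ h ∈ S, f h ≤ g h) (hM : 0 ≤ M)
    (hgM : ∫⁻ h in S, ENNReal.ofReal (g h ^ r * kernel σ h) ∂μ ≤ ENNReal.ofReal M) :
    ∫ h in S, spow r (f h) * kernel σ h ∂μ ≤ M := by
  refine integral_le_of_lintegral_ofReal_le hM
    ((setLIntegral_mono' hS fun h hh => ENNReal.ofReal_le_ofReal ?_).trans hgM)
  rw [← spow_of_nonneg hr (hg h hh)]
  exact mul_le_mul_of_nonneg_right ((strictMono_spow hr).monotone (hfg h hh)) (kernel_nonneg σ h)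

variable {E : Type*} [NormedAddCommGroup E]

section Haar

variable [NormedSpace ℝ E] [FiniteDimensional ℝ E] [MeasurableSpace E] [BorelSpace E]
  {μ : Measure E} [μ.IsAddHaarMeasure]

lemma integrableOn_compl_closedBall_mul_kernel {σ ε M : ℝ} (hσ : 0 < σ) (hε : 0 < ε) {f : E → ℝ}
    (hf : Measurable f) (hM : ∀ h, |f h| ≤ M) :
    IntegrableOn (fun h => f h * kernel σ h) (closedBall 0 ε)ᶜ μ := by
  refine Integrable.bdd_mul ⟨(measurable_kernel σ).aestronglyMeasurable, ?_⟩
    hf.aestronglyMeasurable (.of_forall hM)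
  obtain ⟨C, -, hC⟩ := exists_lintegral_compl_ball_kernel_eq μ hσ
  rw [hasFiniteIntegral_iff_ofReal (.of_forall (kernel_nonneg σ))]
  calc ∫⁻ h in (closedBall 0 ε)ᶜ, ENNReal.ofReal (kernel σ h) ∂μ
      ≤ ∫⁻ h in (ball 0 ε)ᶜ, ENNReal.ofReal (kernel σ h) ∂μ :=
        lintegral_mono_set (compl_subset_compl.2 ball_subset_closedBall)
    _ < ∞ := hC ε hε ▸ ENNReal.ofReal_lt_top

lemma setIntegral_comp_smul_mul_kernel (F : E → ℝ) (σ : ℝ) {r : ℝ} (hr : 0 < r) (S : Set E) :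
    ∫ h in S, F (r • h) * kernel σ h ∂μ = r ^ σ * ∫ k in r • S, F k * kernel σ k ∂μ := by
  have hscale (h : E) : F (r • h) * kernel σ h =
      r ^ (finrank ℝ E + σ) * (F (r • h) * kernel σ (r • h)) := by
    rw [kernel_smul σ hr, mul_left_comm, ← mul_assoc (r ^ _), ← Real.rpow_add hr, add_neg_cancel,
      Real.rpow_zero, one_mul]
  simp_rw [hscale]
  rw [integral_const_mul,
    Measure.setIntegral_comp_smul_of_pos μ (fun k => F k * kernel σ k) S hr, smul_eq_mul,
    ← mul_assoc, add_comm, Real.rpow_add_natCast hr.ne', mul_inv_cancel_right₀ (by positivity)]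

lemma exists_setIntegral_spow_mul_kernel_le_rpow [Nontrivial E] {r σ M : ℝ} (hr : 0 < r)
    (hσ : 0 < σ) (hM : 0 ≤ M) :
    ∃ C : ℝ, 0 ≤ C ∧ ∀ f : E → ℝ, (∀ h, f h ≤ M) → ∀ ρ : ℝ, 0 < ρ → ∀ S : Set E,
      MeasurableSet S → S ⊆ (ball 0 ρ)ᶜ →
        ∫ h in S, spow r (f h) * kernel σ h ∂μ ≤ C * ρ ^ (-σ) := by
  obtain ⟨C, hC, htail⟩ := exists_lintegral_compl_ball_kernel_eq μ hσ
  refine ⟨M ^ r * C, by positivity, fun f hf ρ hρ S hS hSρ =>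
    setIntegral_spow_mul_kernel_le hr hS (fun _ _ => hM) (fun h _ => hf h) (by positivity) ?_⟩
  refine (lintegral_mono_set hSρ).trans_eq ?_
  simp_rw [ENNReal.ofReal_mul (Real.rpow_nonneg hM r)]
  rw [lintegral_const_mul' _ _ ENNReal.ofReal_ne_top, htail ρ hρ, mul_assoc,
    ← ENNReal.ofReal_mul (by positivity)]

lemma exists_setIntegral_spow_mul_kernel_le_of_le_norm_rpow [Nontrivial E] {r σ t M A : ℝ}
    (hr : 0 < r) (hσ : 0 < σ) (hσt : σ < t * r) (hM : 0 ≤ M) (hA : 0 ≤ A) :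
    ∃ C : ℝ, 0 ≤ C ∧ ∀ f : E → ℝ, (∀ h, f h ≤ M) → ∀ S : Set E, MeasurableSet S →
      (∀ h ∈ S, f h ≤ A * ‖h‖ ^ t) → ∫ h in S, spow r (f h) * kernel σ h ∂μ ≤ C := by
  have hfin := lintegral_min_rpow_mul_kernel_lt_top (μ := μ) hσ hr.le hA hM hσt
  refine ⟨(∫⁻ h, ENNReal.ofReal (min M (A * ‖h‖ ^ t) ^ r * kernel σ h) ∂μ).toReal,
    ENNReal.toReal_nonneg, fun f hf S hS hfS => setIntegral_spow_mul_kernel_le hr hS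
      (g := fun h => min M (A * ‖h‖ ^ t))
      (fun _ _ => by positivity) (fun h hh => le_min (hf h) (hfS h hh)) ENNReal.toReal_nonneg ?_⟩
  exact (setLIntegral_le_lintegral _ _).trans_eq (ENNReal.ofReal_toReal hfin.ne).symm

lemma exists_setIntegral_profile_far_le [Nontrivial E] {N : ℕ} {β r σ : ℝ} (hN : N ≠ 0)
    (hβ : 0 ≤ β) (hr : 0 < r) (hσ : 0 < σ) (hσN : σ < (2 * N : ℕ) * r) :
    ∃ C : ℝ, 0 ≤ C ∧ ∀ κ : ℝ, 0 < κ → κ ≤ 1 → ∀ y : E, ∀ S : Set E, MeasurableSet S →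
      S ⊆ (ball 0 (touchRadius N κ y))ᶜ →
        ∫ h in S, spow r (profile N β κ (y + h) - profile N β κ y) * kernel σ h ∂μ ≤
          C * regDist N κ y ^ (-σ) := by
  set c : ℝ := (6 * 2 ^ N)⁻¹
  have hc : 0 < c := by positivity
  obtain ⟨C₁, hC₁, hgrowth⟩ := exists_profile_add_sub_le_norm_pow (E := E) hN hβ hc
  obtain ⟨C₂, hC₂, htail⟩ :=
    exists_setIntegral_spow_mul_kernel_le_rpow (μ := μ) hr hσ zero_le_two
  obtain ⟨C₃, hC₃, hcore⟩ :=
    exists_setIntegral_spow_mul_kernel_le_of_le_norm_rpow (μ := μ) hr hσ hσN zero_le_two hC₁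
  refine ⟨C₂ * c ^ (-σ) + C₃ * 2 ^ σ, by positivity, fun κ hκ hκ1 y S hS hSρ => ?_⟩
  set d := regDist N κ y with hd
  have hd0 : 0 < d := regDist_pos hκ y
  have hincr (h : E) : profile N β κ (y + h) - profile N β κ y ≤ 2 :=
    (abs_le.1 (abs_profile_sub_le hκ hβ _ _)).2
  rw [add_mul]
  rcases le_total d ‖y‖ with hdy | hdy
  · rw [touchRadius, min_eq_right hdy] at hSρ
    have hfar := htail _ hincr (c * d) (by positivity) S hS hSρ
    rw [Real.mul_rpow hc.le hd0.le, ← mul_assoc] at hfar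
    exact hfar.trans (le_add_of_nonneg_right (by positivity))
  · rw [touchRadius, min_eq_left hdy] at hSρ
    have hbounded := hcore _ hincr S hS fun h hh => by
      rw [Real.rpow_natCast]
      exact hgrowth κ hκ y h (not_lt.1 (mt mem_ball_zero_iff.2 (hSρ hh)))
    have hone : 1 ≤ 2 ^ σ * d ^ (-σ) := by
      rw [Real.rpow_neg hd0.le, ← div_eq_mul_inv, ← Real.div_rpow zero_le_two hd0.le]
      exact Real.one_le_rpow ((one_le_div hd0).2 ((regDist_le y).trans (by linarith))) hσ.le
    rw [mul_assoc C₃]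
    exact hbounded.trans ((le_mul_of_one_le_right hC₃ hone).trans
      (le_add_of_nonneg_left (by positivity)))

end Haar

variable [InnerProductSpace ℝ E] [FiniteDimensional ℝ E] [MeasurableSpace E] [BorelSpace E]
  [Nontrivial E]

lemma exists_setIntegral_profile_near_le {N : ℕ} {β p σ : ℝ} (hN : N ≠ 0) (hβ : 0 < β)
    (hp : 1 < p) (hσ : 0 < σ) (hσp : σ < p) (hσN : σ ≤ (2 * N - 1 : ℕ) * (p - 1)) :
    ∃ C : ℝ, 0 ≤ C ∧ ∀ κ : ℝ, 0 < κ → κ ≤ 1 → ∀ y : E, y ≠ 0 → ‖y‖ < 1 → ∀ ε : ℝ, 0 < ε →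
      ∫ h in ball 0 (touchRadius N κ y) \ closedBall 0 ε,
        spow (p - 1) (profile N β κ (y + h) - profile N β κ y) * kernel σ h ≤
          C * regDist N κ y ^ (-σ) := by
  obtain ⟨C₁, hC₁, htouch⟩ := exists_profile_add_sub_le (E := E) hN hβ
  obtain ⟨C₂, hC₂, hannulus⟩ := exists_setIntegral_annulus_spow_le (E := E) hp hσ hσp hC₁
  refine ⟨C₂ * ((4 * β * N) ^ (p - 1) * (12 * 2 ^ N) ^ σ), by positivity,
    fun κ hκ hκ1 y hy0 hy1 ε hε => ?_⟩
  set g := profileSlope N β κ y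
  set ρ := touchRadius N κ y
  have hg : 0 ≤ g := profileSlope_nonneg hκ hβ.le y
  have hρ : 0 < ρ := touchRadius_pos hκ hy0
  have hgρ : g * ρ ≤ 4 * β * N * ‖y‖ ^ (2 * N - 1) :=
    (mul_le_mul_of_nonneg_left (touchRadius_le_regDist hκ hy0) hg).trans
      (profileSlope_mul_regDist_le hκ hβ.le y)
  have hmeas : Measurable fun h => profile N β κ (y + h) - profile N β κ y :=
    (((continuous_profile hκ).comp (continuous_const.add continuous_id)).sub
      continuous_const).measurable
  calc ∫ h in ball 0 ρ \ closedBall 0 ε,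
        spow (p - 1) (profile N β κ (y + h) - profile N β κ y) * kernel σ h
      ≤ C₂ * (g ^ (p - 1) * ρ ^ (p - 1 - σ)) :=
        hannulus _ (‖y‖⁻¹ • y) 2 g ρ ε hmeas (fun h => abs_profile_sub_le hκ hβ.le _ _)
          (norm_smul_inv_norm hy0) hg hρ hε (htouch κ hκ y hy0 hy1)
    _ = C₂ * ((g * ρ) ^ (p - 1) * ρ ^ (-σ)) := by
        rw [Real.mul_rpow hg hρ.le, sub_eq_add_neg (p - 1), Real.rpow_add hρ, mul_assoc]
    _ ≤ C₂ * ((4 * β * N * ‖y‖ ^ (2 * N - 1)) ^ (p - 1) * ρ ^ (-σ)) := by gcongr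
    _ = C₂ * ((4 * β * N) ^ (p - 1) * ((‖y‖ ^ (2 * N - 1)) ^ (p - 1) * ρ ^ (-σ))) := by
        rw [Real.mul_rpow (by positivity) (by positivity), mul_assoc]
    _ ≤ C₂ * ((4 * β * N) ^ (p - 1) * ((12 * 2 ^ N) ^ σ * regDist N κ y ^ (-σ))) := by
        have := norm_pow_rpow_mul_touchRadius_rpow_le hκ hκ1 hσ.le hσN hy0 hy1.le
        gcongr C₂ * (_ * ?_)
    _ = _ := by ring

lemma exists_profile_operator_le {N : ℕ} {β p σ : ℝ} (hN : N ≠ 0) (hβ : 0 < β) (hp : 1 < p)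
    (hσ : 0 < σ) (hσp : σ < p) (hσN : σ ≤ (2 * N - 1 : ℕ) * (p - 1)) :
    ∃ C : ℝ, ∀ κ : ℝ, 0 < κ → κ ≤ 1 → ∀ y : E, y ≠ 0 → ‖y‖ < 1 → ∀ ε : ℝ, 0 < ε →
      ∫ h in (closedBall 0 ε)ᶜ,
        spow (p - 1) (profile N β κ (y + h) - profile N β κ y) * kernel σ h ≤
          C * regDist N κ y ^ (-σ) := by
  have hr : 0 < p - 1 := by linarith
  have hσN' : σ < (2 * N : ℕ) * (p - 1) :=
    hσN.trans_lt (by gcongr; omega)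
  obtain ⟨C₁, -, hnear⟩ := exists_setIntegral_profile_near_le (E := E) hN hβ hp hσ hσp hσN
  obtain ⟨C₂, -, hfar⟩ := exists_setIntegral_profile_far_le (E := E) (μ := volume) hN hβ.le hr
    hσ hσN'
  refine ⟨C₁ + C₂, fun κ hκ hκ1 y hy0 hy1 ε hε => ?_⟩
  have hmeas : Measurable fun h => spow (p - 1) (profile N β κ (y + h) - profile N β κ y) :=
    ((continuous_spow hr).comp (((continuous_profile hκ).comp
      (continuous_const.add continuous_id)).sub continuous_const)).measurable
  have hintegrable : IntegrableOn (fun h => spow (p - 1) (profile N β κ (y + h) - profile N β κ y) *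
      kernel σ h) (closedBall 0 ε)ᶜ :=
    integrableOn_compl_closedBall_mul_kernel (M := 2 ^ (p - 1)) hσ hε hmeas fun h => by
      rw [abs_spow hr]
      exact Real.rpow_le_rpow (abs_nonneg _) (abs_profile_sub_le hκ hβ.le _ _) hr.le
  rw [← integral_inter_add_sdiff (t := ball 0 (touchRadius N κ y)) measurableSet_ball hintegrable,
    inter_comm, ← sdiff_eq, add_mul]
  exact add_le_add (hnear κ hκ hκ1 y hy0 hy1 ε hε)
    (hfar κ hκ hκ1 y _ (measurableSet_closedBall.compl.diff measurableSet_ball) fun h hh => hh.2)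

end Operator

section Barrier

/-- The profile rescaled to the ball of radius `R`, with `κ = L / R`, so that `1 + barrier`
equals `2 * (L / (R * regDist)) ^ β` and decays away from the sphere at a rate independent of
`R`. -/
def barrier {E : Type*} [NormedAddCommGroup E] [NormedSpace ℝ E] (N : ℕ) (β L R : ℝ) (x : E) : ℝ :=
  profile N β (L / R) (R⁻¹ • x)

variable {E : Type*} [NormedAddCommGroup E] {N : ℕ} {β L R : ℝ}

section NormedSpace

variable [NormedSpace ℝ E]

lemma one_add_barrier (N : ℕ) (β L R : ℝ) (x : E) :
    1 + barrier N β L R x = 2 * (L / (R * regDist N (L / R) (R⁻¹ • x))) ^ β := by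
  rw [barrier, profile, div_div]
  ring

lemma one_add_barrier_rpow {m σ : ℝ} (hL : 0 < L) (hR : 0 < R) (hβm : β * (m - 1) = σ) (x : E) :
    (1 + barrier N β L R x) ^ (m - 1) =
      2 ^ (m - 1) * L ^ σ * (R * regDist N (L / R) (R⁻¹ • x)) ^ (-σ) := by
  have hd : 0 < R * regDist N (L / R) (R⁻¹ • x) := mul_pos hR (regDist_pos (by positivity) _)
  rw [one_add_barrier, Real.mul_rpow zero_le_two (by positivity), ← Real.rpow_mul (by positivity),
    hβm, Real.div_rpow hL.le hd.le, Real.rpow_neg hd.le]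
  ring

lemma barrier_of_le_norm (hL : 0 < L) (hR : 0 < R) {x : E} (hx : R ≤ ‖x‖) :
    barrier N β L R x = 1 := by
  refine profile_of_one_le_norm (by positivity) ?_
  rwa [norm_smul_of_nonneg (by positivity), inv_mul_eq_div, one_le_div hR]

lemma add_sub_norm_le_mul_regDist (hN : N ≠ 0) (L : ℝ) (hR : 0 < R) {x : E} (hx : ‖x‖ ≤ R) :
    L + R - ‖x‖ ≤ R * regDist N (L / R) (R⁻¹ • x) := by
  have hnorm : ‖R⁻¹ • x‖ = ‖x‖ / R := by
    rw [norm_smul_of_nonneg (by positivity), inv_mul_eq_div]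
  have hpow : (‖x‖ / R) ^ (2 * N) ≤ ‖x‖ / R :=
    pow_le_of_le_one (by positivity) ((div_le_one hR).2 hx) (by omega)
  calc L + R - ‖x‖ = R * (L / R + (1 - ‖x‖ / R)) := by field_simp; ring
    _ ≤ R * (L / R + (1 - ‖R⁻¹ • x‖ ^ (2 * N))) := by rw [hnorm]; gcongr
    _ ≤ _ := by gcongr; exact le_regDist_sub_norm_pow _

lemma barrier_le_of_norm_le (hN : N ≠ 0) (hβ : 0 < β) (hL : 0 < L) {a : ℝ} (ha : 0 < a)
    {x : E} (hx : ‖x‖ + L / (a / 2) ^ β⁻¹ ≤ L + R) (hxR : ‖x‖ ≤ R) (hR : 0 < R) :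
    barrier N β L R x ≤ -1 + a := by
  have hd : 0 < R * regDist N (L / R) (R⁻¹ • x) := mul_pos hR (regDist_pos (by positivity) _)
  have hlarge : L / (a / 2) ^ β⁻¹ ≤ R * regDist N (L / R) (R⁻¹ • x) :=
    le_trans (by linarith) (add_sub_norm_le_mul_regDist hN L hR hxR)
  have hsmall : (L / (R * regDist N (L / R) (R⁻¹ • x))) ^ β ≤ a / 2 :=
    calc _ ≤ ((a / 2) ^ β⁻¹) ^ β := by
          gcongr
          exact (div_le_comm₀ (by positivity) hd).1 hlarge
      _ = a / 2 := Real.rpow_inv_rpow (by positivity) hβ.ne'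
  linarith [one_add_barrier N β L R x]

lemma setIntegral_barrier_mul_kernel [MeasurableSpace E] [BorelSpace E] [FiniteDimensional ℝ E]
    {μ : Measure E} [μ.IsAddHaarMeasure] (r σ : ℝ) {ε : ℝ} (hR : 0 < R) (x : E) :
    ∫ h in (closedBall 0 ε)ᶜ,
        spow r (barrier N β L R (x + h) - barrier N β L R x) * kernel σ h ∂μ =
      R ^ (-σ) * ∫ k in (closedBall 0 (ε / R))ᶜ,
        spow r (profile N β (L / R) (R⁻¹ • x + k) - profile N β (L / R) (R⁻¹ • x)) *
          kernel σ k ∂μ := by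
  have hset : R⁻¹ • (closedBall (0 : E) ε)ᶜ = (closedBall 0 (ε / R))ᶜ := by
    rw [compl_eq_univ_sdiff, smul_set_sdiff₀ (inv_ne_zero hR.ne'),
      smul_set_univ₀ (inv_ne_zero hR.ne'), ← compl_eq_univ_sdiff,
      smul_closedBall' (inv_ne_zero hR.ne'), smul_zero, Real.norm_of_nonneg (by positivity),
      inv_mul_eq_div]
  have hscale := setIntegral_comp_smul_mul_kernel (μ := μ) (fun k => spow r
    (profile N β (L / R) (R⁻¹ • x + k) - profile N β (L / R) (R⁻¹ • x))) σ (inv_pos.2 hR)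
    (closedBall 0 ε)ᶜ
  rw [hset, Real.inv_rpow hR.le, ← Real.rpow_neg hR.le] at hscale
  simpa only [barrier, smul_add] using hscale

end NormedSpace

lemma exists_barrier [InnerProductSpace ℝ E] [FiniteDimensional ℝ E] [MeasurableSpace E]
    [BorelSpace E] [Nontrivial E] {p σ m τ a : ℝ} (hp : 1 < p) (hσ : 0 < σ) (hσp : σ < p)
    (hm : 1 < m) (hτ : 0 < τ) (ha : 0 < a) :
    ∃ K C : ℝ, 0 < K ∧ 0 < C ∧ ∀ R : ℝ, K ≤ R → ∃ w : E → ℝ, Continuous w ∧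
      (∀ x, w x ∈ Ioc (-1 : ℝ) 1) ∧ (∀ x, R ≤ ‖x‖ → w x = 1) ∧
      (∀ x, ‖x‖ ≤ R - K → w x ≤ -1 + a) ∧
      (∀ x, ‖x‖ ≤ R → (1 + w x) ^ (m - 1) ≤ C * (1 + R - ‖x‖) ^ (-σ)) ∧
      ∀ x, x ≠ 0 → ‖x‖ < R → ∀ ε : ℝ, 0 < ε →
        ∫ h in (closedBall 0 ε)ᶜ, spow (p - 1) (w (x + h) - w x) * kernel σ h ≤
          τ * (1 + w x) ^ (m - 1) := by
  have hp1 : 0 < p - 1 := by linarith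
  have hm1 : 0 < m - 1 := by linarith
  obtain ⟨N, hN, hNσ⟩ : ∃ N : ℕ, N ≠ 0 ∧ σ ≤ (2 * N - 1 : ℕ) * (p - 1) := by
    obtain ⟨N, hN⟩ := exists_nat_ge (σ / (p - 1))
    refine ⟨N + 1, by omega, ((div_le_iff₀ hp1).1 hN).trans ?_⟩
    gcongr
    omega
  set β := σ / (m - 1)
  have hβ : 0 < β := by positivity
  have hβm : β * (m - 1) = σ := div_mul_cancel₀ _ hm1.ne'
  obtain ⟨C, hoperator⟩ := exists_profile_operator_le (E := E) hN hβ hp hσ hσp hNσ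
  -- By homogeneity the operator costs `C * (R * regDist) ^ (-σ)`, while the right-hand side
  -- carries the extra factor `L ^ σ`.
  obtain ⟨L, hL, hLσ⟩ : ∃ L : ℝ, 1 ≤ L ∧ C / (τ * 2 ^ (m - 1)) ≤ L ^ σ :=
    ((eventually_ge_atTop 1).and ((tendsto_rpow_atTop hσ).eventually_ge_atTop _)).exists
  have hL0 : 0 < L := by linarith
  refine ⟨max L (L / (a / 2) ^ β⁻¹), 2 ^ (m - 1) * L ^ σ, by positivity, by positivity,
    fun R hR => ?_⟩
  have hLR : L ≤ R := (le_max_left _ _).trans hR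
  have hR0 : 0 < R := by linarith
  have hκ : 0 < L / R := by positivity
  refine ⟨barrier N β L R, (continuous_profile hκ).comp (continuous_const_smul _),
    fun x => profile_mem_Ioc hκ hβ.le _, fun x hx => barrier_of_le_norm hL0 hR0 hx,
    fun x hx => ?_, fun x hx => ?_, fun x hx0 hx ε hε => ?_⟩
  · refine barrier_le_of_norm_le hN hβ hL0 ha ?_ ?_ hR0 <;>
      linarith [le_max_left L (L / (a / 2) ^ β⁻¹), le_max_right L (L / (a / 2) ^ β⁻¹)]
  · rw [one_add_barrier_rpow hL0 hR0 hβm]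
    gcongr 2 ^ (m - 1) * L ^ σ * ?_
    exact Real.rpow_le_rpow_of_nonpos (by linarith)
      (by linarith [add_sub_norm_le_mul_regDist hN L hR0 hx]) (by linarith)
  · have hd := regDist_pos (N := N) hκ (R⁻¹ • x)
    rw [setIntegral_barrier_mul_kernel _ _ hR0, one_add_barrier_rpow hL0 hR0 hβm]
    have hx1 : ‖R⁻¹ • x‖ < 1 := by
      rwa [norm_smul_of_nonneg (by positivity), inv_mul_eq_div, div_lt_one hR0]
    calc _ ≤ R ^ (-σ) * (C * regDist N (L / R) (R⁻¹ • x) ^ (-σ)) := by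
          gcongr
          exact hoperator _ hκ ((div_le_one hR0).2 hLR) _ (by simp [hR0.ne', hx0]) hx1 _
            (by positivity)
      _ = C * (R * regDist N (L / R) (R⁻¹ • x)) ^ (-σ) := by
          rw [Real.mul_rpow hR0.le hd.le]
          ring
      _ ≤ τ * 2 ^ (m - 1) * L ^ σ * (R * regDist N (L / R) (R⁻¹ • x)) ^ (-σ) := by
          gcongr
          exact (div_le_iff₀' (by positivity)).1 hLσ
      _ = _ := by ring

end Barrier

/-! ### A nonlocal isoperimetric inequality -/

section Isoperimetric

lemma exists_dyadic_scale {d : ℕ} (hd : d ≠ 0) {b v M : ℝ} (hb : 0 < b) (hv : 0 ≤ v)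
    (hvM : v ≤ M) {N : ℕ} (hvN : v ≤ b * (2 ^ N) ^ d) :
    ∃ N' ≥ N, M ≤ b * (2 ^ N') ^ d ∧ (2 ^ d)⁻¹ * (v / 2 ^ N) ≤ M / 2 ^ N' := by
  have hex : ∃ N' ≥ N, M ≤ b * (2 ^ N') ^ d := by
    obtain ⟨k, hk⟩ := pow_unbounded_of_one_lt (M / b) (one_lt_two (α := ℝ))
    refine ⟨max N k, le_max_left _ _, (div_le_iff₀' hb).1 (hk.le.trans ?_)⟩
    exact (pow_le_pow_right₀ one_le_two (le_max_right N k)).trans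
      (le_self_pow₀ (one_le_pow₀ one_le_two) hd)
  classical
  obtain ⟨hN, hM⟩ := Nat.find_spec hex
  refine ⟨Nat.find hex, hN, hM, ?_⟩
  rcases eq_or_lt_of_le hN with heq | hlt
  · rw [← heq, ← div_eq_inv_mul]
    exact (div_le_self (by positivity) (one_le_pow₀ one_le_two)).trans (by gcongr)
  obtain ⟨i, hi⟩ : ∃ i, Nat.find hex = N + i + 1 := ⟨Nat.find hex - N - 1, by omega⟩
  have hsmall : b * (2 ^ (N + i)) ^ d ≤ M := by
    by_contra! h
    exact Nat.find_min hex (by omega) ⟨by omega, h.le⟩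
  obtain ⟨k, rfl⟩ : ∃ k, d = k + 1 := Nat.exists_eq_succ_of_ne_zero hd
  rw [hi]
  calc ((2 : ℝ) ^ (k + 1))⁻¹ * (v / 2 ^ N)
      ≤ ((2 : ℝ) ^ (k + 1))⁻¹ * ((b * (2 ^ N) ^ (k + 1)) / 2 ^ N) := by gcongr
    _ = (2 ^ (k + 1))⁻¹ * (b * (2 ^ N) ^ k) := by rw [pow_succ (2 ^ N)]; field_simp
    _ ≤ 2⁻¹ * (b * (2 ^ (N + i)) ^ k) := by
        gcongr
        · exact le_self_pow₀ one_le_two (by omega)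
        · exact one_le_two
        · omega
    _ = (b * (2 ^ (N + i)) ^ (k + 1)) / 2 ^ (N + i + 1) := by
        rw [pow_succ (2 ^ (N + i)), pow_succ 2 (N + i)]; field_simp
    _ ≤ M / 2 ^ (N + i + 1) := by gcongr

/-- The geometric sum `∑ j ≤ N, 2 ^ (j * (1 - σ))`, the gain of the nonlocal isoperimetric
inequality at scale `2 ^ N` over the volume-to-scale ratio. -/
def dyadicSum (σ : ℝ) (N : ℕ) : ℝ := ∑ j ∈ Finset.range (N + 1), ((2 : ℝ) ^ (1 - σ)) ^ j

lemma monotone_dyadicSum (σ : ℝ) : Monotone (dyadicSum σ) := fun _ _ h =>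
  Finset.sum_le_sum_of_subset_of_nonneg (Finset.range_mono (by omega)) fun _ _ _ => by positivity

lemma one_le_dyadicSum (σ : ℝ) (N : ℕ) : 1 ≤ dyadicSum σ N :=
  calc 1 = dyadicSum σ 0 := by simp [dyadicSum]
    _ ≤ dyadicSum σ N := monotone_dyadicSum σ N.zero_le

variable {E : Type*} [NormedAddCommGroup E]

/-- The measure of the points of `S` which leave `S` under translation by `h`. -/
def shiftLoss [MeasurableSpace E] (μ : Measure E) (S : Set E) (h : E) : ℝ≥0∞ :=
  μ (S ∩ (· + h) ⁻¹' Sᶜ)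

variable (E) in
/-- The `j`-th dyadic shell around the origin. -/
def dyadicShell (j : ℕ) : Set E := ball 0 (2 ^ (j + 1)) \ ball 0 (2 ^ j)

lemma disjoint_dyadicShell {i j : ℕ} (h : i ≠ j) :
    Disjoint (dyadicShell E i) (dyadicShell E j) := by
  wlog hij : i < j generalizing i j
  · exact (this h.symm (by omega)).symm
  refine disjoint_sdiff_right.mono_left (sdiff_subset.trans (ball_subset_ball ?_))
  exact pow_le_pow_right₀ one_le_two hij

lemma measurableSet_dyadicShell [MeasurableSpace E] [BorelSpace E] (j : ℕ) :
    MeasurableSet (dyadicShell E j) :=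
  measurableSet_ball.diff measurableSet_ball

lemma shiftLoss_add_self_le [MeasurableSpace E] [BorelSpace E] {μ : Measure E}
    [μ.IsAddRightInvariant] (S : Set E) (h : E) :
    shiftLoss μ S (h + h) ≤ 2 * shiftLoss μ S h := by
  have hsub : S ∩ (· + (h + h)) ⁻¹' Sᶜ ⊆
      (S ∩ (· + h) ⁻¹' Sᶜ) ∪ (· + h) ⁻¹' (S ∩ (· + h) ⁻¹' Sᶜ) := by
    rintro x ⟨hx, hx2⟩
    by_cases hxh : x + h ∈ S
    · exact .inr ⟨hxh, by simpa only [mem_preimage, add_assoc] using hx2⟩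
    · exact .inl ⟨hx, hxh⟩
  refine (measure_mono hsub).trans ((measure_union_le _ _).trans_eq ?_)
  rw [measure_preimage_add_right, two_mul, shiftLoss]

variable [NormedSpace ℝ E]

/-- The kernel of order `σ` cut off to `1 ≤ ‖h‖`, where it is integrable. -/
def farKernel (σ : ℝ) (h : E) : ℝ≥0∞ :=
  (ball 0 1)ᶜ.indicator (fun h => ENNReal.ofReal (kernel σ h)) h

/-- The interaction energy of two sets through `farKernel`. -/
def interaction [MeasurableSpace E] (μ : Measure E) (σ : ℝ) (S T : Set E) : ℝ≥0∞ :=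
  ∫⁻ x in S, ∫⁻ y in T, farKernel σ (x - y) ∂μ ∂μ

lemma farKernel_neg (σ : ℝ) (h : E) : farKernel σ (-h) = farKernel σ h := by
  simp only [farKernel, indicator, mem_compl_iff, mem_ball_zero_iff, norm_neg, kernel_neg]

lemma smul_dyadicShell (i j : ℕ) : (2 : ℝ) ^ i • dyadicShell E j = dyadicShell E (i + j) := by
  have h2 : (2 : ℝ) ^ i ≠ 0 := by positivity
  rw [dyadicShell, smul_set_sdiff₀ h2, _root_.smul_ball h2, _root_.smul_ball h2, smul_zero,
    Real.norm_of_nonneg (by positivity), ← pow_add, ← pow_add, dyadicShell, add_assoc]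

lemma ofReal_rpow_le_farKernel {σ : ℝ} (hσ : 0 ≤ σ) {j : ℕ} {h : E} (hh : h ∈ dyadicShell E j) :
    ENNReal.ofReal ((2 ^ (j + 1)) ^ (-(finrank ℝ E + σ))) ≤ farKernel σ h := by
  have hh2 := mem_ball_zero_iff.1 hh.1
  have hh1 : 1 ≤ ‖h‖ :=
    (one_le_pow₀ one_le_two).trans (not_lt.1 (mt mem_ball_zero_iff.2 hh.2))
  rw [farKernel, indicator_of_mem (by simpa using hh1)]
  exact ENNReal.ofReal_le_ofReal
    (Real.rpow_le_rpow_of_nonpos (by linarith) hh2.le (neg_nonpos.2 (by positivity)))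

lemma measure_dyadicShell_ne_top [MeasurableSpace E] [FiniteDimensional ℝ E]
    {μ : Measure E} [IsFiniteMeasureOnCompacts μ] (N : ℕ) : μ (dyadicShell E N) ≠ ∞ :=
  ((measure_mono sdiff_subset).trans_lt measure_ball_lt_top).ne

lemma measureReal_dyadicShell_zero_pos [Nontrivial E] [MeasurableSpace E]
    [FiniteDimensional ℝ E] {μ : Measure E} [IsFiniteMeasureOnCompacts μ]
    [μ.IsOpenPosMeasure] : 0 < μ.real (dyadicShell E 0) := by
  refine ENNReal.toReal_pos ?_ (measure_dyadicShell_ne_top 0)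
  have hsub : ball 0 2 \ closedBall 0 1 ⊆ dyadicShell E 0 := by
    rw [dyadicShell, zero_add, pow_one, pow_zero]
    exact sdiff_subset_sdiff_right ball_subset_closedBall
  obtain ⟨x, hx⟩ := exists_norm_eq E (c := 3 / 2) (by norm_num)
  refine ((isOpen_ball.sdiff isClosed_closedBall).measure_pos μ ⟨x, ?_⟩ |>.trans_le
    (measure_mono hsub)).ne'
  constructor <;> simp [hx] <;> norm_num

variable [MeasurableSpace E] [BorelSpace E]

lemma measurable_farKernel (σ : ℝ) : Measurable (farKernel σ : E → ℝ≥0∞) :=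
  (measurable_kernel σ).ennreal_ofReal.indicator measurableSet_ball.compl

lemma shiftLoss_two_pow_smul_le {μ : Measure E} [μ.IsAddRightInvariant]
    (S : Set E) (j : ℕ) (h : E) :
    shiftLoss μ S ((2 : ℝ) ^ j • h) ≤ 2 ^ j * shiftLoss μ S h := by
  induction j with
  | zero => simp
  | succ j ih =>
    calc shiftLoss μ S ((2 : ℝ) ^ (j + 1) • h)
        = shiftLoss μ S ((2 : ℝ) ^ j • h + (2 : ℝ) ^ j • h) := by rw [← add_smul, pow_succ, mul_two]
      _ ≤ 2 * (2 ^ j * shiftLoss μ S h) := (shiftLoss_add_self_le S _).trans (by gcongr)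
      _ = 2 ^ (j + 1) * shiftLoss μ S h := by rw [pow_succ]; ring

variable [FiniteDimensional ℝ E] {μ : Measure E} [μ.IsAddHaarMeasure]

lemma lintegral_mul_shiftLoss {S : Set E} (hS : MeasurableSet S) {F : E → ℝ≥0∞}
    (hF : Measurable F) :
    ∫⁻ h, F h * shiftLoss μ S h ∂μ = ∫⁻ x in S, ∫⁻ h in (x + ·) ⁻¹' Sᶜ, F h ∂μ ∂μ := by
  have hind : Measurable fun z : E × E => Sᶜ.indicator (1 : E → ℝ≥0∞) (z.1 + z.2) :=
    (measurable_one.indicator hS.compl).comp measurable_add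
  calc ∫⁻ h, F h * shiftLoss μ S h ∂μ
      = ∫⁻ h, ∫⁻ x in S, F h * Sᶜ.indicator 1 (x + h) ∂μ ∂μ := by
        refine lintegral_congr fun h => ?_
        have hshift : Measurable fun x => Sᶜ.indicator (1 : E → ℝ≥0∞) (x + h) :=
          hind.comp (measurable_id.prodMk measurable_const)
        rw [lintegral_const_mul _ hshift,
          shiftLoss, inter_comm, ← Measure.restrict_apply (measurable_add_const h hS.compl),
          ← lintegral_indicator_one (measurable_add_const h hS.compl)]
        rfl
    _ = ∫⁻ x in S, ∫⁻ h, F h * Sᶜ.indicator 1 (x + h) ∂μ ∂μ :=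
        lintegral_lintegral_swap
          ((hF.comp measurable_fst).mul (hind.comp measurable_swap)).aemeasurable
    _ = ∫⁻ x in S, ∫⁻ h in (x + ·) ⁻¹' Sᶜ, F h ∂μ ∂μ := by
        refine lintegral_congr fun x => ?_
        rw [← lintegral_indicator ((measurable_const_add x) hS.compl)]
        refine lintegral_congr fun h => ?_
        by_cases hh : x + h ∈ S <;> simp [hh]

lemma interaction_compl_eq {S : Set E} (hS : MeasurableSet S) (σ : ℝ) :
    interaction μ σ S Sᶜ = ∫⁻ h, farKernel σ h * shiftLoss μ S h ∂μ := by
  rw [lintegral_mul_shiftLoss hS (measurable_farKernel σ), interaction]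
  refine lintegral_congr fun x => ?_
  rw [← lintegral_indicator hS.compl, ← lintegral_indicator ((measurable_const_add x) hS.compl),
    ← lintegral_add_left_eq_self _ x]
  refine lintegral_congr fun h => ?_
  simp only [indicator, sub_add_cancel_left, farKernel_neg, mem_preimage]
  rfl

lemma mul_le_lintegral_shiftLoss {S A : Set E} (hS : MeasurableSet S) (hA : MeasurableSet A) :
    μ S * (μ A - μ S) ≤ ∫⁻ h in A, shiftLoss μ S h ∂μ := by
  have hindicator : ∫⁻ h in A, shiftLoss μ S h ∂μ = ∫⁻ h, A.indicator 1 h * shiftLoss μ S h ∂μ := by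
    rw [← lintegral_indicator hA]
    refine lintegral_congr fun h => ?_
    by_cases hh : h ∈ A <;> simp [hh]
  rw [hindicator, lintegral_mul_shiftLoss hS (measurable_one.indicator hA), mul_comm,
    ← setLIntegral_const]
  refine lintegral_mono fun x => ?_
  rw [lintegral_indicator_one hA, Measure.restrict_apply hA, ← measure_preimage_add μ x S]
  exact le_measure_sdiff

lemma lintegral_dyadicShell_shiftLoss_le (S : Set E) (i j : ℕ) :
    ∫⁻ h in dyadicShell E (i + j), shiftLoss μ S h ∂μ ≤
      ENNReal.ofReal ((2 ^ i) ^ (finrank ℝ E + 1)) *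
        ∫⁻ h in dyadicShell E j, shiftLoss μ S h ∂μ := by
  have h2 : (0 : ℝ) < 2 ^ i := by positivity
  rw [← smul_dyadicShell, setLIntegral_smul_set _ h2, pow_succ, ENNReal.ofReal_mul (by positivity),
    mul_assoc]
  refine mul_le_mul' le_rfl ?_
  rw [← lintegral_const_mul' _ _ ENNReal.ofReal_ne_top]
  refine lintegral_mono fun h => ?_
  rw [ENNReal.ofReal_pow zero_le_two, ENNReal.ofReal_ofNat]
  exact shiftLoss_two_pow_smul_le S i h

lemma two_pow_rpow_neg_mul_eq (d : ℕ) (σ : ℝ) (i j : ℕ) :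
    ((2 : ℝ) ^ (j + 1)) ^ (-(d + σ)) =
      2 ^ (-(d + σ)) * ((2 ^ (i + j)) ^ (d + 1))⁻¹ * ((2 : ℝ) ^ (1 - σ)) ^ j *
        (2 ^ i) ^ (d + 1) := by
  rw [← Real.rpow_natCast, ← Real.rpow_mul zero_le_two, ← pow_mul, ← pow_mul]
  simp_rw [← Real.rpow_natCast]
  rw [← Real.rpow_neg zero_le_two, ← Real.rpow_mul zero_le_two]
  simp_rw [← Real.rpow_add (two_pos (α := ℝ))]
  congr 1
  push_cast
  ring

lemma le_lintegral_dyadicShell_farKernel_mul_shiftLoss {σ : ℝ} (hσ : 0 ≤ σ) (S : Set E) (i j : ℕ) :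
    ENNReal.ofReal (2 ^ (-(finrank ℝ E + σ)) * ((2 ^ (i + j)) ^ (finrank ℝ E + 1))⁻¹ *
        ((2 : ℝ) ^ (1 - σ)) ^ j) * ∫⁻ h in dyadicShell E (i + j), shiftLoss μ S h ∂μ ≤
      ∫⁻ h in dyadicShell E j, farKernel σ h * shiftLoss μ S h ∂μ := by
  refine (mul_le_mul_right (lintegral_dyadicShell_shiftLoss_le S i j) _).trans ?_
  rw [← mul_assoc, ← ENNReal.ofReal_mul (by positivity), ← two_pow_rpow_neg_mul_eq,
    ← lintegral_const_mul' _ _ ENNReal.ofReal_ne_top]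
  refine setLIntegral_mono' (measurableSet_dyadicShell j) fun h hh => ?_
  gcongr
  exact ofReal_rpow_le_farKernel hσ hh

lemma le_interaction_compl {σ : ℝ} (hσ : 0 ≤ σ) {S : Set E} (hS : MeasurableSet S) (N : ℕ) :
    ENNReal.ofReal (2 ^ (-(finrank ℝ E + σ)) * ((2 ^ N) ^ (finrank ℝ E + 1))⁻¹ * dyadicSum σ N) *
      ∫⁻ h in dyadicShell E N, shiftLoss μ S h ∂μ ≤ interaction μ σ S Sᶜ := by
  rw [dyadicSum, Finset.mul_sum, ENNReal.ofReal_sum_of_nonneg fun _ _ => by positivity,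
    Finset.sum_mul, interaction_compl_eq hS]
  calc _ ≤ ∑ j ∈ Finset.range (N + 1),
          ∫⁻ h in dyadicShell E j, farKernel σ h * shiftLoss μ S h ∂μ := by
        refine Finset.sum_le_sum fun j hj => ?_
        obtain ⟨i, rfl⟩ := Nat.exists_eq_add_of_le' (Finset.mem_range_succ_iff.1 hj)
        exact le_lintegral_dyadicShell_farKernel_mul_shiftLoss hσ S i j
    _ = ∫⁻ h in ⋃ j ∈ Finset.range (N + 1), dyadicShell E j, farKernel σ h * shiftLoss μ S h ∂μ :=
        (lintegral_biUnion_finset (fun _ _ _ _ hij => disjoint_dyadicShell hij)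
          (fun j _ => measurableSet_dyadicShell j) _).symm
    _ ≤ _ := setLIntegral_le_lintegral _ _

lemma measureReal_dyadicShell (N : ℕ) :
    μ.real (dyadicShell E N) = (2 ^ N) ^ finrank ℝ E * μ.real (dyadicShell E 0) := by
  rw [show dyadicShell E N = (2 : ℝ) ^ N • dyadicShell E 0 by rw [smul_dyadicShell, add_zero],
    measureReal_def, Measure.addHaar_smul_of_nonneg _
    (by positivity), ENNReal.toReal_mul, ENNReal.toReal_ofReal (by positivity), measureReal_def]

lemma le_lintegral_dyadicShell_shiftLoss {S : Set E} (hS : MeasurableSet S) (hSfin : μ S ≠ ∞)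
    {N : ℕ} (hSN : μ.real S ≤ μ.real (dyadicShell E 0) / 2 * (2 ^ N) ^ finrank ℝ E) :
    ENNReal.ofReal (μ.real S * (μ.real (dyadicShell E 0) / 2 * (2 ^ N) ^ finrank ℝ E)) ≤
      ∫⁻ h in dyadicShell E N, shiftLoss μ S h ∂μ := by
  refine le_trans ?_ (mul_le_lintegral_shiftLoss hS (measurableSet_dyadicShell N))
  rw [← ofReal_measureReal hSfin, ← ofReal_measureReal (measure_dyadicShell_ne_top N),
    ← ENNReal.ofReal_sub _ measureReal_nonneg, ← ENNReal.ofReal_mul measureReal_nonneg,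
    measureReal_dyadicShell N]
  exact ENNReal.ofReal_le_ofReal (mul_le_mul_of_nonneg_left (by linarith) measureReal_nonneg)

variable (μ) in
lemma exists_isoperimetric [Nontrivial E] {σ : ℝ} (hσ : 0 ≤ σ) :
    ∃ b c : ℝ, 0 < b ∧ 0 < c ∧ ∀ S : Set E, MeasurableSet S → μ S ≠ ∞ →
      ∀ (N : ℕ) (v : ℝ), 0 ≤ v → v ≤ b * (2 ^ N) ^ finrank ℝ E → v ≤ μ.real S →
        ENNReal.ofReal (c * (v / 2 ^ N) * dyadicSum σ N) ≤ interaction μ σ S Sᶜ := by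
  set d := finrank ℝ E
  have ha : 0 < μ.real (dyadicShell E 0) := measureReal_dyadicShell_zero_pos
  set b := μ.real (dyadicShell E 0) / 2
  refine ⟨b, b * 2 ^ (-(d + σ)) * (2 ^ d)⁻¹, by positivity, by positivity,
    fun S hS hSfin N v hv hvN hvS => ?_⟩
  obtain ⟨N', hN, hSN, hratio⟩ :=
    exists_dyadic_scale finrank_pos.ne' (by positivity : 0 < b) hv hvS hvN
  have hsum : 0 ≤ dyadicSum σ N := zero_le_one.trans (one_le_dyadicSum σ N)
  calc ENNReal.ofReal (b * 2 ^ (-(d + σ)) * (2 ^ d)⁻¹ * (v / 2 ^ N) * dyadicSum σ N)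
      = ENNReal.ofReal (b * 2 ^ (-(d + σ)) * ((2 ^ d)⁻¹ * (v / 2 ^ N)) * dyadicSum σ N) := by
        ring_nf
    _ ≤ ENNReal.ofReal (b * 2 ^ (-(d + σ)) * (μ.real S / 2 ^ N') * dyadicSum σ N') := by
        gcongr
        exact monotone_dyadicSum σ hN
    _ = ENNReal.ofReal (2 ^ (-(d + σ)) * ((2 ^ N') ^ (d + 1))⁻¹ * dyadicSum σ N') *
          ENNReal.ofReal (μ.real S * (b * (2 ^ N') ^ d)) := by
        rw [← ENNReal.ofReal_mul (by have := one_le_dyadicSum σ N'; positivity), pow_succ]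
        congr 1
        field_simp
    _ ≤ ENNReal.ofReal (2 ^ (-(d + σ)) * ((2 ^ N') ^ (d + 1))⁻¹ * dyadicSum σ N') *
          ∫⁻ h in dyadicShell E N', shiftLoss μ S h ∂μ := by
        gcongr
        exact le_lintegral_dyadicShell_shiftLoss hS hSfin hSN
    _ ≤ interaction μ σ S Sᶜ := le_interaction_compl hσ hS N'

end Isoperimetric

/-! ### Comparison of the kinetic energies -/

section Truncation

variable {p : ℝ} (a b a' b' : ℝ)

lemma spow_sub_mul_posPart_sub_le {r : ℝ} (hr : 0 < r) :
    spow r (b - b') * ((a - b)⁺ - (a' - b')⁺) ≤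
      spow r (min a b - min a' b') * ((a - b)⁺ - (a' - b')⁺) := by
  have hmono := (strictMono_spow hr).monotone
  rcases le_total a b with h | h <;> rcases le_total a' b' with h' | h'
  · simp [posPart_eq_zero.2 (sub_nonpos.2 h), posPart_eq_zero.2 (sub_nonpos.2 h')]
  · rw [posPart_eq_zero.2 (sub_nonpos.2 h), min_eq_left h, min_eq_right h']
    exact mul_le_mul_of_nonpos_right (hmono (by linarith)) (by linarith [posPart_nonneg (a' - b')])
  · rw [posPart_eq_zero.2 (sub_nonpos.2 h'), min_eq_right h, min_eq_left h']
    exact mul_le_mul_of_nonneg_right (hmono (by linarith)) (by linarith [posPart_nonneg (a - b)])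
  · rw [min_eq_right h, min_eq_right h']

variable {a b a' b'}

lemma abs_min_sub_min_rpow_add_le {c β M : ℝ} (hp : 1 < p)
    (hgap : ∀ x y : ℝ, |x| ≤ 2 * M → |y| ≤ 2 * M → β ≤ |x - y| →
      |y| ^ p + p * spow (p - 1) y * (x - y) + c ≤ |x| ^ p)
    (ha : |a| ≤ M) (hb : |b| ≤ M) (ha' : |a'| ≤ M) (hb' : |b'| ≤ M) :
    |min a b - min a' b'| ^ p +
        p * (spow (p - 1) (b - b') * ((a - b)⁺ - (a' - b')⁺)) +
        {t | β ≤ |t|}.indicator (fun _ => c) ((a - b)⁺ - (a' - b')⁺) ≤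
      |a - a'| ^ p := by
  have hdiff : (a - a') - (min a b - min a' b') = (a - b)⁺ - (a' - b')⁺ := by
    rw [inf_eq_sub_posPart_sub a, inf_eq_sub_posPart_sub a']; ring
  have htangent := mul_le_mul_of_nonneg_left
    (spow_sub_mul_posPart_sub_le a b a' b' (sub_pos.2 hp)) (zero_le_one.trans hp.le)
  rw [← hdiff] at htangent ⊢
  by_cases hβ : (a - a') - (min a b - min a' b') ∈ {t : ℝ | β ≤ |t|}
  · have hmin : |min a b| ≤ M := abs_min_le_max_abs_abs.trans (max_le ha hb)
    have hmin' : |min a' b'| ≤ M := abs_min_le_max_abs_abs.trans (max_le ha' hb')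
    rw [indicator_of_mem hβ]
    linarith [hgap (a - a') (min a b - min a' b') ((abs_sub _ _).trans (by linarith))
      ((abs_sub _ _).trans (by linarith)) hβ]
  · rw [indicator_of_notMem hβ]
    linarith [abs_rpow_tangent_le hp (a - a') (min a b - min a' b')]

end Truncation

section PairMeasure

variable {α : Type*} [MeasurableSpace α] {μ : Measure α} {Ω : Set α}

variable (μ Ω) in
/-- The measure on pairs of points which underlies the kinetic energy in `Ω`: pairs of points of `Ω`
count half, and pairs with only the first point in `Ω` count fully. -/
def pairMeasure : Measure (α × α) :=
  (1 / 2 : ℝ≥0∞) • (μ.prod μ).restrict (Ω ×ˢ Ω) + (μ.prod μ).restrict (Ω ×ˢ Ωᶜ)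

lemma lintegral_pairMeasure (F : α × α → ℝ≥0∞) :
    ∫⁻ z, F z ∂pairMeasure μ Ω =
      1 / 2 * ∫⁻ z in Ω ×ˢ Ω, F z ∂μ.prod μ + ∫⁻ z in Ω ×ˢ Ωᶜ, F z ∂μ.prod μ := by
  rw [pairMeasure, lintegral_add_measure, lintegral_smul_measure, smul_eq_mul]

lemma pairMeasure_le (hΩ : MeasurableSet Ω) : pairMeasure μ Ω ≤ μ.prod μ := by
  have hdisj : Disjoint (Ω ×ˢ Ω) (Ω ×ˢ Ωᶜ) := disjoint_prod.2 (.inr disjoint_compl_right)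
  calc pairMeasure μ Ω
      ≤ (1 : ℝ≥0∞) • (μ.prod μ).restrict (Ω ×ˢ Ω) + (μ.prod μ).restrict (Ω ×ˢ Ωᶜ) := by
        rw [pairMeasure]
        gcongr
        simp
    _ = (μ.prod μ).restrict (Ω ×ˢ Ω ∪ Ω ×ˢ Ωᶜ) := by
        rw [one_smul, Measure.restrict_union hdisj (hΩ.prod hΩ.compl)]
    _ ≤ μ.prod μ := Measure.restrict_le_self

variable [SFinite μ]

lemma setLIntegral_prod_swap (A B : Set α) {F : α × α → ℝ≥0∞} :
    ∫⁻ z in A ×ˢ B, F z.swap ∂μ.prod μ = ∫⁻ z in B ×ˢ A, F z ∂μ.prod μ := by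
  rw [← Measure.prod_restrict, ← Measure.prod_restrict, lintegral_prod_swap]

lemma setLIntegral_prod_le_lintegral_pairMeasure {S T : Set α} {F : α × α → ℝ≥0∞}
    (hF : ∀ z, F z.swap = F z) (hS : MeasurableSet S) (hT : MeasurableSet T)
    (hΩ : MeasurableSet Ω) (hST : Disjoint S T) (hSΩ : S ⊆ Ω) :
    ∫⁻ z in S ×ˢ T, F z ∂μ.prod μ ≤ ∫⁻ z, F z ∂pairMeasure μ Ω := by
  have hdisj : Disjoint (S ×ˢ (T ∩ Ω)) ((T ∩ Ω) ×ˢ S) :=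
    disjoint_prod.2 (.inl (hST.mono_right inter_subset_left))
  have hinner : 2 * ∫⁻ z in S ×ˢ (T ∩ Ω), F z ∂μ.prod μ ≤ ∫⁻ z in Ω ×ˢ Ω, F z ∂μ.prod μ := by
    rw [two_mul]
    nth_rw 2 [← setLIntegral_prod_swap]
    simp only [hF]
    rw [← lintegral_union ((hT.inter hΩ).prod hS) hdisj]
    exact lintegral_mono_set (union_subset (prod_mono hSΩ inter_subset_right)
      (prod_mono inter_subset_right hSΩ))
  have hcover : S ×ˢ T ⊆ S ×ˢ (T ∩ Ω) ∪ Ω ×ˢ Ωᶜ := by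
    rintro z ⟨hz₁, hz₂⟩
    by_cases hz : z.2 ∈ Ω
    · exact .inl ⟨hz₁, hz₂, hz⟩
    · exact .inr ⟨hSΩ hz₁, hz⟩
  calc ∫⁻ z in S ×ˢ T, F z ∂μ.prod μ
      ≤ ∫⁻ z in S ×ˢ (T ∩ Ω), F z ∂μ.prod μ + ∫⁻ z in Ω ×ˢ Ωᶜ, F z ∂μ.prod μ :=
        (lintegral_mono_set hcover).trans (lintegral_union_le _ _ _)
    _ ≤ ∫⁻ z, F z ∂pairMeasure μ Ω := by
        rw [lintegral_pairMeasure]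
        gcongr
        rw [one_div, mul_comm, ← div_eq_mul_inv, ENNReal.le_div_iff_mul_le (by simp) (by simp),
          mul_comm]
        exact hinner

lemma integral_add_swap_pairMeasure {Y : α × α → ℝ} (hY : Integrable Y (μ.prod μ))
    (hΩ : MeasurableSet Ω) (hYΩ : ∀ z : α × α, z.2 ∉ Ω → Y z = 0) :
    ∫ z, (Y z + Y z.swap) ∂pairMeasure μ Ω = ∫ z, Y z ∂μ.prod μ := by
  have hYs : Integrable (fun z => Y z.swap) (μ.prod μ) := hY.swap
  have hZ : Integrable (fun z => Y z + Y z.swap) (μ.prod μ) := hY.add hYs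
  have hinner : ∫ z in Ω ×ˢ Ω, Y z.swap ∂μ.prod μ = ∫ z in Ω ×ˢ Ω, Y z ∂μ.prod μ := by
    rw [← Measure.prod_restrict, integral_prod_swap]
  have houter : ∫ z in Ω ×ˢ Ωᶜ, (Y z + Y z.swap) ∂μ.prod μ =
      ∫ z in Ωᶜ ×ˢ Ω, Y z ∂μ.prod μ := by
    rw [setIntegral_congr_fun (hΩ.prod hΩ.compl)
      (fun z hz => by rw [hYΩ z hz.2, zero_add] : EqOn _ (fun z => Y z.swap) _),
      ← Measure.prod_restrict, ← Measure.prod_restrict, integral_prod_swap]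
  have hdisj : Disjoint (Ω ×ˢ Ω) (Ωᶜ ×ˢ Ω) := disjoint_prod.2 (.inl disjoint_compl_right)
  calc ∫ z, (Y z + Y z.swap) ∂pairMeasure μ Ω
      = (1 / 2 : ℝ) * ∫ z in Ω ×ˢ Ω, (Y z + Y z.swap) ∂μ.prod μ +
          ∫ z in Ω ×ˢ Ωᶜ, (Y z + Y z.swap) ∂μ.prod μ := by
        rw [pairMeasure, integral_add_measure (hZ.integrableOn.smul_measure (by simp))
          hZ.integrableOn, integral_smul_measure]
        simp
    _ = ∫ z in Ω ×ˢ Ω, Y z ∂μ.prod μ + ∫ z in Ωᶜ ×ˢ Ω, Y z ∂μ.prod μ := by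
        rw [integral_add hY.integrableOn hYs.integrableOn, hinner, houter]
        ring
    _ = ∫ z in univ ×ˢ Ω, Y z ∂μ.prod μ := by
        rw [← setIntegral_union hdisj (hΩ.compl.prod hΩ) hY.integrableOn hY.integrableOn,
          ← union_prod, union_compl_self]
    _ = ∫ z, Y z ∂μ.prod μ :=
        setIntegral_eq_integral_of_forall_compl_eq_zero fun z hz => hYΩ z fun h => hz ⟨trivial, h⟩

end PairMeasure

lemma lintegral_ofReal_add_le {α : Type*} [MeasurableSpace α] {ν : Measure α} {f g : α → ℝ}
    (hf : AEMeasurable f ν) (hf0 : ∀ x, 0 ≤ f x) (hg : Integrable g ν)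
    (hfg : ∀ x, 0 ≤ f x + g x) :
    ∫⁻ x, ENNReal.ofReal (f x + g x) ∂ν ≤
      ∫⁻ x, ENNReal.ofReal (f x) ∂ν + ENNReal.ofReal (∫ x, g x ∂ν) := by
  rcases eq_or_ne (∫⁻ x, ENNReal.ofReal (f x) ∂ν) ∞ with htop | htop
  · simp [htop]
  have hfi : Integrable f ν := ⟨hf.aestronglyMeasurable, by
    rwa [hasFiniteIntegral_iff_ofReal (.of_forall hf0), lt_top_iff_ne_top]⟩
  have hfgi : Integrable (fun x => f x + g x) ν := hfi.add hg
  rw [← ofReal_integral_eq_lintegral_ofReal hfgi (.of_forall hfg), integral_add hfi hg,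
    ← ofReal_integral_eq_lintegral_ofReal hfi (.of_forall hf0)]
  exact ENNReal.ofReal_add_le

lemma ofReal_integral_le_lintegral_ofReal {α : Type*} [MeasurableSpace α] {ν : Measure α}
    (f : α → ℝ) : ENNReal.ofReal (∫ x, f x ∂ν) ≤ ∫⁻ x, ENNReal.ofReal (f x) ∂ν := by
  rcases eq_or_ne (∫⁻ x, ENNReal.ofReal (f x) ∂ν) ∞ with htop | htop
  · simp [htop]
  refine ENNReal.ofReal_le_of_le_toReal
    (integral_le_of_lintegral_ofReal_le ENNReal.toReal_nonneg ?_)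
  rw [ENNReal.ofReal_toReal htop]

section Convolution

variable {E : Type*} [AddCommGroup E] [MeasurableSpace E] [MeasurableAdd₂ E] [MeasurableNeg E]
  {μ : Measure E} [SFinite μ] [μ.IsAddLeftInvariant] {g k : E → ℝ} {φ : E × E → ℝ} {M : ℝ}

lemma integrable_mul_mul_sub (hg : Integrable g μ) (hk : Integrable k μ) (hφ : Measurable φ)
    (hφM : ∀ z, |φ z| ≤ M) :
    Integrable (fun z : E × E => g z.2 * (φ z * k (z.1 - z.2))) (μ.prod μ) := by
  have hconv : Integrable (fun z : E × E => g z.2 * k (z.1 - z.2)) (μ.prod μ) :=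
    hg.convolution_integrand (ContinuousLinearMap.mul ℝ ℝ) hk
  exact (hconv.bdd_mul hφ.aestronglyMeasurable (.of_forall hφM)).congr
    (.of_forall fun z => mul_left_comm _ _ _)

lemma integral_mul_mul_sub (hg : Integrable g μ) (hk : Integrable k μ) (hφ : Measurable φ)
    (hφM : ∀ z, |φ z| ≤ M) :
    ∫ z, g z.2 * (φ z * k (z.1 - z.2)) ∂μ.prod μ = ∫ y, g y * ∫ h, φ (y + h, y) * k h ∂μ ∂μ := by
  rw [integral_prod_symm _ (integrable_mul_mul_sub hg hk hφ hφM)]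
  refine integral_congr_ae (.of_forall fun y => ?_)
  simp only [integral_const_mul]
  rw [← integral_add_left_eq_self _ y]
  simp only [add_sub_cancel_left]

end Convolution

section Comparison

variable {E : Type*} [AddCommGroup E] {p c β M : ℝ} {u w k : E → ℝ}

/-- Half of the integrand of the first variation at `w`, in the direction `(u - w)⁺`, of the energy
with interaction kernel `k`. The other half is its transpose; both carry the opposite sign. -/
def firstVariation (p : ℝ) (u w k : E → ℝ) (z : E × E) : ℝ :=
  p * (u z.2 - w z.2)⁺ * (spow (p - 1) (w z.1 - w z.2) * k (z.1 - z.2))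

lemma firstVariation_add_swap (hkneg : ∀ h, k (-h) = k h) (z : E × E) :
    firstVariation p u w k z + firstVariation p u w k z.swap =
      -(p * (spow (p - 1) (w z.1 - w z.2) * ((u z.1 - w z.1)⁺ - (u z.2 - w z.2)⁺))) *
        k (z.1 - z.2) := by
  have hspow : spow (p - 1) (w z.2 - w z.1) = -spow (p - 1) (w z.1 - w z.2) := by
    rw [← spow_neg, neg_sub]
  have hk : k (z.2 - z.1) = k (z.1 - z.2) := by rw [← hkneg, neg_sub]
  simp only [firstVariation, Prod.fst_swap, Prod.snd_swap, hspow, hk]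
  ring

lemma min_sub_rpow_mul_add_le_firstVariation (hp : 1 < p)
    (hgap : ∀ x y : ℝ, |x| ≤ 2 * M → |y| ≤ 2 * M → β ≤ |x - y| →
      |y| ^ p + p * spow (p - 1) y * (x - y) + c ≤ |x| ^ p)
    (huM : ∀ x, |u x| ≤ M) (hwM : ∀ x, |w x| ≤ M) (hk0 : ∀ h, 0 ≤ k h)
    (hkneg : ∀ h, k (-h) = k h) (z : E × E) :
    |min (u z.1) (w z.1) - min (u z.2) (w z.2)| ^ p * k (z.1 - z.2) +
        {z : E × E | β ≤ |(u z.1 - w z.1)⁺ - (u z.2 - w z.2)⁺|}.indicator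
          (fun z => c * k (z.1 - z.2)) z ≤
      |u z.1 - u z.2| ^ p * k (z.1 - z.2) +
        (firstVariation p u w k z + firstVariation p u w k z.swap) := by
  have hreal := mul_le_mul_of_nonneg_right
    (abs_min_sub_min_rpow_add_le hp hgap (huM z.1) (hwM z.1) (huM z.2) (hwM z.2)) (hk0 (z.1 - z.2))
  rw [firstVariation_add_swap hkneg]
  simp only [indicator_apply, mem_ofPred_eq] at hreal ⊢
  split_ifs at hreal ⊢ <;> linarith

variable [MeasurableSpace E] [MeasurableAdd₂ E] [MeasurableNeg E] {μ : Measure E} [SFinite μ]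
  [μ.IsAddLeftInvariant] {Ω : Set E}

lemma integrable_firstVariation (hu : Measurable u) (hw : Measurable w)
    (huM : ∀ x, |u x| ≤ M) (hwM : ∀ x, |w x| ≤ M) (hp : 1 < p) (hk : Integrable k μ)
    (hΩfin : μ Ω ≠ ∞) (huw : ∀ x ∉ Ω, u x ≤ w x) :
    Integrable (firstVariation p u w k) (μ.prod μ) ∧
      ∫ z, firstVariation p u w k z ∂μ.prod μ = ∫ x, p * (u x - w x)⁺ *
        ∫ h, spow (p - 1) (w (x + h) - w x) * k h ∂μ ∂μ := by
  have hg : Integrable (fun x => p * (u x - w x)⁺) μ := by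
    have hbound (x : E) : ‖p * (u x - w x)⁺‖ ≤ p * (2 * M) := by
      rw [Real.norm_of_nonneg (by positivity)]
      gcongr
      exact max_le (by linarith [le_abs_self (u x), neg_abs_le (w x), huM x, hwM x])
        (by linarith [abs_nonneg (u x), huM x])
    refine IntegrableOn.integrable_of_forall_notMem_eq_zero (s := Ω)
      (Measure.integrableOn_of_bounded hΩfin
        (((hu.sub hw).max measurable_const).const_mul p).aestronglyMeasurable
        (.of_forall hbound)) fun x hx => ?_
    simp [posPart_eq_zero.2 (sub_nonpos.2 (huw x hx))]
  have hφ : Measurable fun z : E × E => spow (p - 1) (w z.1 - w z.2) :=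
    (continuous_spow (sub_pos.2 hp)).measurable.comp
      ((hw.comp measurable_fst).sub (hw.comp measurable_snd))
  have hφM (z : E × E) : |spow (p - 1) (w z.1 - w z.2)| ≤ (2 * M) ^ (p - 1) := by
    rw [abs_spow (sub_pos.2 hp)]
    exact Real.rpow_le_rpow (abs_nonneg _)
      ((abs_sub _ _).trans (by linarith [hwM z.1, hwM z.2])) (sub_pos.2 hp).le
  exact ⟨integrable_mul_mul_sub hg hk hφ hφM, integral_mul_mul_sub hg hk hφ hφM⟩

/-- The competitor `min u w` is compared with `u` by convexity of `|·| ^ p`; strict convexity gains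
a fixed multiple of the kernel wherever `(u - w)⁺` jumps by at least `β`. -/
lemma lintegral_min_sub_rpow_add_le (hp : 1 < p) (hc : 0 ≤ c)
    (hgap : ∀ x y : ℝ, |x| ≤ 2 * M → |y| ≤ 2 * M → β ≤ |x - y| →
      |y| ^ p + p * spow (p - 1) y * (x - y) + c ≤ |x| ^ p)
    (hu : Measurable u) (hw : Measurable w) (huM : ∀ x, |u x| ≤ M) (hwM : ∀ x, |w x| ≤ M)
    (hkm : Measurable k) (hk : Integrable k μ) (hk0 : ∀ h, 0 ≤ k h) (hkneg : ∀ h, k (-h) = k h)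
    (hΩ : MeasurableSet Ω) (hΩfin : μ Ω ≠ ∞) (huw : ∀ x ∉ Ω, u x ≤ w x) :
    ∫⁻ z, ENNReal.ofReal (|min (u z.1) (w z.1) - min (u z.2) (w z.2)| ^ p * k (z.1 - z.2))
          ∂pairMeasure μ Ω +
        ENNReal.ofReal c * ∫⁻ z in {z : E × E | β ≤ |(u z.1 - w z.1)⁺ - (u z.2 - w z.2)⁺|},
          ENNReal.ofReal (k (z.1 - z.2)) ∂pairMeasure μ Ω ≤
      ∫⁻ z, ENNReal.ofReal (|u z.1 - u z.2| ^ p * k (z.1 - z.2)) ∂pairMeasure μ Ω +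
        ∫⁻ x, ENNReal.ofReal (p * (u x - w x)⁺ *
          ∫ h, spow (p - 1) (w (x + h) - w x) * k h ∂μ) ∂μ := by
  set D := {z : E × E | β ≤ |(u z.1 - w z.1)⁺ - (u z.2 - w z.2)⁺|}
  set Y := firstVariation p u w k
  have hη : Measurable fun x => (u x - w x)⁺ := (hu.sub hw).max measurable_const
  have hD : MeasurableSet D := measurableSet_le measurable_const
    ((hη.comp measurable_fst).sub (hη.comp measurable_snd)).norm
  have hksub : Measurable fun z : E × E => k (z.1 - z.2) :=
    hkm.comp (measurable_fst.sub measurable_snd)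
  have hpoint := min_sub_rpow_mul_add_le_firstVariation hp hgap huM hwM hk0 hkneg
  have hmin0 (z : E × E) :
      0 ≤ |min (u z.1) (w z.1) - min (u z.2) (w z.2)| ^ p * k (z.1 - z.2) :=
    mul_nonneg (by positivity) (hk0 _)
  have hjump0 (z : E × E) : 0 ≤ D.indicator (fun z => c * k (z.1 - z.2)) z :=
    indicator_nonneg (fun z _ => mul_nonneg hc (hk0 _)) z
  obtain ⟨hY, hYint⟩ := integrable_firstVariation hu hw huM hwM hp hk hΩfin huw
  have hYΩ (z : E × E) (hz : z.2 ∉ Ω) : Y z = 0 := by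
    simp [Y, firstVariation, posPart_eq_zero.2 (sub_nonpos.2 (huw _ hz))]
  have hYs : Integrable (fun z => Y z + Y z.swap) (pairMeasure μ Ω) :=
    Integrable.mono_measure (hY.add hY.swap) (pairMeasure_le hΩ)
  calc _ = ∫⁻ z, ENNReal.ofReal
          (|min (u z.1) (w z.1) - min (u z.2) (w z.2)| ^ p * k (z.1 - z.2) +
            D.indicator (fun z => c * k (z.1 - z.2)) z) ∂pairMeasure μ Ω := by
        simp only [ENNReal.ofReal_add (hmin0 _) (hjump0 _)]
        rw [lintegral_add_right _ (hksub.const_mul c |>.indicator hD).ennreal_ofReal,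
          ← lintegral_const_mul _ hksub.ennreal_ofReal, ← lintegral_indicator hD]
        congr 1
        refine lintegral_congr fun z => ?_
        simp only [indicator_apply, apply_ite ENNReal.ofReal, ENNReal.ofReal_mul hc,
          ENNReal.ofReal_zero]
    _ ≤ ∫⁻ z, ENNReal.ofReal (|u z.1 - u z.2| ^ p * k (z.1 - z.2) + (Y z + Y z.swap))
          ∂pairMeasure μ Ω := lintegral_mono fun z => ENNReal.ofReal_le_ofReal (hpoint z)
    _ ≤ ∫⁻ z, ENNReal.ofReal (|u z.1 - u z.2| ^ p * k (z.1 - z.2)) ∂pairMeasure μ Ω +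
          ENNReal.ofReal (∫ z, (Y z + Y z.swap) ∂pairMeasure μ Ω) := by
        refine lintegral_ofReal_add_le ?_ (fun z => mul_nonneg (by positivity) (hk0 _)) hYs
          fun z => (add_nonneg (hmin0 z) (hjump0 z)).trans (hpoint z)
        exact ((((hu.comp measurable_fst).sub (hu.comp measurable_snd)).norm.pow_const p).mul
          hksub).aemeasurable
    _ ≤ _ := by
        rw [integral_add_swap_pairMeasure hY hΩ hYΩ, hYint]
        gcongr
        exact ofReal_integral_le_lintegral_ofReal _

end Comparison

section TruncatedKernel

variable {E : Type*} [NormedAddCommGroup E] [NormedSpace ℝ E]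

/-- The kernel `kernel σ`, cut off at distance `ε` to make it integrable. -/
def truncKernel (σ ε : ℝ) : E → ℝ := (closedBall 0 ε)ᶜ.indicator (kernel σ)

variable {σ ε : ℝ}

lemma truncKernel_nonneg (h : E) : 0 ≤ truncKernel σ ε h :=
  indicator_nonneg (fun h _ => kernel_nonneg σ h) h

lemma truncKernel_le_kernel (h : E) : truncKernel σ ε h ≤ kernel σ h :=
  indicator_le_self' (fun h _ => kernel_nonneg σ h) h

lemma truncKernel_neg (h : E) : truncKernel σ ε (-h) = truncKernel σ ε h := by
  classical
  simp only [truncKernel, indicator_apply, mem_compl_iff, mem_closedBall_zero_iff, norm_neg,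
    kernel_neg]

lemma farKernel_le_ofReal_truncKernel (hε : ε < 1) (h : E) :
    farKernel σ h ≤ ENNReal.ofReal (truncKernel σ ε h) := by
  by_cases hh : h ∈ (ball (0 : E) 1)ᶜ
  · have hh' : h ∈ (closedBall (0 : E) ε)ᶜ := fun hε' => hh (closedBall_subset_ball hε hε')
    rw [farKernel, truncKernel, indicator_of_mem hh, indicator_of_mem hh']
  · rw [farKernel, indicator_of_notMem hh]
    exact zero_le

variable [MeasurableSpace E] [BorelSpace E] {μ : Measure E}

lemma measurable_truncKernel : Measurable (truncKernel σ ε : E → ℝ) :=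
  (measurable_kernel σ).indicator measurableSet_closedBall.compl

lemma integral_mul_truncKernel (φ : E → ℝ) :
    ∫ h, φ h * truncKernel σ ε h ∂μ = ∫ h in (closedBall 0 ε)ᶜ, φ h * kernel σ h ∂μ := by
  rw [← integral_indicator measurableSet_closedBall.compl]
  simp only [truncKernel, indicator_mul_right]

lemma lintegral_mul_truncKernel_sub [SecondCountableTopology E] (ν : Measure (E × E))
    (f : E × E → ℝ) :
    ∫⁻ z, ENNReal.ofReal (f z * truncKernel σ ε (z.1 - z.2)) ∂ν =
      ∫⁻ z in {z | ε < ‖z.1 - z.2‖}, ENNReal.ofReal (f z * kernel σ (z.1 - z.2)) ∂ν := by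
  have hmeas : MeasurableSet {z : E × E | ε < ‖z.1 - z.2‖} :=
    measurableSet_lt measurable_const (measurable_fst.sub measurable_snd).norm
  rw [← lintegral_indicator hmeas]
  refine lintegral_congr fun z => ?_
  by_cases hz : ε < ‖z.1 - z.2‖ <;> simp [truncKernel, indicator, hz]

variable [FiniteDimensional ℝ E]

lemma lintegral_mul_kernel_sub_eq_iSup (hσ : 0 < σ) (ν : Measure (E × E)) (f : E × E → ℝ) :
    ∫⁻ z, ENNReal.ofReal (f z * kernel σ (z.1 - z.2)) ∂ν =
      ⨆ k : ℕ, ∫⁻ z, ENNReal.ofReal (f z * truncKernel σ (1 / (k + 2)) (z.1 - z.2)) ∂ν := by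
  have hmono : Monotone fun k : ℕ => {z : E × E | 1 / ((k : ℝ) + 2) < ‖z.1 - z.2‖} :=
    fun k l hkl z hz => lt_of_le_of_lt (by gcongr) (show 1 / ((k : ℝ) + 2) < _ from hz)
  have hunion : ⋃ k : ℕ, {z : E × E | 1 / ((k : ℝ) + 2) < ‖z.1 - z.2‖} = {z | z.1 ≠ z.2} := by
    ext z
    simp only [mem_iUnion, mem_ofPred_eq, ← sub_ne_zero (a := z.1), ← norm_pos_iff]
    refine ⟨fun ⟨k, hk⟩ => lt_trans (by positivity) hk, fun hz => ?_⟩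
    obtain ⟨k, hk⟩ := exists_nat_one_div_lt hz
    exact ⟨k, lt_of_le_of_lt (by gcongr; norm_num) hk⟩
  have hdiag (z : E × E) (hz : z ∉ {z : E × E | z.1 ≠ z.2}) :
      ENNReal.ofReal (f z * kernel σ (z.1 - z.2)) = 0 := by
    have hexp : -((finrank ℝ E : ℝ) + σ) ≠ 0 :=
      neg_ne_zero.2 (by positivity)
    rw [sub_eq_zero.2 (not_not.1 hz), kernel, norm_zero, Real.zero_rpow hexp, mul_zero,
      ENNReal.ofReal_zero]
  simp_rw [lintegral_mul_truncKernel_sub]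
  rw [← setLIntegral_iUnion_of_directed _ hmono.directed_le, hunion,
    setLIntegral_eq_of_support_subset]
  exact fun z hz => by_contra fun h => hz (hdiag z h)

variable [μ.IsAddHaarMeasure]

lemma integrable_truncKernel (hσ : 0 < σ) (hε : 0 < ε) :
    Integrable (truncKernel σ ε : E → ℝ) μ := by
  rw [truncKernel, integrable_indicator_iff measurableSet_closedBall.compl]
  simpa using integrableOn_compl_closedBall_mul_kernel (μ := μ) hσ hε
    (measurable_const (a := (1 : ℝ))) (M := 1) (by simp)

end TruncatedKernel

section KernelComparison

variable {E : Type*} [NormedAddCommGroup E] [NormedSpace ℝ E] [FiniteDimensional ℝ E]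
  [MeasurableSpace E] [BorelSpace E] {μ : Measure E} [μ.IsAddHaarMeasure]

lemma interaction_le_setLIntegral_pairMeasure {σ a : ℝ} (ha : 0 < a) {η : E → ℝ}
    (hη : Measurable η) {Ω : Set E} (hΩ : MeasurableSet Ω) (hηΩ : ∀ x ∉ Ω, η x ≤ 0) :
    interaction μ σ {x | 2 * a ≤ η x} {x | η x ≤ a} ≤
      ∫⁻ z in {z : E × E | a ≤ |η z.1 - η z.2|}, farKernel σ (z.1 - z.2) ∂pairMeasure μ Ω := by
  set D := {z : E × E | a ≤ |η z.1 - η z.2|}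
  have hD : MeasurableSet D := measurableSet_le measurable_const
    ((hη.comp measurable_fst).sub (hη.comp measurable_snd)).norm
  have hS : MeasurableSet {x | 2 * a ≤ η x} := measurableSet_le measurable_const hη
  have hT : MeasurableSet {x | η x ≤ a} := measurableSet_le hη measurable_const
  have hfar : Measurable fun z : E × E => farKernel σ (z.1 - z.2) :=
    (measurable_farKernel σ).comp (measurable_fst.sub measurable_snd)
  have hST : {x | 2 * a ≤ η x} ×ˢ {x | η x ≤ a} ⊆ D := fun z ⟨(hz₁ : 2 * a ≤ _), (hz₂ : _ ≤ a)⟩ =>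
    (by linarith : a ≤ η z.1 - η z.2).trans (le_abs_self _)
  have hswap (z : E × E) : D.indicator (fun z => farKernel σ (z.1 - z.2)) z.swap =
      D.indicator (fun z => farKernel σ (z.1 - z.2)) z := by
    have hmem : z.swap ∈ D ↔ z ∈ D := by simp [D, abs_sub_comm]
    simp only [indicator_apply, hmem, Prod.fst_swap, Prod.snd_swap, ← farKernel_neg σ (z.1 - z.2),
      neg_sub]
  calc interaction μ σ {x | 2 * a ≤ η x} {x | η x ≤ a}
      = ∫⁻ z in {x | 2 * a ≤ η x} ×ˢ {x | η x ≤ a},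
          D.indicator (fun z => farKernel σ (z.1 - z.2)) z ∂μ.prod μ := by
        rw [setLIntegral_indicator hD, inter_eq_right.2 hST, ← Measure.prod_restrict,
          lintegral_prod _ hfar.aemeasurable, interaction]
    _ ≤ ∫⁻ z, D.indicator (fun z => farKernel σ (z.1 - z.2)) z ∂pairMeasure μ Ω :=
        setLIntegral_prod_le_lintegral_pairMeasure hswap hS hT hΩ
          (disjoint_left.2 fun x (hx : 2 * a ≤ η x) (hx' : η x ≤ a) => by linarith)
          fun x (hx : 2 * a ≤ η x) => by_contra fun hxΩ => by linarith [hηΩ x hxΩ]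
    _ = _ := lintegral_indicator hD _

lemma lintegral_kernel_min_add_interaction_le {σ p c a M : ℝ} (hσ : 0 < σ)
    (hp : 1 < p) (hc : 0 ≤ c) (ha : 0 < a)
    (hgap : ∀ x y : ℝ, |x| ≤ 2 * M → |y| ≤ 2 * M → a ≤ |x - y| →
      |y| ^ p + p * spow (p - 1) y * (x - y) + c ≤ |x| ^ p)
    {Ω : Set E} (hΩ : MeasurableSet Ω) (hΩfin : μ Ω ≠ ∞) {u w B : E → ℝ}
    (hu : Measurable u) (hw : Measurable w) (huM : ∀ x, |u x| ≤ M) (hwM : ∀ x, |w x| ≤ M)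
    (huw : ∀ x ∉ Ω, u x ≤ w x)
    (hop : ∀ ε, 0 < ε → ∀ᵐ x ∂μ, w x < u x →
      ∫ h in (closedBall 0 ε)ᶜ, spow (p - 1) (w (x + h) - w x) * kernel σ h ∂μ ≤ B x) :
    ∫⁻ z, ENNReal.ofReal (|min (u z.1) (w z.1) - min (u z.2) (w z.2)| ^ p * kernel σ (z.1 - z.2))
          ∂pairMeasure μ Ω +
        ENNReal.ofReal c *
          interaction μ σ {x | 2 * a ≤ (u x - w x)⁺} {x | (u x - w x)⁺ ≤ a} ≤
      ∫⁻ z, ENNReal.ofReal (|u z.1 - u z.2| ^ p * kernel σ (z.1 - z.2)) ∂pairMeasure μ Ω +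
        ∫⁻ x, ENNReal.ofReal (p * (u x - w x)⁺ * B x) ∂μ := by
  rw [lintegral_mul_kernel_sub_eq_iSup hσ, ENNReal.iSup_add]
  refine iSup_le fun k => ?_
  set ε : ℝ := 1 / (k + 2) with hε_def
  have hε : 0 < ε := by positivity
  have hε1 : ε < 1 := by rw [hε_def, div_lt_one] <;> linarith [k.cast_nonneg (α := ℝ)]
  have hvariation : ∫⁻ x, ENNReal.ofReal (p * (u x - w x)⁺ *
      ∫ h, spow (p - 1) (w (x + h) - w x) * truncKernel σ ε h ∂μ) ∂μ ≤
      ∫⁻ x, ENNReal.ofReal (p * (u x - w x)⁺ * B x) ∂μ := by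
    refine lintegral_mono_ae ((hop ε hε).mono fun x hx => ENNReal.ofReal_le_ofReal ?_)
    rcases le_or_gt (u x) (w x) with hle | hlt
    · simp [posPart_eq_zero.2 (sub_nonpos.2 hle)]
    · rw [integral_mul_truncKernel]
      gcongr
      exact hx hlt
  have hinteraction := (interaction_le_setLIntegral_pairMeasure (μ := μ) (σ := σ) ha
    ((hu.sub hw).max measurable_const) hΩ
    fun x hx => (posPart_eq_zero.2 (sub_nonpos.2 (huw x hx))).le).trans
    (lintegral_mono fun z => farKernel_le_ofReal_truncKernel hε1 (z.1 - z.2))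
  calc _ ≤ _ := add_le_add le_rfl (mul_le_mul_right hinteraction _)
    _ ≤ _ := lintegral_min_sub_rpow_add_le hp hc hgap hu hw huM hwM measurable_truncKernel
      (integrable_truncKernel hσ hε) truncKernel_nonneg truncKernel_neg hΩ hΩfin huw
    _ ≤ _ := by
      gcongr
      exact truncKernel_le_kernel _

end KernelComparison

/-! ### The energy estimate -/

section Potential

variable {W : ℝ → ℝ} {m lam Lam θ q c₁ t r a : ℝ}

namespace IsDegeneratePotential

lemma nonneg (hW : IsDegeneratePotential W m lam Lam θ q c₁) (ht : |t| ≤ 1) : 0 ≤ W t := by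
  refine le_trans ?_ (hW.bounds t (abs_le.1 ht)).1
  have hind : 0 ≤ (Iic θ).indicator (fun _ => (1 : ℝ)) t :=
    indicator_nonneg (fun _ _ => zero_le_one) t
  have hlam := hW.lam_mem.1.le
  positivity

lemma le_two_mul_rpow (hW : IsDegeneratePotential W m lam Lam θ q c₁) (hm : 1 < m)
    (ht : |t| ≤ 1) : W t ≤ 2 * Lam * (1 + t) ^ (m - 1) := by
  obtain ⟨ht₁, ht₂⟩ := abs_le.1 ht
  have hLam : 1 ≤ Lam := hW.Lam_mem
  calc W t ≤ Lam * |1 + t| ^ m := (hW.bounds t ⟨ht₁, ht₂⟩).2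
    _ = Lam * ((1 + t) * (1 + t) ^ (m - 1)) := by
        rw [abs_of_nonneg (by linarith), mul_comm (1 + t),
          ← Real.rpow_add_one' (by linarith) (by linarith), sub_add_cancel]
    _ ≤ Lam * (2 * (1 + t) ^ (m - 1)) := by
        have : 0 ≤ (1 + t) ^ (m - 1) := Real.rpow_nonneg (by linarith) _
        gcongr
        linarith
    _ = 2 * Lam * (1 + t) ^ (m - 1) := by ring

lemma measurable_comp (hW : IsDegeneratePotential W m lam Lam θ q c₁) {α : Type*}
    [MeasurableSpace α] {u : α → ℝ} (hu : Measurable u) (hu₁ : ∀ x, |u x| ≤ 1) :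
    Measurable fun x => W (u x) :=
  (lowerSemicontinuous_restrict_iff.2 hW.lsc).measurable.comp
    (hu.subtype_mk (h := fun x => abs_le.1 (hu₁ x)))

lemma lintegral_comp_lt_top (hW : IsDegeneratePotential W m lam Lam θ q c₁) (hm : 1 < m)
    {α : Type*} [MeasurableSpace α] {ν : Measure α} [IsFiniteMeasure ν] {u : α → ℝ}
    (hu₁ : ∀ x, |u x| ≤ 1) : ∫⁻ x, ENNReal.ofReal (W (u x)) ∂ν < ∞ := by
  have hLam : 1 ≤ Lam := hW.Lam_mem
  have hbound : ∀ x, W (u x) ≤ 2 * Lam * 2 ^ (m - 1) := fun x => by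
    obtain ⟨hl, hr⟩ := abs_le.1 (hu₁ x)
    refine (hW.le_two_mul_rpow hm (hu₁ x)).trans ?_
    gcongr <;> linarith
  calc ∫⁻ x, ENNReal.ofReal (W (u x)) ∂ν
      ≤ ∫⁻ _, ENNReal.ofReal (2 * Lam * 2 ^ (m - 1)) ∂ν :=
        lintegral_mono fun x => ENNReal.ofReal_le_ofReal (hbound x)
    _ < ∞ := by
        rw [lintegral_const]
        exact ENNReal.mul_lt_top ENNReal.ofReal_lt_top (measure_lt_top _ _)

lemma add_add_le_of_le (hW : IsDegeneratePotential W m lam Lam θ q c₁) (ha : 0 ≤ a)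
    (hr : -1 < r) (hrt : r ≤ t) (ht : t ≤ -1 + q) :
    W r + c₁ * (t - r) * (1 + r) ^ (m - 1) +
      (Ioo a (2 * a)).indicator (fun _ => c₁ * a ^ ⌈m⌉₊) (t - r) ≤ W t := by
  have hc₁ := hW.c₁_pos.le
  have hgrowth := hW.growth r t hr.le hrt ht
  rw [abs_of_pos (by linarith)] at hgrowth
  have hind : (Ioo a (2 * a)).indicator (fun _ => c₁ * a ^ ⌈m⌉₊) (t - r) ≤
      c₁ * (t - r) ^ ⌈m⌉₊ := by
    refine indicator_apply_le' (fun h => ?_) fun _ => ?_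
    · have := h.1.le
      gcongr
    · have := sub_nonneg.2 hrt
      positivity
  linarith

lemma add_add_le_of_gt (hW : IsDegeneratePotential W m lam Lam θ q c₁) (hm : 1 < m)
    (ha : 0 < a) (haq : 4 * a ≤ q) (hr : -1 < r) (hrt : r ≤ t) (ht : -1 + q < t) (ht₁ : t ≤ 1) :
    W r + c₁ * (t - r) * (1 + r) ^ (m - 1) +
        (Ioo a (2 * a)).indicator (fun _ => c₁ * a ^ ⌈m⌉₊) (t - r) ≤
      W t + (2 * Lam + 2 * c₁ + c₁ * a ^ ⌈m⌉₊ / (2 * a) ^ (m - 1)) * (1 + r) ^ (m - 1) := by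
  have hc₁ := hW.c₁_pos
  have hpos : 0 < (1 + r) ^ (m - 1) := Real.rpow_pos_of_pos (by linarith) _
  have hWt := hW.nonneg (t := t) (abs_le.2 ⟨by linarith, ht₁⟩)
  have hWr := hW.le_two_mul_rpow (t := r) hm (abs_le.2 ⟨hr.le, by linarith⟩)
  have hlin : c₁ * (t - r) * (1 + r) ^ (m - 1) ≤ c₁ * 2 * (1 + r) ^ (m - 1) := by
    gcongr
    linarith
  have hind : (Ioo a (2 * a)).indicator (fun _ => c₁ * a ^ ⌈m⌉₊) (t - r) ≤
      c₁ * a ^ ⌈m⌉₊ / (2 * a) ^ (m - 1) * (1 + r) ^ (m - 1) := by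
    refine indicator_apply_le' (fun h => ?_) fun _ => by positivity
    have har : 2 * a ≤ 1 + r := by linarith [h.2]
    rw [div_mul_eq_mul_div, le_div_iff₀ (by positivity)]
    gcongr
  linarith

/-- If `t - r ∈ (a, 2a)` and `t > -1 + q ≥ -1 + 4a`, then `1 + r ≥ 2a` is bounded below, so the
term `(1 + r) ^ (m - 1)` pays for the absence of the growth condition beyond `-1 + q`. -/
lemma min_add_add_le (hW : IsDegeneratePotential W m lam Lam θ q c₁) (hm : 1 < m)
    (ha : 0 < a) (haq : 4 * a ≤ q) (ht : |t| ≤ 1) (hr : -1 < r) :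
    W (min t r) + c₁ * (t - r)⁺ * (1 + r) ^ (m - 1) +
        (Ioo a (2 * a)).indicator (fun _ => c₁ * a ^ ⌈m⌉₊) (t - r)⁺ ≤
      W t + (Ioi (max r (-1 + q))).indicator (fun _ =>
        (2 * Lam + 2 * c₁ + c₁ * a ^ ⌈m⌉₊ / (2 * a) ^ (m - 1)) * (1 + r) ^ (m - 1)) t := by
  rcases le_or_gt t r with htr | hrt
  · rw [min_eq_left htr, posPart_eq_zero.2 (sub_nonpos.2 htr),
      indicator_of_notMem (fun h => ha.not_gt h.1),
      indicator_of_notMem (notMem_Ioi.2 (htr.trans (le_max_left _ _)))]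
    simp
  rw [min_eq_right hrt.le, posPart_of_nonneg (sub_nonneg.2 hrt.le)]
  rcases le_or_gt t (-1 + q) with htq | htq
  · rw [indicator_of_notMem (notMem_Ioi.2 (htq.trans (le_max_right _ _))), add_zero]
    exact hW.add_add_le_of_le ha.le hr hrt.le htq
  · rw [indicator_of_mem (mem_Ioi.2 (max_lt hrt htq))]
    exact hW.add_add_le_of_gt hm ha haq hr hrt.le htq (abs_le.1 ht).2

lemma lintegral_min_add_add_le (hW : IsDegeneratePotential W m lam Lam θ q c₁) (hm : 1 < m)
    (ha : 0 < a) (haq : 4 * a ≤ q) {α : Type*} [MeasurableSpace α] {ν : Measure α} {u w : α → ℝ}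
    (hu : Measurable u) (hw : Measurable w) (hu₁ : ∀ x, |u x| ≤ 1)
    (hw₁ : ∀ x, w x ∈ Ioc (-1) 1) :
    ∫⁻ x, ENNReal.ofReal (W (min (u x) (w x))) ∂ν +
          ∫⁻ x, ENNReal.ofReal (c₁ * (u x - w x)⁺ * (1 + w x) ^ (m - 1)) ∂ν +
        ENNReal.ofReal (c₁ * a ^ ⌈m⌉₊) * ν {x | (u x - w x)⁺ ∈ Ioo a (2 * a)} ≤
      ∫⁻ x, ENNReal.ofReal (W (u x)) ∂ν +
        ENNReal.ofReal (2 * Lam + 2 * c₁ + c₁ * a ^ ⌈m⌉₊ / (2 * a) ^ (m - 1)) *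
          ∫⁻ x in {x | max (w x) (-1 + q) < u x}, ENNReal.ofReal ((1 + w x) ^ (m - 1)) ∂ν := by
  set C := 2 * Lam + 2 * c₁ + c₁ * a ^ ⌈m⌉₊ / (2 * a) ^ (m - 1)
  have hc₁ := hW.c₁_pos
  have hC : 0 ≤ C := by
    have : 1 ≤ Lam := hW.Lam_mem
    positivity
  have hmin₁ (x : α) : |min (u x) (w x)| ≤ 1 := by
    rcases min_choice (u x) (w x) with h | h <;> rw [h]
    exacts [hu₁ x, abs_le.2 ⟨(hw₁ x).1.le, (hw₁ x).2⟩]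
  have hpow (x : α) : 0 ≤ (1 + w x) ^ (m - 1) := Real.rpow_nonneg (by linarith [(hw₁ x).1]) _
  have hlin (x : α) : 0 ≤ c₁ * (u x - w x)⁺ * (1 + w x) ^ (m - 1) :=
    mul_nonneg (mul_nonneg hc₁.le (posPart_nonneg _)) (hpow x)
  have hη : Measurable fun x => (u x - w x)⁺ := (hu.sub hw).max measurable_const
  have hG : MeasurableSet {x | (u x - w x)⁺ ∈ Ioo a (2 * a)} := hη measurableSet_Ioo
  have hA : MeasurableSet {x | max (w x) (-1 + q) < u x} :=
    measurableSet_lt (hw.max measurable_const) hu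
  have hD : Measurable fun x => ENNReal.ofReal ((1 + w x) ^ (m - 1)) :=
    ((measurable_const.add hw).pow_const _).ennreal_ofReal
  rw [← lintegral_const_mul _ hD, ← lintegral_indicator hA, ← lintegral_indicator_const hG,
    ← lintegral_add_left (hW.measurable_comp (hu.min hw) hmin₁).ennreal_ofReal,
    ← lintegral_add_right _ (measurable_const.indicator hG),
    ← lintegral_add_left (hW.measurable_comp hu hu₁).ennreal_ofReal]
  refine lintegral_mono fun x => ?_
  have hpt := ENNReal.ofReal_le_ofReal (hW.min_add_add_le hm ha haq (hu₁ x) (hw₁ x).1)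
  rw [ENNReal.ofReal_add (add_nonneg (hW.nonneg (hmin₁ x)) (hlin x))
    (indicator_nonneg (fun _ _ => by positivity) _), ENNReal.ofReal_add (hW.nonneg (hmin₁ x))
    (hlin x), ENNReal.ofReal_add (hW.nonneg (hu₁ x))
    (indicator_nonneg (fun _ _ => mul_nonneg hC (hpow x)) _)] at hpt
  classical
  simpa only [indicator_apply, mem_Ioi, mem_ofPred_eq, apply_ite ENNReal.ofReal,
    ENNReal.ofReal_zero, ENNReal.ofReal_mul hC] using hpt

end IsDegeneratePotential

end Potential

section FarKernel

variable {E : Type*} [NormedAddCommGroup E] [NormedSpace ℝ E] [FiniteDimensional ℝ E]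
  [MeasurableSpace E] [BorelSpace E] {μ : Measure E} [μ.IsAddHaarMeasure]

lemma lintegral_farKernel_lt_top {σ : ℝ} (hσ : 0 < σ) : ∫⁻ h, farKernel σ h ∂μ < ∞ := by
  obtain ⟨C, -, hC⟩ := exists_lintegral_compl_ball_kernel_eq μ hσ
  simp only [farKernel]
  rw [lintegral_indicator measurableSet_ball.compl, hC 1 one_pos]
  exact ENNReal.ofReal_lt_top

lemma interaction_le_add (σ : ℝ) {S U T G : Set E} (hU : U ⊆ T ∪ G) :
    interaction μ σ S U ≤ interaction μ σ S T + (∫⁻ h, farKernel σ h ∂μ) * μ G := by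
  have hfar : Measurable fun z : E × E => farKernel σ (z.1 - z.2) :=
    (measurable_farKernel σ).comp (measurable_fst.sub measurable_snd)
  have hG : ∫⁻ x in S, ∫⁻ y in G, farKernel σ (x - y) ∂μ ∂μ ≤ (∫⁻ h, farKernel σ h ∂μ) * μ G := by
    rw [lintegral_lintegral_swap (f := fun x y => farKernel σ (x - y)) hfar.aemeasurable,
      ← setLIntegral_const]
    refine lintegral_mono fun y => (setLIntegral_le_lintegral _ _).trans_eq ?_
    exact lintegral_sub_right_eq_self (fun x => farKernel σ x) y
  calc interaction μ σ S U
      ≤ ∫⁻ x in S, (∫⁻ y in T, farKernel σ (x - y) ∂μ + ∫⁻ y in G, farKernel σ (x - y) ∂μ) ∂μ :=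
        lintegral_mono fun x => (lintegral_mono_set hU).trans (lintegral_union_le _ _ _)
    _ = interaction μ σ S T + ∫⁻ x in S, ∫⁻ y in G, farKernel σ (x - y) ∂μ ∂μ := by
        rw [lintegral_add_right _ hfar.lintegral_prod_right', interaction]
    _ ≤ _ := by gcongr

lemma exists_mul_interaction_le_add {σ α κ : ℝ} (hσ : 0 < σ) (hα : 0 < α) (hκ : 0 < κ) :
    ∃ c, 0 < c ∧ ∀ S U T G : Set E, U ⊆ T ∪ G → ENNReal.ofReal c * interaction μ σ S U ≤
      ENNReal.ofReal α * interaction μ σ S T + ENNReal.ofReal κ * μ G := by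
  set J := (∫⁻ h, farKernel σ h ∂μ).toReal
  have hJ : ∫⁻ h, farKernel σ h ∂μ = ENNReal.ofReal J :=
    (ENNReal.ofReal_toReal (lintegral_farKernel_lt_top hσ).ne).symm
  have : 0 ≤ J := ENNReal.toReal_nonneg
  have hcJ : min α (κ / (J + 1)) * J ≤ κ :=
    calc min α (κ / (J + 1)) * J ≤ κ / (J + 1) * (J + 1) := by
          gcongr
          exacts [min_le_right _ _, by linarith]
      _ = κ := div_mul_cancel₀ _ (by positivity)
  refine ⟨min α (κ / (J + 1)), by positivity, fun S U T G hU => ?_⟩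
  calc ENNReal.ofReal (min α (κ / (J + 1))) * interaction μ σ S U
      ≤ ENNReal.ofReal (min α (κ / (J + 1))) *
          (interaction μ σ S T + ENNReal.ofReal J * μ G) := by
        gcongr
        exact (interaction_le_add σ hU).trans_eq (by rw [hJ])
    _ = ENNReal.ofReal (min α (κ / (J + 1))) * interaction μ σ S T +
          ENNReal.ofReal (min α (κ / (J + 1)) * J) * μ G := by
        rw [mul_add, ← mul_assoc, ENNReal.ofReal_mul (by positivity)]
    _ ≤ _ := by
        gcongr
        exact min_le_left _ _

end FarKernel

section PerimeterControl

variable {E : Type*} [NormedAddCommGroup E] [MeasurableSpace E]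

/-- The measure of `{u > θ}` in the ball of radius `R`, weighted by a power of the distance to the
sphere; the shift by `1` keeps the weight bounded. -/
def weightedSuperlevel (μ : Measure E) (σ θ : ℝ) (u : E → ℝ) (R : ℝ) : ℝ≥0∞ :=
  ∫⁻ x in ball 0 R ∩ {x | θ < u x}, ENNReal.ofReal ((1 + R - ‖x‖) ^ (-σ)) ∂μ

/-- The nonlocal perimeter of some set containing `{u > θ}` in the ball of radius `R - K` is
controlled by `ε` and by the weighted measure of `{u > θ}` in the ball of radius `R`. This is all
that the iteration uses of the minimality of `u`. -/
def PerimeterControl [NormedSpace ℝ E] (μ : Measure E) (σ θ K c C ε : ℝ) (u : E → ℝ) (R : ℝ) :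
    Prop :=
  ∃ S : Set E, MeasurableSet S ∧ μ S ≠ ∞ ∧ ball 0 (R - K) ∩ {x | θ < u x} ⊆ S ∧
    ENNReal.ofReal c * interaction μ σ S Sᶜ ≤
      ENNReal.ofReal ε + ENNReal.ofReal C * weightedSuperlevel μ σ θ u R

lemma lintegral_le_mul_weightedSuperlevel [BorelSpace E] {μ : Measure E} {σ θ b C R : ℝ}
    {u w f : E → ℝ} (hu : Measurable u) (hC : 0 ≤ C) (hθ : θ ≤ b)
    (hball : ∀ x, w x < u x → ‖x‖ < R) (hf : ∀ x, ‖x‖ < R → f x ≤ C * (1 + R - ‖x‖) ^ (-σ)) :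
    ∫⁻ x in {x | max (w x) b < u x}, ENNReal.ofReal (f x) ∂μ ≤
      ENNReal.ofReal C * weightedSuperlevel μ σ θ u R := by
  have hsubset : {x | max (w x) b < u x} ⊆ ball 0 R ∩ {x | θ < u x} := fun x hx => by
    obtain ⟨hwx, hbx⟩ := max_lt_iff.1 hx.out
    exact ⟨mem_ball_zero_iff.2 (hball x hwx), hθ.trans_lt hbx⟩
  rw [weightedSuperlevel, ← lintegral_const_mul' _ _ ENNReal.ofReal_ne_top]
  refine (lintegral_mono_set hsubset).trans (setLIntegral_mono'
    (measurableSet_ball.inter (measurableSet_lt measurable_const hu)) fun x hx => ?_)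
  rw [← ENNReal.ofReal_mul hC]
  exact ENNReal.ofReal_le_ofReal (hf x (mem_ball_zero_iff.1 hx.1))

end PerimeterControl

section EnergyEstimate

variable {n : ℕ}

lemma kinetic_eq_lintegral_pairMeasure {s p : ℝ} {u : EuclideanSpace ℝ (Fin n) → ℝ}
    (hu : Measurable u) (Ω : Set (EuclideanSpace ℝ (Fin n))) :
    kinetic s p u Ω = ∫⁻ z, ENNReal.ofReal (|u z.1 - u z.2| ^ p * kernel (s * p) (z.1 - z.2))
      ∂pairMeasure volume Ω := by
  have hgag (x y : EuclideanSpace ℝ (Fin n)) :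
      gagliardo s p u x y = ENNReal.ofReal (|u x - u y| ^ p * kernel (s * p) (x - y)) := by
    rw [gagliardo, kernel, finrank_euclideanSpace_fin, Real.rpow_neg (norm_nonneg _),
      div_eq_mul_inv]
  have hmeas : Measurable fun z : EuclideanSpace ℝ (Fin n) × EuclideanSpace ℝ (Fin n) =>
      ENNReal.ofReal (|u z.1 - u z.2| ^ p * kernel (s * p) (z.1 - z.2)) :=
    (((((hu.comp measurable_fst).sub (hu.comp measurable_snd)).norm).pow_const _).mul
      ((measurable_kernel _).comp (measurable_fst.sub measurable_snd))).ennreal_ofReal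
  simp only [kinetic, hgag, lintegral_pairMeasure, ← Measure.prod_restrict,
    lintegral_prod _ hmeas.aemeasurable]

/-- Summing the minimality inequality for the competitor `v` with the comparisons of the kinetic and
potential parts, every energy of `u` and `v` cancels. -/
lemma mul_add_le_of_energy_comparison {t Ku Kv Wu Wv P I G D ε : ℝ≥0∞} (ht : t ≤ 1)
    (hKu : Ku ≠ ∞) (hWu : Wu ≠ ∞) (hkin : Kv + I ≤ Ku + P) (hpot : Wv + P + G ≤ Wu + D)
    (hmin : Kv ≠ ∞ → t * Ku + Wu ≤ ε + (t * Kv + Wv)) : t * I + G ≤ ε + D := by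
  rcases eq_or_ne D ∞ with rfl | hD
  · simp
  have hWvP : Wv + P ≠ ∞ :=
    ne_top_of_le_ne_top (ENNReal.add_ne_top.2 ⟨hWu, hD⟩) (le_self_add.trans hpot)
  have hKv : Kv ≠ ∞ := ne_top_of_le_ne_top
    (ENNReal.add_ne_top.2 ⟨hKu, (ENNReal.add_ne_top.1 hWvP).2⟩) (le_self_add.trans hkin)
  have htop : t ≠ ∞ := ne_top_of_le_ne_top ENNReal.one_ne_top ht
  refine (ENNReal.add_le_add_iff_left (a := t * Ku + t * Kv + Wu + (Wv + P)) ?_).1 ?_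
  · finiteness
  calc t * Ku + t * Kv + Wu + (Wv + P) + (t * I + G)
      = (t * Ku + Wu) + t * (Kv + I) + (Wv + P + G) := by ring
    _ ≤ (ε + (t * Kv + Wv)) + t * (Ku + P) + (Wu + D) := by
        exact add_le_add (add_le_add (hmin hKv) (mul_le_mul_right hkin t)) hpot
    _ = (ε + (t * Kv + Wv)) + (t * Ku + t * P) + (Wu + D) := by rw [mul_add]
    _ ≤ (ε + (t * Kv + Wv)) + (t * Ku + 1 * P) + (Wu + D) := by gcongr
    _ = t * Ku + t * Kv + Wu + (Wv + P) + (ε + D) := by ring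

lemma min_mem_XTrace {s p : ℝ} {u w : EuclideanSpace ℝ (Fin n) → ℝ}
    {Ω : Set (EuclideanSpace ℝ (Fin n))} (hu : Measurable u) (hu₁ : ∀ x, |u x| ≤ 1)
    (hw : Measurable w) (hw₁ : ∀ x, |w x| ≤ 1) (huw : ∀ x ∉ Ω, u x ≤ w x)
    (hkin : kinetic s p (fun x => min (u x) (w x)) Ω < ∞) :
    (fun x => min (u x) (w x)) ∈ XTrace s p u Ω := by
  refine ⟨⟨(hu.min hw).aemeasurable, hkin, .of_forall fun x => ?_⟩,
    .of_forall fun x hx => min_eq_left (huw x hx)⟩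
  rcases min_choice (u x) (w x) with h | h <;> simp only [h]
  exacts [hu₁ x, hw₁ x]

lemma EpsMinimizes.interaction_add_volume_le {W : ℝ → ℝ} {m lam Lam θ q c₁ s p c a ε : ℝ}
    (hW : IsDegeneratePotential W m lam Lam θ q c₁) (hm : 1 < m) (hs : 0 < s) (hp : 1 < p)
    (hc : 0 ≤ c) (ha : 0 < a) (haq : 4 * a ≤ q)
    (hgap : ∀ x y : ℝ, |x| ≤ 2 * 1 → |y| ≤ 2 * 1 → a ≤ |x - y| →
      |y| ^ p + p * spow (p - 1) y * (x - y) + c ≤ |x| ^ p)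
    {Ω : Set (EuclideanSpace ℝ (Fin n))} (hΩ : MeasurableSet Ω) (hΩfin : volume Ω ≠ ∞)
    {u w : EuclideanSpace ℝ (Fin n) → ℝ} (hmin : EpsMinimizes W s p ε u Ω) (hu : Measurable u)
    (hu₁ : ∀ x, |u x| ≤ 1) (hw : Measurable w) (hw₁ : ∀ x, w x ∈ Ioc (-1) 1)
    (huw : ∀ x ∉ Ω, u x ≤ w x)
    (hop : ∀ δ, 0 < δ → ∀ᵐ x, w x < u x →
      ∫ h in (closedBall 0 δ)ᶜ, spow (p - 1) (w (x + h) - w x) * kernel (s * p) h ≤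
        c₁ / p * (1 + w x) ^ (m - 1)) :
    ENNReal.ofReal (1 - s) * (ENNReal.ofReal c *
          interaction volume (s * p) {x | 2 * a ≤ (u x - w x)⁺} {x | (u x - w x)⁺ ≤ a}) +
        ENNReal.ofReal (c₁ * a ^ ⌈m⌉₊) * volume {x | (u x - w x)⁺ ∈ Ioo a (2 * a)} ≤
      ENNReal.ofReal ε +
        ENNReal.ofReal (2 * Lam + 2 * c₁ + c₁ * a ^ ⌈m⌉₊ / (2 * a) ^ (m - 1)) *
          ∫⁻ x in {x | max (w x) (-1 + q) < u x}, ENNReal.ofReal ((1 + w x) ^ (m - 1)) := by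
  have hw_abs (x) : |w x| ≤ 1 := abs_le.2 ⟨(hw₁ x).1.le, (hw₁ x).2⟩
  have hη_zero (x) (hx : x ∉ Ω) : (u x - w x)⁺ = 0 := posPart_eq_zero.2 (sub_nonpos.2 (huw x hx))
  have hkin := lintegral_kernel_min_add_interaction_le (mul_pos hs (one_pos.trans hp)) hp hc ha
    hgap hΩ hΩfin hu hw hu₁ hw_abs huw hop
  have hfirst : ∫⁻ x, ENNReal.ofReal (p * (u x - w x)⁺ * (c₁ / p * (1 + w x) ^ (m - 1))) =
      ∫⁻ x in Ω, ENNReal.ofReal (c₁ * (u x - w x)⁺ * (1 + w x) ^ (m - 1)) := by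
    rw [← setLIntegral_eq_of_support_subset (s := Ω) fun x hx => ?_]
    · refine lintegral_congr fun x => congrArg ENNReal.ofReal ?_
      field_simp
    · by_contra hxΩ
      simp [hη_zero x hxΩ] at hx
  rw [← kinetic_eq_lintegral_pairMeasure hu,
    ← kinetic_eq_lintegral_pairMeasure (u := fun x => min (u x) (w x)) (hu.min hw), hfirst] at hkin
  have : IsFiniteMeasure (volume.restrict Ω) := isFiniteMeasure_restrict.2 hΩfin
  have hpot := hW.lintegral_min_add_add_le hm ha haq (ν := volume.restrict Ω) hu hw hu₁ hw₁
  have hGΩ : {x | (u x - w x)⁺ ∈ Ioo a (2 * a)} ⊆ Ω := fun x (hx : _ ∈ Ioo a (2 * a)) =>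
    by_contra fun hxΩ => (ha.trans hx.1).ne' (hη_zero x hxΩ)
  rw [Measure.restrict_eq_self volume hGΩ] at hpot
  refine (mul_add_le_of_energy_comparison (ε := ENNReal.ofReal ε)
    (ENNReal.ofReal_le_one.2 (by linarith)) hmin.1.2.1.ne (hW.lintegral_comp_lt_top hm hu₁).ne
    hkin hpot fun hKv => ?_).trans ?_
  · exact hmin.2 _ (min_mem_XTrace hu hu₁ hw hw_abs huw hKv.lt_top)
  · gcongr
    exact Measure.restrict_le_self

lemma exists_perimeterControl [NeZero n] {s p m c₁ θs : ℝ} (hs : 0 < s) (hs₁ : s < 1)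
    (hp : 1 < p) (hm : 1 < m) (hc₁ : 0 < c₁) (hθs : -1 < θs) :
    ∃ K c : ℝ, 0 < K ∧ 0 < c ∧ ∀ Lam : ℝ, 1 ≤ Lam → ∃ C : ℝ, 0 < C ∧
      ∀ (lam θ q : ℝ) (W : ℝ → ℝ), IsDegeneratePotential W m lam Lam θ q c₁ → θs ≤ -1 + q →
      ∀ (Ω : Set (EuclideanSpace ℝ (Fin n))) (u : EuclideanSpace ℝ (Fin n) → ℝ),
      MeasurableSet Ω → volume Ω ≠ ∞ → Measurable u → (∀ x, |u x| ≤ 1) →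
      ∀ ε : ℝ, EpsMinimizes W s p ε u Ω → ∀ R : ℝ, K ≤ R → ball 0 R ⊆ Ω →
      PerimeterControl volume (s * p) θs K c C ε u R := by
  have hσ : 0 < s * p := by positivity
  obtain ⟨a, ha, haθ⟩ : ∃ a, 0 < a ∧ 4 * a = 1 + θs := ⟨(1 + θs) / 4, by linarith, by ring⟩
  obtain ⟨g, hg, hgap⟩ := exists_abs_rpow_tangent_add_le hp ha (2 * 1)
  obtain ⟨K, Cw, hK, hCw, hbarrier⟩ := exists_barrier (E := EuclideanSpace ℝ (Fin n)) hp hσ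
    (mul_lt_of_lt_one_left (one_pos.trans hp) hs₁) hm (div_pos hc₁ (one_pos.trans hp))
    (mul_pos two_pos ha)
  obtain ⟨c, hc, hcover⟩ := exists_mul_interaction_le_add
    (μ := (volume : Measure (EuclideanSpace ℝ (Fin n)))) hσ (mul_pos (sub_pos.2 hs₁) hg)
    (mul_pos hc₁ (pow_pos ha ⌈m⌉₊))
  refine ⟨K, c, hK, hc, fun Lam hLam => ?_⟩
  set C := 2 * Lam + 2 * c₁ + c₁ * a ^ ⌈m⌉₊ / (2 * a) ^ (m - 1)
  have hC : 0 < C := by positivity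
  refine ⟨C * Cw, by positivity, fun lam θ q W hW hθq Ω u hΩ hΩfin hu hu₁ ε hmin R hR hRΩ => ?_⟩
  obtain ⟨w, hw_cont, hw₁, hw_out, hw_in, hw_decay, hop⟩ := hbarrier R hR
  have huw (x) (hx : R ≤ ‖x‖) : u x ≤ w x := (abs_le.1 (hu₁ x)).2.trans_eq (hw_out x hx).symm
  have hball (x) (hx : w x < u x) : ‖x‖ < R := lt_of_not_ge fun h => (huw x h).not_gt hx
  have hS_ball : {x | 2 * a ≤ (u x - w x)⁺} ⊆ ball 0 R := fun x (hx : 2 * a ≤ _) =>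
    mem_ball_zero_iff.2 (hball x (sub_pos.1 (posPart_pos_iff.1 (by linarith))))
  have hweighted := lintegral_le_mul_weightedSuperlevel (μ := volume) (f := fun x =>
    (1 + w x) ^ (m - 1)) hu hCw.le hθq hball fun x hx => hw_decay x hx.le
  have henergy := hmin.interaction_add_volume_le hW hm hs hp hg.le ha (by linarith) hgap hΩ hΩfin
    hu hu₁ hw_cont.measurable hw₁ (fun x hx => huw x (le_of_not_gt fun h => hx (hRΩ (by simpa)))) ?_
  · refine ⟨{x | 2 * a ≤ (u x - w x)⁺}, measurableSet_le measurable_const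
      ((hu.sub hw_cont.measurable).max measurable_const),
      ((measure_mono hS_ball).trans_lt measure_ball_lt_top).ne, fun x hx => ?_, ?_⟩
    · have hwx := hw_in x (mem_ball_zero_iff.1 hx.1).le
      have hux : θs < u x := hx.2
      exact (show 2 * a ≤ u x - w x by linarith).trans (le_posPart _)
    · refine (hcover _ _ {x | (u x - w x)⁺ ≤ a} {x | (u x - w x)⁺ ∈ Ioo a (2 * a)}
        fun x hx => ?_).trans ?_
      · exact (le_or_gt _ a).imp_right fun h => ⟨h, not_le.1 hx⟩
      · rw [ENNReal.ofReal_mul (sub_nonneg.2 hs₁.le), mul_assoc, ENNReal.ofReal_mul hC.le,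
          mul_assoc]
        exact henergy.trans (by gcongr)
  · intro δ hδ
    filter_upwards [Measure.ae_ne volume 0] with x hx₀ hx
    exact hop x hx₀ (hball x hx) δ hδ

end EnergyEstimate

/-! ### Iteration over balls -/

section WeightSum

variable {σ : ℝ}

lemma sum_truncated_rpow_le (hσ : 0 ≤ σ) (ℓ : ℕ) (d : ℝ) :
    ∑ i ∈ Finset.range ℓ, (if 0 < d + i then (1 + (d + i)) ^ (-σ) else 0) ≤
      ∑ k ∈ Finset.range ℓ, (1 + (k : ℝ)) ^ (-σ) := by
  have hpos (ℓ : ℕ) {d : ℝ} (hd : 0 < d) :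
      ∑ i ∈ Finset.range ℓ, (if 0 < d + i then (1 + (d + i)) ^ (-σ) else 0) ≤
        ∑ k ∈ Finset.range ℓ, (1 + (k : ℝ)) ^ (-σ) := by
    refine Finset.sum_le_sum fun i _ => ?_
    rw [if_pos (by positivity)]
    exact Real.rpow_le_rpow_of_nonpos (by positivity) (by linarith) (by linarith)
  induction ℓ generalizing d with
  | zero => simp
  | succ ℓ ih =>
    rcases lt_or_ge 0 d with hd | hd
    · exact hpos _ hd
    rw [Finset.sum_range_succ', Finset.sum_range_succ _ ℓ, if_neg (by simpa using hd), add_zero]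
    have hshift (i : ℕ) : d + ((i + 1 : ℕ) : ℝ) = d + 1 + i := by push_cast; ring
    simp only [hshift]
    exact (ih (d + 1)).trans (le_add_of_nonneg_right (by positivity))

lemma sum_range_two_pow_rpow_le (hσ : 0 ≤ σ) (M : ℕ) :
    ∑ k ∈ Finset.range (2 ^ M), (1 + (k : ℝ)) ^ (-σ) ≤ 2 * dyadicSum σ M := by
  have hsum : ∑ k ∈ Finset.range (2 ^ M), (1 + (k : ℝ)) ^ (-σ) ≤
      1 + ∑ j ∈ Finset.range M, ((2 : ℝ) ^ (1 - σ)) ^ j := by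
    induction M with
    | zero => simp
    | succ M ih =>
      rw [pow_succ, mul_two, Finset.sum_range_add, Finset.sum_range_succ _ M, ← add_assoc]
      refine add_le_add ih ?_
      calc ∑ k ∈ Finset.range (2 ^ M), (1 + ((2 ^ M + k : ℕ) : ℝ)) ^ (-σ)
          ≤ ∑ _k ∈ Finset.range (2 ^ M), ((2 : ℝ) ^ M) ^ (-σ) := by
            refine Finset.sum_le_sum fun k _ => ?_
            refine Real.rpow_le_rpow_of_nonpos (by positivity) ?_ (by linarith)
            push_cast
            linarith [(Nat.cast_nonneg k : (0 : ℝ) ≤ k)]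
        _ = ((2 : ℝ) ^ (1 - σ)) ^ M := by
            rw [Finset.sum_const, Finset.card_range, nsmul_eq_mul, sub_eq_add_neg,
              Real.rpow_add two_pos, Real.rpow_one, mul_pow, ← Real.rpow_pow_comm two_pos.le,
              Nat.cast_pow, Nat.cast_ofNat]
  have hgeom : ∑ j ∈ Finset.range M, ((2 : ℝ) ^ (1 - σ)) ^ j ≤ dyadicSum σ M := by
    rw [dyadicSum, Finset.sum_range_succ]
    exact le_add_of_nonneg_right (by positivity)
  linarith [one_le_dyadicSum σ M]

lemma dyadicSum_add_le (σ : ℝ) (N i : ℕ) :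
    dyadicSum σ (N + i) ≤ (i + 1) * max ((2 : ℝ) ^ (1 - σ)) 1 ^ i * dyadicSum σ N := by
  set ratio := (2 : ℝ) ^ (1 - σ) with hratio
  set Q := max ratio 1
  have hratio₀ : 0 ≤ ratio := by positivity
  have hsplit : dyadicSum σ (N + i) =
      ∑ j ∈ Finset.range i, ratio ^ j + ratio ^ i * dyadicSum σ N := by
    rw [dyadicSum, show N + i + 1 = i + (N + 1) by ring, Finset.sum_range_add, dyadicSum,
      Finset.mul_sum]
    simp only [pow_add, hratio]
  have hpow : ratio ^ i ≤ Q ^ i := pow_le_pow_left₀ hratio₀ (le_max_left _ _) i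
  have hhead : ∑ j ∈ Finset.range i, ratio ^ j ≤ i * Q ^ i := by
    calc ∑ j ∈ Finset.range i, ratio ^ j ≤ ∑ _j ∈ Finset.range i, Q ^ i :=
          Finset.sum_le_sum fun j hj => (pow_le_pow_left₀ hratio₀ (le_max_left _ _) j).trans
            (pow_le_pow_right₀ (le_max_right _ _) (Finset.mem_range.1 hj).le)
      _ = i * Q ^ i := by simp
  have hone := one_le_dyadicSum σ N
  calc dyadicSum σ (N + i) ≤ i * Q ^ i * dyadicSum σ N + Q ^ i * dyadicSum σ N := by
        rw [hsplit]
        gcongr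
        exact hhead.trans (le_mul_of_one_le_right (by positivity) hone)
    _ = (i + 1) * Q ^ i * dyadicSum σ N := by ring

lemma exists_add_one_mul_pow_le {Q a : ℝ} (hQ : 0 ≤ Q) (hQ₂ : Q < 2) (ha : 0 < a) :
    ∃ i : ℕ, ((i : ℝ) + 1) * Q ^ i ≤ a * 2 ^ i := by
  have hlt : Q / 2 < 1 := by linarith
  have hlim := (tendsto_self_mul_const_pow_of_lt_one (by positivity : 0 ≤ Q / 2) hlt).add
    (tendsto_pow_atTop_nhds_zero_of_lt_one (by positivity : 0 ≤ Q / 2) hlt)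
  rw [add_zero] at hlim
  obtain ⟨i, hi⟩ := (hlim.eventually (gt_mem_nhds ha)).exists
  refine ⟨i, ?_⟩
  rw [div_pow, ← add_one_mul, mul_div_assoc', div_lt_iff₀ (by positivity)] at hi
  exact hi.le

/-- The gain `2 ^ i` of summing over `2 ^ i` times as many radii beats the growth of the weights,
since `2 ^ (1 - σ) < 2`. -/
lemma exists_forall_dyadicSum_add_le (hσ : 0 < σ) {a : ℝ} (ha : 0 < a) :
    ∃ i : ℕ, ∀ N, dyadicSum σ (N + i) ≤ a * 2 ^ i * dyadicSum σ N := by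
  have hQ : max ((2 : ℝ) ^ (1 - σ)) 1 < 2 :=
    max_lt (Real.rpow_lt_self_of_one_lt one_lt_two (by linarith)) one_lt_two
  obtain ⟨i, hi⟩ := exists_add_one_mul_pow_le (by positivity) hQ ha
  refine ⟨i, fun N => (dyadicSum_add_le σ N i).trans ?_⟩
  have := one_le_dyadicSum σ N
  gcongr

end WeightSum

lemma div_pow_mul_pow_le_of_doubling {V : ℝ → ℝ} (hV : Monotone V) {d : ℕ} {r₀ H v₀ r : ℝ}
    (hr₀ : 0 < r₀) (hH : r₀ ≤ H) (hv₀ : 0 ≤ v₀) (hVr₀ : v₀ ≤ V r₀) (hr : r₀ ≤ r)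
    (hdoubling : ∀ j : ℕ, H * 2 ^ (j + 1) ≤ r → (2 ^ j) ^ d * v₀ ≤ V (H * 2 ^ j) →
      (2 ^ (j + 1)) ^ d * v₀ ≤ V (H * 2 ^ (j + 1))) :
    v₀ / (2 * H) ^ d * r ^ d ≤ V r := by
  have hr_pos := hr₀.trans_le hr
  have hH_pos := hr₀.trans_le hH
  rcases lt_or_ge r H with hrH | hrH
  · calc v₀ / (2 * H) ^ d * r ^ d ≤ v₀ / (2 * H) ^ d * (2 * H) ^ d := by gcongr; linarith
      _ = v₀ := by field_simp
      _ ≤ V r := hVr₀.trans (hV hr)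
  have hgrowth (j : ℕ) : H * 2 ^ j ≤ r → (2 ^ j) ^ d * v₀ ≤ V (H * 2 ^ j) := by
    induction j with
    | zero => simpa using fun _ => hVr₀.trans (hV hH)
    | succ j ih =>
      refine fun hj => hdoubling j hj (ih (le_trans ?_ hj))
      gcongr <;> norm_num
  obtain ⟨j, hj, hj'⟩ := exists_nat_pow_near ((one_le_div hH_pos).2 hrH) (one_lt_two (α := ℝ))
  rw [le_div_iff₀' hH_pos] at hj
  rw [div_lt_iff₀' hH_pos, pow_succ', ← mul_assoc, mul_comm H] at hj'
  calc v₀ / (2 * H) ^ d * r ^ d ≤ v₀ / (2 * H) ^ d * (2 * H * 2 ^ j) ^ d := by gcongr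
    _ = (2 ^ j) ^ d * v₀ := by rw [mul_pow (2 * H)]; field_simp
    _ ≤ V r := (hgrowth j hj).trans (hV hj)

section Superlevel

variable {E : Type*} [NormedAddCommGroup E] [MeasurableSpace E] {μ : Measure E}

/-- The measure of `{u > θ}` in the ball of radius `R`, the quantity whose growth in `R` the density
estimate quantifies. -/
def superlevelMeasure (μ : Measure E) (θ : ℝ) (u : E → ℝ) (R : ℝ) : ℝ :=
  μ.real (ball 0 R ∩ {x | θ < u x})

lemma superlevelMeasure_congr_ae {u v : E → ℝ} (h : u =ᵐ[μ] v) (θ R : ℝ) :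
    superlevelMeasure μ θ u R = superlevelMeasure μ θ v R := by
  refine measureReal_congr ?_
  filter_upwards [h] with x hx
  change (x ∈ ball 0 R ∧ θ < u x) = (x ∈ ball 0 R ∧ θ < v x)
  rw [hx]

lemma sum_weightedSuperlevel_le [OpensMeasurableSpace E] {σ θ : ℝ} (hσ : 0 ≤ σ) {u : E → ℝ}
    (T : ℝ) (ℓ : ℕ) :
    ∑ i ∈ Finset.range ℓ, weightedSuperlevel μ σ θ u (T + i) ≤
      ENNReal.ofReal (∑ k ∈ Finset.range ℓ, (1 + (k : ℝ)) ^ (-σ)) *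
        μ (ball 0 (T + ℓ) ∩ {x | θ < u x}) := by
  set weight : ℕ → E → ℝ≥0∞ := fun i =>
    (ball 0 (T + i)).indicator fun x => ENNReal.ofReal ((1 + (T + i) - ‖x‖) ^ (-σ))
  have hweight_meas (i : ℕ) : Measurable (weight i) :=
    ((measurable_const.sub measurable_norm).pow_const _).ennreal_ofReal.indicator
      measurableSet_ball
  have hball : ∀ i ∈ Finset.range ℓ, weightedSuperlevel μ σ θ u (T + i) =
      ∫⁻ x in ball 0 (T + ℓ) ∩ {x | θ < u x}, weight i x ∂μ := fun i hi => by
    have hiℓ : (i : ℝ) ≤ ℓ := by exact_mod_cast (Finset.mem_range.1 hi).le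
    rw [setLIntegral_indicator measurableSet_ball, ← inter_assoc,
      inter_eq_left.2 (ball_subset_ball (by linarith)), weightedSuperlevel]
  have hweight_sum (x : E) : ∑ i ∈ Finset.range ℓ, weight i x ≤
      ENNReal.ofReal (∑ k ∈ Finset.range ℓ, (1 + (k : ℝ)) ^ (-σ)) := by
    refine le_trans (Eq.le ?_)
      (ENNReal.ofReal_le_ofReal (sum_truncated_rpow_le hσ ℓ (T - ‖x‖)))
    rw [ENNReal.ofReal_sum_of_nonneg fun i _ => by split_ifs <;> positivity]
    refine Finset.sum_congr rfl fun i _ => ?_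
    have hmem : x ∈ ball (0 : E) (T + i) ↔ 0 < T - ‖x‖ + i := by
      rw [mem_ball_zero_iff]
      constructor <;> intro h <;> linarith
    split_ifs with h
    · simp only [weight, indicator_of_mem (hmem.2 h)]
      ring_nf
    · simp only [weight, indicator_of_notMem (mt hmem.1 h), ENNReal.ofReal_zero]
  rw [Finset.sum_congr rfl hball, ← lintegral_finsetSum _ fun i _ => hweight_meas i,
    ← setLIntegral_const]
  exact lintegral_mono hweight_sum

lemma monotone_superlevelMeasure [ProperSpace E] [IsFiniteMeasureOnCompacts μ] (θ : ℝ)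
    (u : E → ℝ) : Monotone (superlevelMeasure μ θ u) := fun _ _ h =>
  measureReal_mono (inter_subset_inter_left _ (ball_subset_ball h))
    ((measure_mono inter_subset_left).trans_lt measure_ball_lt_top).ne

lemma PerimeterControl.le_mul_weightedSuperlevel [NormedSpace ℝ E] {σ θ K c C ε c' X v ρ R : ℝ}
    {u : E → ℝ} (h : PerimeterControl μ σ θ K c C ε u R) (hc : 0 ≤ c) (hX : 0 ≤ X)
    (hiso : ∀ S : Set E, MeasurableSet S → μ S ≠ ∞ → v ≤ μ.real S →
      ENNReal.ofReal c' ≤ interaction μ σ S Sᶜ)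
    (hcX : c * c' = 2 * X) (hεX : ε ≤ X) (hρ : ρ ≤ R - K) (hv : v ≤ superlevelMeasure μ θ u ρ) :
    ENNReal.ofReal X ≤ ENNReal.ofReal C * weightedSuperlevel μ σ θ u R := by
  obtain ⟨S, hS, hSfin, hsubset, hle⟩ := h
  have hvS : v ≤ μ.real S := hv.trans <| measureReal_mono
    ((inter_subset_inter_left _ (ball_subset_ball hρ)).trans hsubset) hSfin
  refine (ENNReal.add_le_add_iff_left (a := ENNReal.ofReal X) ENNReal.ofReal_ne_top).1 ?_
  calc ENNReal.ofReal X + ENNReal.ofReal X = ENNReal.ofReal c * ENNReal.ofReal c' := by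
        rw [← ENNReal.ofReal_mul hc, hcX, two_mul, ENNReal.ofReal_add hX hX]
    _ ≤ ENNReal.ofReal c * interaction μ σ S Sᶜ := by gcongr; exact hiso S hS hSfin hvS
    _ ≤ ENNReal.ofReal ε + ENNReal.ofReal C * weightedSuperlevel μ σ θ u R := hle
    _ ≤ ENNReal.ofReal X + ENNReal.ofReal C * weightedSuperlevel μ σ θ u R := by gcongr

lemma mul_le_mul_superlevelMeasure_of_forall_le [ProperSpace E] [OpensMeasurableSpace E]
    [IsFiniteMeasureOnCompacts μ] {σ θ C X T : ℝ} {u : E → ℝ} (hσ : 0 ≤ σ) (hC : 0 ≤ C)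
    (M : ℕ) (hle : ∀ i < 2 ^ M, ENNReal.ofReal X ≤
      ENNReal.ofReal C * weightedSuperlevel μ σ θ u (T + (i : ℕ))) :
    2 ^ M * X ≤ C * (2 * dyadicSum σ M) * superlevelMeasure μ θ u (T + 2 ^ M) := by
  have hfin : μ (ball 0 (T + (2 ^ M : ℕ)) ∩ {x | θ < u x}) ≠ ∞ :=
    ((measure_mono inter_subset_left).trans_lt measure_ball_lt_top).ne
  have hnonneg : 0 ≤ ∑ k ∈ Finset.range (2 ^ M), (1 + (k : ℝ)) ^ (-σ) :=
    Finset.sum_nonneg fun k _ => by positivity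
  have hsum := Finset.sum_le_sum fun i hi => hle i (Finset.mem_range.1 hi)
  rw [Finset.sum_const, Finset.card_range, nsmul_eq_mul, ← Finset.mul_sum,
    ← ENNReal.ofReal_natCast, ← ENNReal.ofReal_mul (by positivity)] at hsum
  have hbound := hsum.trans (mul_le_mul_right (sum_weightedSuperlevel_le hσ T (2 ^ M)) _)
  rw [← ofReal_measureReal hfin, ← ENNReal.ofReal_mul hnonneg, ← ENNReal.ofReal_mul hC,
    ENNReal.ofReal_le_ofReal_iff (by positivity)] at hbound
  push_cast at hbound
  calc 2 ^ M * X ≤ C * (_ * superlevelMeasure μ θ u (T + 2 ^ M)) := hbound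
    _ ≤ C * (2 * dyadicSum σ M * superlevelMeasure μ θ u (T + 2 ^ M)) := by
        gcongr
        exacts [measureReal_nonneg, sum_range_two_pow_rpow_le hσ M]
    _ = C * (2 * dyadicSum σ M) * superlevelMeasure μ θ u (T + 2 ^ M) := by ring

end Superlevel

section Growth

variable {E : Type*} [NormedAddCommGroup E] [NormedSpace ℝ E] [FiniteDimensional ℝ E]
  [Nontrivial E] [MeasurableSpace E] [BorelSpace E] (μ : Measure E) [μ.IsAddHaarMeasure]

/-- Averaging the energy estimate over `2 ^ (N + i₀)` consecutive radii. -/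
lemma exists_two_pow_mul_le_superlevelMeasure {σ c : ℝ} (hσ : 0 < σ) (hc : 0 < c) :
    ∃ b κ : ℝ, 0 < b ∧ 0 < κ ∧ ∀ C, 0 < C → ∃ i₀ : ℕ, ∀ (θ K ε ρ v : ℝ) (N : ℕ) (u : E → ℝ),
      0 ≤ v → v ≤ b * (2 ^ N) ^ finrank ℝ E → v ≤ superlevelMeasure μ θ u ρ →
      ε ≤ κ * (v / 2 ^ N) →
      (∀ R, ρ + K ≤ R → R ≤ ρ + K + 2 ^ (N + i₀) → PerimeterControl μ σ θ K c C ε u R) →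
      2 ^ finrank ℝ E * v ≤ superlevelMeasure μ θ u (ρ + K + 2 ^ (N + i₀)) := by
  obtain ⟨b, c', hb, hc', hiso⟩ := exists_isoperimetric μ hσ.le
  refine ⟨b, c * c' / 2, hb, by positivity, fun C hC => ?_⟩
  obtain ⟨i₀, hi₀⟩ := exists_forall_dyadicSum_add_le hσ
    (by positivity : 0 < c * c' / 2 / (2 * C * 2 ^ finrank ℝ E))
  refine ⟨i₀, fun θ K ε ρ v N u hv hvb hvρ hε hcontrol => ?_⟩
  have hone := one_le_dyadicSum σ N
  have hX : 0 ≤ c * c' / 2 * (v / 2 ^ N) * dyadicSum σ N := by positivity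
  have hradius (i : ℕ) (hi : i < 2 ^ (N + i₀)) :
      ENNReal.ofReal (c * c' / 2 * (v / 2 ^ N) * dyadicSum σ N) ≤
        ENNReal.ofReal C * weightedSuperlevel μ σ θ u (ρ + K + i) := by
    have hi' : (i : ℝ) ≤ 2 ^ (N + i₀) := by exact_mod_cast hi.le
    refine (hcontrol (ρ + K + i) (by simp) (by gcongr)).le_mul_weightedSuperlevel
      (c' := c' * (v / 2 ^ N) * dyadicSum σ N) hc.le hX
      (fun S hS hSfin hvS => hiso S hS hSfin N v hv hvb hvS) (by ring)
      (hε.trans (le_mul_of_one_le_right (by positivity) hone)) ?_ hvρ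
    linarith [(Nat.cast_nonneg i : (0 : ℝ) ≤ i)]
  set V := superlevelMeasure μ θ u (ρ + K + 2 ^ (N + i₀))
  have hV : 0 ≤ V := measureReal_nonneg
  have hfactor : 0 < c * c' / 2 * 2 ^ i₀ * dyadicSum σ N := by positivity
  refine le_of_mul_le_mul_left ?_ (div_pos hfactor (pow_pos two_pos (finrank ℝ E)))
  calc c * c' / 2 * 2 ^ i₀ * dyadicSum σ N / 2 ^ finrank ℝ E * (2 ^ finrank ℝ E * v)
      = 2 ^ (N + i₀) * (c * c' / 2 * (v / 2 ^ N) * dyadicSum σ N) := by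
        rw [pow_add]; field_simp
    _ ≤ C * (2 * dyadicSum σ (N + i₀)) * V :=
        mul_le_mul_superlevelMeasure_of_forall_le hσ.le hC.le (N + i₀) hradius
    _ ≤ C * (2 * (c * c' / 2 / (2 * C * 2 ^ finrank ℝ E) * 2 ^ i₀ * dyadicSum σ N)) * V := by
        gcongr
        exact hi₀ N
    _ = c * c' / 2 * 2 ^ i₀ * dyadicSum σ N / 2 ^ finrank ℝ E * V := by field_simp

lemma exists_mul_pow_le_superlevelMeasure {σ c K : ℝ} (hσ : 0 < σ) (hc : 0 < c) (hK : 0 ≤ K) :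
    ∃ b κ : ℝ, 0 < b ∧ 0 < κ ∧ ∀ C r₀ c₀ : ℝ, 0 < C → 0 < r₀ → 0 < c₀ → ∃ ct : ℝ, 0 < ct ∧
      ∀ (θ ε r : ℝ) (u : E → ℝ), ε ≤ κ * min c₀ b →
      c₀ ≤ superlevelMeasure μ θ u r₀ → r₀ ≤ r →
      (∀ R, K ≤ R → R ≤ r → PerimeterControl μ σ θ K c C ε u R) →
      ct * r ^ finrank ℝ E ≤ superlevelMeasure μ θ u r := by
  obtain ⟨b, κ, hb, hκ, hstep⟩ := exists_two_pow_mul_le_superlevelMeasure μ hσ hc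
  refine ⟨b, κ, hb, hκ, fun C r₀ c₀ hC hr₀ hc₀ => ?_⟩
  obtain ⟨i₀, hstep⟩ := hstep C hC
  set d := finrank ℝ E
  have hd : d ≠ 0 := finrank_pos.ne'
  set H := r₀ + K + 2 ^ i₀
  have hH : r₀ ≤ H := by simp only [H, add_assoc]; exact le_add_of_nonneg_right (by positivity)
  have hv₀ : 0 < min c₀ b := lt_min hc₀ hb
  refine ⟨min c₀ b / (2 * H) ^ d, by positivity, fun θ ε r u hε hVr₀ hr hcontrol => ?_⟩
  have hmono := monotone_superlevelMeasure (μ := μ) θ u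
  refine div_pow_mul_pow_le_of_doubling hmono hr₀ hH hv₀.le ((min_le_left _ _).trans hVr₀) hr
    fun j hjr hj => ?_
  have hnext : H * 2 ^ j + K + 2 ^ (j + i₀) ≤ H * 2 ^ (j + 1) := by
    have hpow : (1 : ℝ) ≤ 2 ^ j := one_le_pow₀ one_le_two
    calc H * 2 ^ j + K + 2 ^ (j + i₀) ≤ H * 2 ^ j + (r₀ + K) * 2 ^ j + 2 ^ (j + i₀) := by
          gcongr
          exact (le_add_of_nonneg_left hr₀.le).trans (le_mul_of_one_le_right (by positivity) hpow)
      _ = H * 2 ^ (j + 1) := by simp only [H, pow_add]; ring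
  have hvb : (2 ^ j) ^ d * min c₀ b ≤ b * (2 ^ j) ^ d := by
    rw [mul_comm b]
    gcongr
    exact min_le_right _ _
  have hεj : ε ≤ κ * ((2 ^ j) ^ d * min c₀ b / 2 ^ j) := by
    refine hε.trans ?_
    gcongr
    rw [le_div_iff₀ (by positivity), mul_comm]
    gcongr
    exact le_self_pow₀ (one_le_pow₀ one_le_two) hd
  calc (2 ^ (j + 1)) ^ d * min c₀ b = 2 ^ d * ((2 ^ j) ^ d * min c₀ b) := by
        rw [pow_succ, mul_pow]; ring
    _ ≤ superlevelMeasure μ θ u (H * 2 ^ j + K + 2 ^ (j + i₀)) :=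
        hstep θ K ε (H * 2 ^ j) _ j u (by positivity) hvb hj hεj fun R hR hR' =>
          hcontrol R (le_trans (le_add_of_nonneg_left (by positivity)) hR)
            (hR'.trans (hnext.trans hjr))
    _ ≤ superlevelMeasure μ θ u (H * 2 ^ (j + 1)) := hmono hnext

end Growth

/-! ### Passing to Borel representatives -/

section Representative

variable {n : ℕ} {W : ℝ → ℝ} {s p ε : ℝ} {u v : EuclideanSpace ℝ (Fin n) → ℝ}
  {Ω : Set (EuclideanSpace ℝ (Fin n))}

lemma kinetic_congr_ae (h : u =ᵐ[volume] v) (s p : ℝ) (Ω : Set (EuclideanSpace ℝ (Fin n))) :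
    kinetic s p u Ω = kinetic s p v Ω := by
  have hcongr (A B : Set (EuclideanSpace ℝ (Fin n))) :
      ∫⁻ x in A, ∫⁻ y in B, gagliardo s p u x y = ∫⁻ x in A, ∫⁻ y in B, gagliardo s p v x y := by
    refine lintegral_congr_ae ((ae_restrict_of_ae h).mono fun x hx => ?_)
    refine lintegral_congr_ae ((ae_restrict_of_ae h).mono fun y hy => ?_)
    simp only [gagliardo, hx, hy]
  rw [kinetic, kinetic, hcongr, hcongr]

lemma energy_congr_ae (h : u =ᵐ[volume] v) (W : ℝ → ℝ) (s p : ℝ)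
    (Ω : Set (EuclideanSpace ℝ (Fin n))) : energy W s p u Ω = energy W s p v Ω := by
  rw [energy, energy, kinetic_congr_ae h]
  congr 1
  exact lintegral_congr_ae ((ae_restrict_of_ae h).mono fun x hx => by simp only [hx])

lemma EpsMinimizes.congr_ae (hmin : EpsMinimizes W s p ε u Ω) (h : u =ᵐ[volume] v) :
    EpsMinimizes W s p ε v Ω := by
  obtain ⟨⟨hu, hkin, hu₁⟩, hle⟩ := hmin
  refine ⟨⟨hu.congr h, kinetic_congr_ae h s p Ω ▸ hkin, ?_⟩, fun w hw => ?_⟩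
  · filter_upwards [h, hu₁] with x hx hux
    rwa [← hx]
  · rw [← energy_congr_ae h]
    refine hle w ⟨hw.1, ?_⟩
    filter_upwards [h, hw.2] with x hx hwx hxΩ
    rw [hx, hwx hxΩ]

lemma exists_measurable_abs_le_one_ae_eq {α : Type*} [MeasurableSpace α] {μ : Measure α}
    {f : α → ℝ} (hf : AEMeasurable f μ) (hf₁ : ∀ᵐ x ∂μ, |f x| ≤ 1) :
    ∃ g : α → ℝ, Measurable g ∧ (∀ x, |g x| ≤ 1) ∧ f =ᵐ[μ] g := by
  refine ⟨fun x => max (-1) (min 1 (hf.mk f x)),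
    measurable_const.max (measurable_const.min hf.measurable_mk), fun x => ?_, ?_⟩
  · exact abs_le.2 ⟨le_max_left _ _, max_le (by norm_num) (min_le_left _ _)⟩
  · filter_upwards [hf.ae_eq_mk, hf₁] with x hx hfx
    rw [← hx, min_eq_right (abs_le.1 hfx).2, max_eq_right (abs_le.1 hfx).1]

lemma IsEpsMinimizer.exists_epsMinimizes {r : ℝ} (h : IsEpsMinimizer W s p ε u Ω)
    (hΩ : IsOpen Ω) (hr : 0 < r) (hball : ball 0 (3 * r) ⊆ Ω) :
    ∃ Ω' : Set (EuclideanSpace ℝ (Fin n)), MeasurableSet Ω' ∧ volume Ω' ≠ ∞ ∧ ball 0 r ⊆ Ω' ∧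
      EpsMinimizes W s p ε u Ω' := by
  obtain ⟨-, hbounded, hunbounded⟩ := h
  by_cases hΩb : Bornology.IsBounded Ω
  · exact ⟨Ω, hΩ.measurableSet, hΩb.measure_lt_top.ne,
      (ball_subset_ball (by linarith)).trans hball, hbounded hΩb⟩
  · have hclosure : closure (ball (0 : EuclideanSpace ℝ (Fin n)) (2 * r)) ⊆
        closedBall 0 (2 * r) := closure_ball_subset_closedBall
    refine ⟨ball 0 (2 * r), measurableSet_ball, measure_ball_lt_top.ne,
      ball_subset_ball (by linarith), hunbounded hΩb _ isOpen_ball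
        ((isCompact_closedBall _ _).of_isClosed_subset isClosed_closure hclosure) ?_⟩
    exact (hclosure.trans (closedBall_subset_ball (by linarith))).trans hball

end Representative

lemma exists_density_estimate {n : ℕ} [NeZero n] {s p m c₁ θs : ℝ} (hs : 0 < s) (hs₁ : s < 1)
    (hp : 1 < p) (hm : 1 < m) (hc₁ : 0 < c₁) (hθs : -1 < θs) :
    ∃ b κ : ℝ, 0 < b ∧ 0 < κ ∧ ∀ r₀ Lam c₀ : ℝ, 0 < r₀ → 1 ≤ Lam → 0 < c₀ → ∃ ct : ℝ, 0 < ct ∧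
      ∀ (lam θ q : ℝ) (W : ℝ → ℝ), IsDegeneratePotential W m lam Lam θ q c₁ → θs ≤ -1 + q →
      ∀ (Ω : Set (EuclideanSpace ℝ (Fin n))) (u : EuclideanSpace ℝ (Fin n) → ℝ), IsOpen Ω →
      ∀ ε : ℝ, ε ≤ κ * min c₀ b → IsEpsMinimizer W s p ε u Ω →
      c₀ ≤ superlevelMeasure volume θs u r₀ →
      ∀ r : ℝ, r₀ ≤ r → ball 0 (3 * r) ⊆ Ω → ct * r ^ n ≤ superlevelMeasure volume θs u r := by
  obtain ⟨K, c, hK, hc, hcontrol⟩ := exists_perimeterControl (n := n) hs hs₁ hp hm hc₁ hθs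
  obtain ⟨b, κ, hb, hκ, hgrowth⟩ := exists_mul_pow_le_superlevelMeasure
    (volume : Measure (EuclideanSpace ℝ (Fin n))) (mul_pos hs (one_pos.trans hp)) hc hK.le
  refine ⟨b, κ, hb, hκ, fun r₀ Lam c₀ hr₀ hLam hc₀ => ?_⟩
  obtain ⟨C, hC, hcontrol⟩ := hcontrol Lam hLam
  obtain ⟨ct, hct, hgrowth⟩ := hgrowth C r₀ c₀ hC hr₀ hc₀
  refine ⟨ct, hct, fun lam θ q W hW hθq Ω u hΩ ε hε hmin hu₀ r hr hball => ?_⟩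
  obtain ⟨Ω', hΩ', hΩ'fin, hrΩ', hmin'⟩ := hmin.exists_epsMinimizes hΩ (hr₀.trans_le hr) hball
  obtain ⟨w, hw, hw₁, huw⟩ := exists_measurable_abs_le_one_ae_eq hmin.1.1 hmin.1.2.2
  rw [superlevelMeasure_congr_ae huw] at hu₀ ⊢
  have hdensity := hgrowth θs ε r w hε hu₀ hr fun R hKR hRr =>
    hcontrol lam θ q W hW hθq Ω' w hΩ' hΩ'fin hw hw₁ ε (hmin'.congr_ae huw) R hKR
      ((ball_subset_ball hRr).trans hrΩ')
  rwa [finrank_euclideanSpace_fin] at hdensity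

section Superlevel

variable {α : Type*} [MeasurableSpace α] {μ : Measure α} {m θ : ℝ} {u : α → ℝ} {A B : Set α}

lemma measureReal_le_rpow_neg_mul_setIntegral (hm : 0 ≤ m) (hθ : -1 < θ) (hu : AEMeasurable u μ)
    (hu₁ : ∀ᵐ x ∂μ, |u x| ≤ 1) (hA : NullMeasurableSet A μ) (hAfin : μ A ≠ ∞)
    (hθA : ∀ x ∈ A, θ < u x) :
    μ.real A ≤ (1 + θ) ^ (-m) * ∫ x in A, |1 + u x| ^ m ∂μ := by
  have hintegrable : IntegrableOn (fun x => |1 + u x| ^ m) A μ := by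
    refine Measure.integrableOn_of_bounded (M := 2 ^ m) hAfin
      ((hu.const_add 1).abs.pow_const m).aestronglyMeasurable
      ((ae_restrict_of_ae hu₁).mono fun x hx => ?_)
    obtain ⟨hlower, hupper⟩ := abs_le.1 hx
    rw [Real.norm_of_nonneg (by positivity)]
    exact Real.rpow_le_rpow (abs_nonneg _) (abs_le.2 ⟨by linarith, by linarith⟩) hm
  rw [← integral_const_mul, ← mul_one (μ.real A), ← smul_eq_mul, ← setIntegral_const]
  refine setIntegral_mono_on₀ (integrableOn_const hAfin) (hintegrable.const_mul _) hA fun x hx => ?_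
  have hθ_pos : 0 < 1 + θ := by linarith
  have hux := hθA x hx
  rw [abs_of_pos (by linarith), Real.rpow_neg hθ_pos.le, inv_mul_eq_div,
    one_le_div (Real.rpow_pos_of_pos hθ_pos m)]
  exact Real.rpow_le_rpow hθ_pos.le (by linarith) hm

lemma measureReal_lt_le_setIntegral_add {θ₂ θt : ℝ} (hm : 0 ≤ m) (hθ : -1 < θ) (hθt : θ₂ ≤ θt)
    (hu : AEMeasurable u μ) (hu₁ : ∀ᵐ x ∂μ, |u x| ≤ 1) (hB : MeasurableSet B) (hBfin : μ B ≠ ∞) :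
    μ.real (B ∩ {x | θ < u x}) ≤
      (1 + θ) ^ (-m) * (∫ x in B ∩ {x | θ < u x ∧ u x ≤ θt}, |1 + u x| ^ m ∂μ) +
        μ.real (B ∩ {x | θ₂ < u x}) := by
  have hfin (S : Set α) : μ (B ∩ S) ≠ ∞ := measure_inter_ne_top_of_left_ne_top hBfin
  have hA : NullMeasurableSet (B ∩ {x | θ < u x ∧ u x ≤ θt}) μ :=
    hB.nullMeasurableSet.inter ((nullMeasurableSet_lt aemeasurable_const hu).inter
      (nullMeasurableSet_le hu aemeasurable_const))
  have hcover : B ∩ {x | θ < u x} ⊆ B ∩ {x | θ < u x ∧ u x ≤ θt} ∪ B ∩ {x | θ₂ < u x} :=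
    fun x hx => (le_or_gt (u x) θ₂).imp (fun h => ⟨hx.1, hx.2, h.trans hθt⟩) fun h => ⟨hx.1, h⟩
  calc μ.real (B ∩ {x | θ < u x})
      ≤ μ.real (B ∩ {x | θ < u x ∧ u x ≤ θt} ∪ B ∩ {x | θ₂ < u x}) :=
        measureReal_mono hcover (measure_union_ne_top (hfin _) (hfin _))
    _ ≤ μ.real (B ∩ {x | θ < u x ∧ u x ≤ θt}) + μ.real (B ∩ {x | θ₂ < u x}) :=
        measureReal_union_le _ _
    _ ≤ _ := by
        gcongr
        exact measureReal_le_rpow_neg_mul_setIntegral hm hθ hu hu₁ hA (hfin _) fun x hx => hx.2.1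

end Superlevel

end NonlocalPhase

end

theorem mainTheorem1_general {n : ℕ} [NeZero n] {s p m c₁ θs : ℝ} (hs : 0 < s) (hs₁ : s < 1)
    (hp : 1 < p) (hm : 1 < m) (hc₁ : 0 < c₁) (hθs : -1 < θs) :
    ∃ δ : ℝ → ℝ, (∀ c₀ : ℝ, 0 < c₀ → 0 < δ c₀) ∧
    ∀ r₀ Lam c₀ : ℝ, 0 < r₀ → 1 ≤ Lam → 0 < c₀ →
    ∃ ct : ℝ, 0 < ct ∧ ct < 1 ∧
    ∀ (lam θ q θ₁ θ₂ θt : ℝ) (W : ℝ → ℝ),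
      NonlocalPhase.IsDegeneratePotential W m lam Lam θ q c₁ →
      θs ≤ θ₁ → θs ≤ -1 + q → θ₂ ≤ θt →
    ∀ (Ω : Set (EuclideanSpace ℝ (Fin n))) (u : EuclideanSpace ℝ (Fin n) → ℝ), IsOpen Ω →
      c₀ < volume.real (Metric.ball 0 r₀ ∩ {x | θ₁ < u x}) →
    ∀ ε : ℝ, ε < δ c₀ → NonlocalPhase.IsEpsMinimizer W s p ε u Ω →
    ∀ r : ℝ, r₀ ≤ r → Metric.ball 0 (3 * r) ⊆ Ω →
      ct * r ^ n <
        (1 + θs) ^ (-m) * (∫ x in Metric.ball 0 r ∩ {x | θs < u x ∧ u x ≤ θt}, |1 + u x| ^ m)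
          + volume.real (Metric.ball 0 r ∩ {x | θ₂ < u x}) := by
  obtain ⟨b, κ, hb, hκ, hdensity⟩ :=
    NonlocalPhase.exists_density_estimate (n := n) hs hs₁ hp hm hc₁ hθs
  refine ⟨fun c₀ => κ * min c₀ b, fun c₀ hc₀ => mul_pos hκ (lt_min hc₀ hb),
    fun r₀ Lam c₀ hr₀ hLam hc₀ => ?_⟩
  obtain ⟨ct, hct, hdensity⟩ := hdensity r₀ Lam c₀ hr₀ hLam hc₀
  refine ⟨min (ct / 2) (1 / 2), by positivity, (min_le_right _ _).trans_lt (by norm_num), ?_⟩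
  intro lam θ q θ₁ θ₂ θt W hW hθ₁ hθq hθt Ω u hΩ hu₀ ε hε hmin r hr hball
  have hr_pos := hr₀.trans_le hr
  have hu₀ : c₀ ≤ NonlocalPhase.superlevelMeasure volume θs u r₀ :=
    hu₀.le.trans (measureReal_mono (inter_subset_inter_right _ fun _ hx => hθ₁.trans_lt hx)
      (measure_inter_ne_top_of_left_ne_top measure_ball_lt_top.ne))
  calc min (ct / 2) (1 / 2) * r ^ n ≤ ct / 2 * r ^ n := by gcongr; exact min_le_left _ _
    _ < ct * r ^ n := by gcongr; linarith
    _ ≤ NonlocalPhase.superlevelMeasure volume θs u r :=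
        hdensity lam θ q W hW hθq Ω u hΩ ε hε.le hmin hu₀ r hr hball
    _ ≤ _ := NonlocalPhase.measureReal_lt_le_setIntegral_add (by linarith) hθs hθt hmin.1.1
        hmin.1.2.2 measurableSet_ball measure_ball_lt_top.ne

/-- Density estimates for `ε`-minimizers. The order of the quantifiers records the dependence of the
constants: `c = c(m, θ_*)`, `δ = δ(s, n, p, m, c₁, θ_*, c₀)`, `Rs = R^*(s, n, p, m, c₁, θ_*, r₀)`,
`ct = c̃(s, n, p, m, Λ, c₁, θ_*, r₀, c₀)`. -/
theorem mainTheorem1 (m θs : ℝ) (hm : 1 < m) (hθs : -1 < θs) :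
    ∃ c : ℝ, 0 < c ∧
    ∀ (n : ℕ) (s p c₁ : ℝ), 1 ≤ n → 0 < s → s < 1 → 1 < p → p ≤ m → 0 < c₁ →
    ∃ δ : ℝ → ℝ, (∀ c₀ : ℝ, 0 < c₀ → 0 < δ c₀) ∧
    ∀ r₀ : ℝ, 0 < r₀ →
    ∃ Rs : ℝ, r₀ ≤ Rs ∧
    ∀ Lam c₀ : ℝ, 1 ≤ Lam → 0 < c₀ →
    ∃ ct : ℝ, 0 < ct ∧ ct < 1 ∧
    ∀ (lam θ q θ₁ θ₂ : ℝ) (W : ℝ → ℝ),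
      NonlocalPhase.IsDegeneratePotential W m lam Lam θ q c₁ →
      θ₁ ∈ Set.Ioc (-1) θ → θ₂ ∈ Set.Ioc (-1) θ →
      θs = min (min θ₁ θ₂) (-1 + q) →
    ∀ (Ω : Set (EuclideanSpace ℝ (Fin n))) (u : EuclideanSpace ℝ (Fin n) → ℝ),
      IsOpen Ω → u ∈ NonlocalPhase.X s p Ω →
      Metric.ball 0 r₀ ⊆ Ω →
      c₀ < MeasureTheory.volume.real (Metric.ball 0 r₀ ∩ {x | θ₁ < u x}) →
    ∀ ε : ℝ, 0 ≤ ε → ε < δ c₀ → NonlocalPhase.IsEpsMinimizer W s p ε u Ω →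
    ∀ r : ℝ, Rs ≤ r → Metric.ball 0 (3 * r) ⊆ Ω →
      ct * r ^ n <
        c * (∫ x in Metric.ball 0 r ∩ {x | θs < u x ∧ u x ≤ max (max θ₁ θ₂) (-1 + q)},
              |1 + u x| ^ m)
          + MeasureTheory.volume.real (Metric.ball 0 r ∩ {x | θ₂ < u x}) := by
  refine ⟨(1 + θs) ^ (-m), Real.rpow_pos_of_pos (by linarith) _, ?_⟩
  intro n s p c₁ hn hs hs₁ hp _ hc₁
  have : NeZero n := ⟨by lia⟩
  obtain ⟨δ, hδ, h⟩ := mainTheorem1_general (n := n) hs hs₁ hp hm hc₁ hθs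
  refine ⟨δ, hδ, fun r₀ hr₀ => ⟨r₀, le_rfl, fun Lam c₀ hLam hc₀ => ?_⟩⟩
  obtain ⟨ct, hct, hct₁, h⟩ := h r₀ Lam c₀ hr₀ hLam hc₀
  refine ⟨ct, hct, hct₁, fun lam θ q θ₁ θ₂ W hW _ _ hθs Ω u hΩ _ _ hu₀ ε _ hε => ?_⟩
  exact h lam θ q θ₁ θ₂ _ W hW (hθs.trans_le (by simp)) (hθs.trans_le (min_le_right _ _))
    (by simp) Ω u hΩ hu₀ ε hε
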